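/- **Setting.** Let $X\in\mathbb R^{d\times n}$, $\beta\in\mathbb R^d$, $Y=\beta^TX$. Train $x\mapsto W^{(2)}W^{(1)}x$ ($W^{(1)}\in\mathbb R^{h\times d}$, $W^{(2)}\in\mathbb R^{1\times h}$) by gradient descent with step size $\eta$ on $L(W)=\frac1{2n}\|W^{(2)}W^{(1)}X-Y\|^2$. Let $F_t=W^{(2)}_tW^{(1)}_tX$ and $E_t=F_t-Y$. Let $\lambda_1\ge\dots\ge\lambda_n$ and $q_1,\dots,q_n$ be the eigenvalues and orthonormal eigenvectors of $X^TX$, and $p_1,\dots,p_n$ orthonormal eigenvectors of $XX^T$ with $XX^Tp_i=\lambda_ip_i$. Fix $a\in(0,1)$, $\gamma>1$, $K\ge1$ and a sequence $\rho_n\to0$. All constants hidden in $\Theta$ and $O$ in the assumptions are bounded by $K$, and all $o(1)$ quantities there by $\rho_n$ (write $A=\Theta(B)$ for $B/K\le A\le KB$). *Data and step size.* $\lambda_1=\Theta(n)$; for some $1\le k<n$: $\lambda_i\le\lambda_{i-1}/\gamma$ for $2\le i\le k$, $\lambda_i=\Theta(n^a)$ for $i>k$, and $|\lambda_k-\frac1{n-k}\sum_{i>k}\lambda_i|\le\rho_nn^a$;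 $\|Y\|=\Theta(\sqrt n)$; $|\langle\beta/\|\beta\|,p_i\rangle|=\Theta(1/\sqrt n)$ for all $i\le n$; $\eta=\Theta(n^{-(1-a)/2})$. *Rank one.* At some iteration $t_0$, $W^{(1)}_{t_0}X=uv_{t_0}^T$ and $W^{(2)}_{t_0}=c_{t_0}u^T$ with $\|u\|=1$, and $|F_{t_0}[i]|\le\rho_n|Y[i]|$ for all $i$. Put $c_t=W^{(2)}_tu$, $v_t^T=u^TW^{(1)}_tX$, $\alpha_t=\|v_t\|^2/c_t^2$, $\Delta_t=\frac{\lambda_1}nc_t^2-\frac2\eta$. *Bounds.* For all $t\ge t_0$: $\frac{\lambda_1}nc_t^2\le\frac K\eta$, $\frac{\lambda_i}nc_t^2<\frac1\eta$ for $i\ge2$, and $\|E_t\|^2\le Kn/\eta$. *Phases.* Iteration $t$ is in Phase I (resp. II) if $\Delta_t<0$ (resp. $\Delta_t>0$) and $c_{t+1}^2>c_t^2$; it is in Phase III (resp. IV) if $\Delta_t>0$ (resp. $\Delta_t<0$) and $\langle E_t,F_t\rangle>0$, which is implied by $c_{t+1}^2<c_t^2$. Let $t_0\le T_1<t_1$,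 where $T_1$ is the last iteration of Phase I, all iterations strictly between $T_1$ and $t_1$ are in Phase II, and $t_1$ is the first iteration of Phase III. Put $\delta_0=\|E_{T_1}\|/\|Y\|$, $\delta_1=|\langle Y,q_1\rangle|/\|Y\|$, $\delta_2=\max\{\delta_0,\sqrt{\delta_1}\}$, and assume $\delta_0\le\rho_n$. **(A)** For every $c_1>0$ there is $C>0$ depending only on $a,\gamma,K,c_1$ such that for all $n\ge N$, with $N$ depending on these and on the sequence $\rho$: if the iterations $t_1,\dots,t$ are all in Phase III, $|\langle E_t,q_1\rangle|\ge c_1\delta_2\|Y\|$ and $\Delta_t>C\max\{1,\frac1{\eta n^{a/4}}\}$, then $c_{t+1}^2<c_t^2$ and $\|v_{t+1}\|^2>\|v_t\|^2$. **(B)** There is $C>0$ depending only on $a,\gamma,K$ such that for every $c_2>0$ and all $n\ge N$, with $N$ depending on $a,\gamma,K,c_2$ and the sequence $\rho$, the following holds. Let the sign of $u$ be chosen so that $c_{T_1}>0$. Suppose that Phase III, started at $t_1$, is directly followed by Phase IV, and let $t_2$ be an iteration of this Phase IV, in particular its last one. If $\|E_{t_2}\|^2\le\|E_{t_1}\|^2$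 and $\Delta_{t_1}\ge c_2\delta_2/\eta$, then $\alpha_{t_2}>\alpha_{t_1}$, $\cos(v_{t_1},Y)\ge1-C\delta_2$ and $\cos(v_{t_2},Y)\ge1-C\delta_2$. -/

import Mathlib

open Filter Topology Matrix

noncomputable section

/-- The Euclidean norm of a vector of real coordinates. -/
def l2norm {m : ℕ} (x : Fin m → ℝ) : ℝ := ‖(WithLp.toLp 2 x : EuclideanSpace ℝ (Fin m))‖

/-- The cosine of the angle between two vectors. -/
def cosAngle {m : ℕ} (x y : Fin m → ℝ) : ℝ := x ⬝ᵥ y / (l2norm x * l2norm y)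

/-- The square loss `(1 / 2n) ‖W₂ W₁ X - Y‖²` of the two-layer linear network
`x ↦ W₂ W₁ x` with scalar output; the rows `W₂` and `Y` are vectors. -/
def sqLoss {n d h : ℕ} (X : Matrix (Fin d) (Fin n) ℝ) (Y : Fin n → ℝ)
    (W₁ : Matrix (Fin h) (Fin d) ℝ) (W₂ : Fin h → ℝ) : ℝ :=
  1 / (2 * (n : ℝ)) * l2norm (W₂ ᵥ* (W₁ * X) - Y) ^ 2

/-- The matrix of partial derivatives of the loss in the entries of the first layer. -/
def gradFirst {n d h : ℕ} (X : Matrix (Fin d) (Fin n) ℝ) (Y : Fin n → ℝ)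
    (W₁ : Matrix (Fin h) (Fin d) ℝ) (W₂ : Fin h → ℝ) : Matrix (Fin h) (Fin d) ℝ :=
  Matrix.of fun i j => deriv (fun s : ℝ => sqLoss X Y (W₁ + s • Matrix.single i j (1 : ℝ)) W₂) 0

/-- The vector of partial derivatives of the loss in the entries of the second layer. -/
def gradSecond {n d h : ℕ} (X : Matrix (Fin d) (Fin n) ℝ) (Y : Fin n → ℝ)
    (W₁ : Matrix (Fin h) (Fin d) ℝ) (W₂ : Fin h → ℝ) : Fin h → ℝ :=
  fun i => deriv (fun s : ℝ => sqLoss X Y W₁ (W₂ + s • Pi.single i (1 : ℝ))) 0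

/-- The raw data of a training run with `n` data points in dimension `d` and hidden width `h`.
All properties are stated separately below. Indices are zero-based, so the largest
eigenvalue `λ₁` of the data kernel is `lam 0` and `q₁` is `q 0`. -/
structure Run (n d h : ℕ) where
  /-- data matrix -/
  X : Matrix (Fin d) (Fin n) ℝ
  /-- coefficients of the linear target -/
  β : Fin d → ℝ
  /-- learning rate -/
  η : ℝ
  /-- eigenvalues of `Xᵀ X` -/
  lam : Fin n → ℝ
  /-- eigenvectors of `Xᵀ X` -/
  q : Fin n → Fin n → ℝ
  /-- eigenvectors of `X Xᵀ` -/
  p : Fin n → Fin d → ℝ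
  /-- first layer at each iteration -/
  W₁ : ℕ → Matrix (Fin h) (Fin d) ℝ
  /-- second layer at each iteration -/
  W₂ : ℕ → Fin h → ℝ
  /-- direction of the rank-one structure of the weights -/
  u : Fin h → ℝ

namespace Run

variable {n d h : ℕ}

/-- The labels `Y = βᵀ X`. -/
def Y (R : Run n d h) : Fin n → ℝ := R.β ᵥ* R.X

/-- The network output `F_t = W₂ W₁ X`. -/
def F (R : Run n d h) (t : ℕ) : Fin n → ℝ := R.W₂ t ᵥ* (R.W₁ t * R.X)

/-- The error `E_t = F_t - Y`. -/
def E (R : Run n d h) (t : ℕ) : Fin n → ℝ := R.F t - R.Y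

/-- The coefficient `c_t` of the second layer along `u`: if `W₂ = c uᵀ` with `u` a unit vector,
this is `c`. -/
def c (R : Run n d h) (t : ℕ) : ℝ := R.W₂ t ⬝ᵥ R.u

/-- The vector `v_t`: if `W₁ X = u vᵀ` with `u` a unit vector, this is `v`. -/
def v (R : Run n d h) (t : ℕ) : Fin n → ℝ := R.u ᵥ* (R.W₁ t * R.X)

/-- The ratio `α_t = ‖v_t‖² / c_t²`. -/
def α (R : Run n d h) (t : ℕ) : ℝ := l2norm (R.v t) ^ 2 / R.c t ^ 2

/-- The approximate sharpness `(λ₁ / n) c_t²`. -/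
def sharpness [NeZero n] (R : Run n d h) (t : ℕ) : ℝ := R.lam 0 / n * R.c t ^ 2

/-- The sharpness excess `Δ_t = (λ₁ / n) c_t² - 2 / η`. -/
def excess [NeZero n] (R : Run n d h) (t : ℕ) : ℝ := R.sharpness t - 2 / R.η

/-- `δ₀ = ‖E_T‖ / ‖Y‖`, where `T` is the end of Phase I. -/
def δ₀ (R : Run n d h) (T : ℕ) : ℝ := l2norm (R.E T) / l2norm R.Y

/-- `δ₁ = |cos (Y, q₁)|`. -/
def δ₁ [NeZero n] (R : Run n d h) : ℝ := |R.Y ⬝ᵥ R.q 0| / l2norm R.Y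

/-- `δ₂ = max (δ₀, √δ₁)`. -/
def δ₂ [NeZero n] (R : Run n d h) (T : ℕ) : ℝ := max (R.δ₀ T) (Real.sqrt R.δ₁)

/-- The weights are trained by gradient descent on the square loss with step size `η`. -/
def IsGD (R : Run n d h) : Prop :=
  ∀ t, R.W₁ (t + 1) = R.W₁ t - R.η • gradFirst R.X R.Y (R.W₁ t) (R.W₂ t) ∧
    R.W₂ (t + 1) = R.W₂ t - R.η • gradSecond R.X R.Y (R.W₁ t) (R.W₂ t)

/-- `lam`, `q` are the non-increasing eigenvalues and orthonormal eigenvectors of `Xᵀ X`, and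
`p` are orthonormal eigenvectors of `X Xᵀ` for the same eigenvalues. -/
structure IsSpectral (R : Run n d h) : Prop where
  antitone : Antitone R.lam
  q_orthonormal : Orthonormal ℝ fun i => (WithLp.toLp 2 (R.q i) : EuclideanSpace ℝ (Fin n))
  q_eigen : ∀ i, (R.Xᵀ * R.X) *ᵥ R.q i = R.lam i • R.q i
  p_orthonormal : Orthonormal ℝ fun i => (WithLp.toLp 2 (R.p i) : EuclideanSpace ℝ (Fin d))
  p_eigen : ∀ i, (R.X * R.Xᵀ) *ᵥ R.p i = R.lam i • R.p i

/-- The assumptions on the data. All `Θ` and `O` constants are bounded by `K`, and all quantities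
that tend to zero are bounded by `ρ`. In one-based notation, the eigenvalues of index at most `k`
decay at least geometrically with ratio `γ`, those of index greater than `k` are of order `n ^ a`,
and `λ_k` exceeds the mean of the latter by at most `ρ n ^ a`. -/
structure DataAssumption [NeZero n] (R : Run n d h) (a γ K ρ : ℝ) : Prop where
  top : (n : ℝ) / K ≤ R.lam 0 ∧ R.lam 0 ≤ K * n
  spectrum : ∃ k : ℕ, 1 ≤ k ∧ k < n ∧
    (∀ i j : Fin n, (i : ℕ) + 1 = j → (j : ℕ) < k → R.lam j ≤ R.lam i / γ) ∧
    (∀ i : Fin n, k ≤ (i : ℕ) → (n : ℝ) ^ a / K ≤ R.lam i ∧ R.lam i ≤ K * (n : ℝ) ^ a) ∧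
    (∀ i : Fin n, (i : ℕ) + 1 = k →
      |R.lam i - (∑ j : Fin n, if k ≤ (j : ℕ) then R.lam j else 0) / ((n : ℝ) - k)| ≤ ρ * (n : ℝ) ^ a)
  label : Real.sqrt n / K ≤ l2norm R.Y ∧ l2norm R.Y ≤ K * Real.sqrt n
  target : ∀ i, 1 / (K * Real.sqrt n) ≤ |R.β ⬝ᵥ R.p i| / l2norm R.β ∧
    |R.β ⬝ᵥ R.p i| / l2norm R.β ≤ K / Real.sqrt n

/-- The learning rate has order `n ^ (-(1 - a) / 2)`. -/
def RateAssumption (R : Run n d h) (a K : ℝ) : Prop :=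
  (n : ℝ) ^ (-(1 - a) / 2) / K ≤ R.η ∧ R.η ≤ K * (n : ℝ) ^ (-(1 - a) / 2)

/-- At iteration `t₀` the weights have rank-one structure `W₁ X = u vᵀ`, `W₂ = c uᵀ` with a unit
vector `u`, and the output is small compared with the labels. -/
structure RankOneAssumption (R : Run n d h) (ρ : ℝ) (t₀ : ℕ) : Prop where
  unit : l2norm R.u = 1
  first : R.W₁ t₀ * R.X = Matrix.vecMulVec R.u (R.v t₀)
  second : R.W₂ t₀ = R.c t₀ • R.u
  small : ∀ i, |R.F t₀ i| ≤ ρ * |R.Y i|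

/-- Upper bounds on the sharpness and on the remaining eigenvalues during training. -/
def SharpnessAssumption [NeZero n] (R : Run n d h) (K : ℝ) (t₀ : ℕ) : Prop :=
  ∀ t, t₀ ≤ t → R.sharpness t ≤ K / R.η ∧ ∀ i, i ≠ 0 → R.lam i / n * R.c t ^ 2 < 1 / R.η

/-- The loss does not diverge too much, and is small at the end `T₁` of Phase I. -/
def LossAssumption (R : Run n d h) (K ρ : ℝ) (t₀ T₁ : ℕ) : Prop :=
  (∀ t, t₀ ≤ t → l2norm (R.E t) ^ 2 ≤ K * (n / R.η)) ∧ R.δ₀ T₁ ≤ ρ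

/-- All standing assumptions on a run. -/
structure Assumptions [NeZero n] (R : Run n d h) (a γ K ρ : ℝ) (t₀ T₁ : ℕ) : Prop where
  gd : R.IsGD
  spectral : R.IsSpectral
  data : R.DataAssumption a γ K ρ
  rate : R.RateAssumption a K
  rankOne : R.RankOneAssumption ρ t₀
  sharp : R.SharpnessAssumption K t₀
  loss : R.LossAssumption K ρ t₀ T₁

/-- Phase I: the sharpness is below `2 / η` and `c_t²` increases. -/
def PhaseI [NeZero n] (R : Run n d h) (t : ℕ) : Prop :=
  R.sharpness t < 2 / R.η ∧ R.c t ^ 2 < R.c (t + 1) ^ 2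

/-- Phase II: the sharpness is above `2 / η` and `c_t²` increases. -/
def PhaseII [NeZero n] (R : Run n d h) (t : ℕ) : Prop :=
  2 / R.η < R.sharpness t ∧ R.c t ^ 2 < R.c (t + 1) ^ 2

/-- Phase III: the sharpness is above `2 / η` and is in its decreasing regime `⟨E_t, F_t⟩ > 0`.
Under the rank-one structure
`c_{t+1}² = c_t² - (2η/n) ⟨E_t, F_t⟩ + (η/n)² ⟨E_t, v_t⟩²`,
so every iteration with `c_{t+1}² < c_t²` satisfies `⟨E_t, F_t⟩ > 0`; that `c_t²` really decreases
is not part of the definition. -/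
def PhaseIII [NeZero n] (R : Run n d h) (t : ℕ) : Prop :=
  2 / R.η < R.sharpness t ∧ 0 < R.E t ⬝ᵥ R.F t

/-- Phase IV: the sharpness is below `2 / η` and still in its decreasing regime. -/
def PhaseIV [NeZero n] (R : Run n d h) (t : ℕ) : Prop :=
  R.sharpness t < 2 / R.η ∧ 0 < R.E t ⬝ᵥ R.F t

/-- `T₁` is the last iteration of Phase I, it is followed by Phase II, and `t₁` is the first
iteration of Phase III. -/
def StartsPhaseIII [NeZero n] (R : Run n d h) (t₀ T₁ t₁ : ℕ) : Prop :=
  t₀ ≤ T₁ ∧ T₁ < t₁ ∧ R.PhaseI T₁ ∧ (∀ t, T₁ < t → t < t₁ → R.PhaseII t) ∧ R.PhaseIII t₁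

/-- Phase III has started at `t₁` and has lasted up to and including `t`. -/
def InPhaseIII [NeZero n] (R : Run n d h) (t₁ t : ℕ) : Prop :=
  t₁ ≤ t ∧ ∀ s, t₁ ≤ s → s ≤ t → R.PhaseIII s

/-- Phase III started at `t₁` and ended at some `T₃`, and Phase IV followed it and has lasted up to
and including `t₂`. -/
def InPhaseIV [NeZero n] (R : Run n d h) (t₁ t₂ : ℕ) : Prop :=
  ∃ T₃, R.InPhaseIII t₁ T₃ ∧ T₃ < t₂ ∧ ∀ s, T₃ < s → s ≤ t₂ → R.PhaseIV s

end Run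

end

/-!
All data are expanded in the eigenbasis `q` of the kernel and normalized by the norm of `Y`. Once
the network has rank one, gradient descent is then a scalar recursion for the modes of the error,
coupled only through the sharpness `σ = η λ₁ c² / n` and the correlation `⟨E, F⟩`.

While the sharpness grows, the error outside the leading mode decays geometrically up to a forcing
of the order of the squared leading target, and the sharpness grows so slowly that exceeding the
threshold `2` by a definite amount takes a long time. At the peak the error therefore consists of
its leading mode. For (A), this mode contributes `(σ - 2) e₀²` to the growth of `‖v‖²`, which
dominates the contributions of the other modes and of the target.

For (B), the squared distance of the sharpness to the threshold, corrected by the energy left in the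
error, is a potential which keeps the sharpness above `1` in Phase IV, so that the modes outside the
leading one stay damped there. The output is then close to a combination of the target and its
leading mode, which gives the cosines. Finally `α` is a constant multiple of `‖F‖² / σ²`, where
`‖F‖² = ‖Y‖² + 2 ⟨E, F⟩ - ‖E‖²`, and it increases because `σ` falls from well above `2` to below `2`
while the loss does not increase.
-/

section Preliminaries

variable {ι : Type*} (s : Finset ι) (f g : ι → ℝ) {A B : ℝ}

theorem sum_abs_mul_abs_le (hA : 0 ≤ A) (hB : 0 ≤ B) (hf : ∑ i ∈ s, f i ^ 2 ≤ A ^ 2)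
    (hg : ∑ i ∈ s, g i ^ 2 ≤ B ^ 2) : ∑ i ∈ s, |f i| * |g i| ≤ A * B := by
  have h := Finset.sum_mul_sq_le_sq_mul_sq s (fun i => |f i|) (fun i => |g i|)
  simp only [sq_abs] at h
  refine abs_le_of_sq_le_sq' ?_ (by positivity) |>.2
  calc _ ≤ _ := h
    _ ≤ A ^ 2 * B ^ 2 := mul_le_mul hf hg (Finset.sum_nonneg fun i _ => sq_nonneg _) (by positivity)
    _ = _ := by ring

theorem abs_sum_mul_le (hA : 0 ≤ A) (hB : 0 ≤ B) (hf : ∑ i ∈ s, f i ^ 2 ≤ A ^ 2)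
    (hg : ∑ i ∈ s, g i ^ 2 ≤ B ^ 2) : |∑ i ∈ s, f i * g i| ≤ A * B :=
  (Finset.abs_sum_le_sum_abs _ _).trans <| by
    simpa only [abs_mul] using sum_abs_mul_abs_le s f g hA hB hf hg

theorem natCast_mul_mul_one_sub_pow_le_one {x : ℝ} (h0 : 0 ≤ x) (h1 : x ≤ 1) (t : ℕ) :
    t * x * (1 - x) ^ t ≤ 1 := by
  have bernoulli : 1 + (t : ℝ) * x ≤ (1 + x) ^ t := one_add_mul_le_pow (by linarith) t
  calc t * x * (1 - x) ^ t ≤ (1 + x) ^ t * (1 - x) ^ t := by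
        gcongr; linarith
    _ = (1 - x ^ 2) ^ t := by rw [← mul_pow]; ring_nf
    _ ≤ 1 := pow_le_one₀ (by nlinarith) (by nlinarith)

theorem mul_pow_mul_le_one_of_le {L C x : ℝ} {k m : ℕ} (hL : 1 ≤ L) (hx : 0 ≤ x) (hC : 0 ≤ C)
    (hk : k ≤ m) (h : C * L ^ m * x ≤ 1) : C * L ^ k * x ≤ 1 := by
  have : L ^ k ≤ L ^ m := pow_le_pow_right₀ hL hk
  refine le_trans ?_ h
  gcongr

theorem half_sq_sub_sq_le_sq_add_mul {r x y : ℝ} (hr : r ^ 2 ≤ 1) :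
    y ^ 2 / 2 - x ^ 2 ≤ (y + r * x) ^ 2 := by
  have : (r * x) ^ 2 ≤ x ^ 2 := by
    rw [mul_pow]; exact mul_le_of_le_one_left (sq_nonneg x) hr
  nlinarith [sq_nonneg (y + 2 * (r * x))]

theorem sq_damped_step_le {r h e f : ℝ} (hr0 : 0 ≤ r) (hr1 : r ≤ 1) (hh0 : 0 ≤ h)
    (hh : h ≤ 1 / 4) : ((1 - r) * e + h * (f - r * e)) ^ 2 ≤
      (1 - r / 4) * e ^ 2 + 2 * h * (e * f) + 4 * h ^ 2 * f ^ 2 := by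
  have hrate : 4 / 3 * ((1 + h) ^ 2 * r ^ 2) ≤ (7 / 4 + 2 * h) * r := by
    have hr : (1 + h) ^ 2 * r ^ 2 ≤ (1 + h) ^ 2 * r :=
      mul_le_mul_of_nonneg_left (by nlinarith) (sq_nonneg _)
    have hcoeff : 4 / 3 * (1 + h) ^ 2 ≤ 7 / 4 + 2 * h := by nlinarith
    linarith [mul_le_mul_of_nonneg_right hcoeff hr0]
  linarith [mul_le_mul_of_nonneg_right hrate (sq_nonneg e), sq_nonneg ((1 + h) * r * e + 3 * h * f)]

theorem two_mul_mul_add_four_mul_sq_le {M h d : ℝ} (hM : 0 < M) (hM4 : M ≤ 1 / 4) :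
    2 * h * (-h / M + d / 4) + 4 * h ^ 2 ≤ M * d ^ 2 := by
  have hquad : 4 * h ^ 2 ≤ h ^ 2 / M := by
    rw [le_div_iff₀ hM]; nlinarith [sq_nonneg h]
  suffices -(h ^ 2 / M) + h * d / 2 ≤ M * d ^ 2 by
    have : 2 * h * (-h / M + d / 4) = -2 * (h ^ 2 / M) + h * d / 2 := by ring
    linarith
  rw [show -(h ^ 2 / M) + h * d / 2 = (-h ^ 2 + h * d / 2 * M) / M by field_simp,
    div_le_iff₀ hM]
  nlinarith [sq_nonneg (h - M * d / 4), sq_nonneg (M * d)]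

theorem lead_corr_succ_le {L h σ x y : ℝ} (hh0 : 0 ≤ h) (hh : h ≤ 1 / 4) (hσ1 : 1 ≤ σ)
    (hσL : σ ≤ L) :
    ((1 + h) * (1 - σ) * x + h * y) * ((1 + h) * (1 - σ) * x + h * y + y) ≤
      x ^ 2 + 4 * L * ((max (σ - 2) 0 + L * h) * x ^ 2) + 4 * L * (|x| * |y|) + y ^ 2 := by
  set k := (1 + h) * (σ - 1) with hk
  set w := max (σ - 2) 0 + L * h with hw
  have hL : 1 ≤ L := hσ1.trans hσL
  have hk0 : 0 ≤ k := mul_nonneg (by linarith) (by linarith)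
  have hmaxσ : σ - 2 ≤ max (σ - 2) 0 := le_max_left _ _
  have hmaxL : max (σ - 2) 0 ≤ L := max_le (by linarith) (by linarith)
  have hw0 : 0 ≤ w := by positivity
  have hkw : k ≤ 1 + w := by rw [hk, hw]; nlinarith
  have hwL : w ≤ 2 * L := by rw [hw]; nlinarith
  have hk2 : k ^ 2 ≤ 1 + 4 * L * w := by
    have : k ^ 2 ≤ (1 + w) ^ 2 := pow_le_pow_left₀ hk0 hkw 2
    nlinarith
  have hcross : -((2 * h + 1) * k * (x * y)) ≤ 4 * L * (|x| * |y|) := by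
    calc -((2 * h + 1) * k * (x * y)) = (2 * h + 1) * k * (-(x * y)) := by ring
      _ ≤ (2 * h + 1) * k * (|x| * |y|) := by
        gcongr; rw [← abs_mul]; exact neg_le_abs _
      _ ≤ 4 * L * (|x| * |y|) := mul_le_mul_of_nonneg_right (by nlinarith) (by positivity)
  have htarget : (h ^ 2 + h) * y ^ 2 ≤ y ^ 2 :=
    mul_le_of_le_one_left (sq_nonneg _) (by nlinarith)
  calc _ = k ^ 2 * x ^ 2 - (2 * h + 1) * k * (x * y) + (h ^ 2 + h) * y ^ 2 := by rw [hk]; ring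
    _ ≤ _ := by linarith [mul_le_mul_of_nonneg_right hk2 (sq_nonneg x)]

theorem edge_gap_succ {D D' g k : ℝ} (hD0 : 0 ≤ D) (hD1 : D ≤ 1) (hg0 : 0 ≤ g) (hg1 : g ≤ 1)
    (hgk : g ≤ 2 * k) (hD' : D' = 2 - (2 - D) * (1 - g) ^ 2) :
    g ≤ D' - D ∧ D' ^ 2 - D ^ 2 ≤ 8 * g * D + 8 * k * (D' - D) := by
  have hgap : D' - D = (2 - D) * (g * (2 - g)) := by rw [hD']; ring
  have hg_le : g ≤ D' - D := by
    rw [hgap]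
    nlinarith [mul_nonneg hg0 (by linarith : 0 ≤ 1 - g), mul_nonneg hg0 (by linarith : 0 ≤ 1 - D),
      mul_nonneg (mul_nonneg hg0 (by linarith : 0 ≤ 1 - g)) (by linarith : 0 ≤ 1 - D)]
  have hgap_le : D' - D ≤ 4 * g := by
    rw [hgap]
    nlinarith [mul_nonneg hg0 hD0, mul_nonneg hg0 hg0,
      mul_nonneg (mul_nonneg hg0 hg0) (by linarith : 0 ≤ 2 - D)]
  refine ⟨hg_le, ?_⟩
  calc D' ^ 2 - D ^ 2 = (D' - D) * (2 * D) + (D' - D) * (D' - D) := by ring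
    _ ≤ 4 * g * (2 * D) + 8 * k * (D' - D) := by
      refine add_le_add ?_ ?_
      · exact mul_le_mul_of_nonneg_right hgap_le (by linarith)
      · exact mul_le_mul_of_nonneg_right (by linarith) (by linarith)
    _ = _ := by ring

theorem sq_add_mul_damped_le {D g d x x' : ℝ} (hD0 : 0 ≤ D) (hD1 : D ≤ 1) (hg0 : 0 ≤ g)
    (hg1 : g ≤ 1) (hd0 : 0 ≤ d) (hd1 : d ≤ 1) (hx0 : 0 ≤ x) (hx'0 : 0 ≤ x')
    (hx' : x' ≤ (1 - D) * x + g * d) :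
    x' ^ 2 + d * x' ≤ (1 - D) * (x ^ 2 + d * x) + g * (2 * x + 2) := by
  have hdd : d * d ≤ 1 := by nlinarith
  have hlinear : d * x' ≤ (1 - D) * (d * x) + g := by
    have h1 := mul_le_mul_of_nonneg_left hx' hd0
    have h2 := mul_le_mul_of_nonneg_left hdd hg0
    linarith
  have hsq : x' ^ 2 ≤ (1 - D) * x ^ 2 + g * (2 * x + 1) := by
    have hdamp : (1 - D) * (1 - D) * x ^ 2 ≤ (1 - D) * x ^ 2 :=
      mul_le_mul_of_nonneg_right (by nlinarith) (sq_nonneg _)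
    have hcross : (1 - D) * d * x ≤ 1 * x := mul_le_mul_of_nonneg_right (by nlinarith) hx0
    have hforce : g * (d * d) ≤ 1 * 1 := mul_le_mul hg1 hdd (by positivity) zero_le_one
    calc x' ^ 2 ≤ ((1 - D) * x + g * d) ^ 2 := pow_le_pow_left₀ hx'0 hx' 2
      _ = (1 - D) * (1 - D) * x ^ 2 + g * (2 * ((1 - D) * d * x) + g * (d * d)) := by ring
      _ ≤ (1 - D) * x ^ 2 + g * (2 * (1 * x) + 1 * 1) := by gcongr
      _ = _ := by ring
  linarith

end Preliminaries

/-- Gradient descent on a rank-one two-layer linear network in normalized coordinates. The error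
and the target are expanded in the eigenbasis of the kernel and divided by the norm of the labels;
`e₀`, `y₀` are their coordinates along the leading eigenvector and `e`, `y` those along the other
ones, of relative eigenvalue `ℓ`. The sharpness `σ` is measured in units of `1 / η`, and `M` is the
coupling of the error to the sharpness. -/
structure ModeSystem (ι : Type*) where
  M : ℝ
  ℓ : ι → ℝ
  y₀ : ℝ
  y : ι → ℝ
  e₀ : ℕ → ℝ
  e : ℕ → ι → ℝ
  σ : ℕ → ℝ

namespace ModeSystem

variable {ι : Type*} [Fintype ι]

/-- The part `∑ e (e + y)` of the correlation of error and output outside the leading mode. -/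
def tailCorr (S : ModeSystem ι) (t : ℕ) : ℝ := ∑ i, S.e t i * (S.e t i + S.y i)

/-- The correlation `⟨E, F⟩` of error and output. -/
def corr (S : ModeSystem ι) (t : ℕ) : ℝ := S.e₀ t * (S.e₀ t + S.y₀) + S.tailCorr t

/-- The squared norm of the error outside the leading mode. -/
def tailSq (S : ModeSystem ι) (t : ℕ) : ℝ := ∑ i, S.e t i ^ 2

/-- The squared norm of the error. -/
def loss (S : ModeSystem ι) (t : ℕ) : ℝ := S.e₀ t ^ 2 + S.tailSq t

/-- The squared norm of the output. -/
def outputSq (S : ModeSystem ι) (t : ℕ) : ℝ := (S.e₀ t + S.y₀) ^ 2 + ∑ i, (S.e t i + S.y i) ^ 2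

/-- The relative decrease of the second layer `c` in one step. -/
noncomputable def shrink (S : ModeSystem ι) (t : ℕ) : ℝ := S.M / S.σ t * S.corr t

/-- The gradient descent recursion in steps `0, …, N`; the second layer does not vanish before. -/
structure IsTrajectory (S : ModeSystem ι) (N : ℕ) : Prop where
  σ_pos : ∀ t ≤ N, 0 < S.σ t
  e₀_succ : ∀ t ≤ N, S.e₀ (t + 1) = (1 - S.shrink t) * (1 - S.σ t) * S.e₀ t - S.shrink t * S.y₀
  e_succ : ∀ t ≤ N, ∀ i,
    S.e (t + 1) i = (1 - S.shrink t) * (1 - S.ℓ i * S.σ t) * S.e t i - S.shrink t * S.y i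
  σ_succ : ∀ t ≤ N, S.σ (t + 1) = S.σ t * (1 - S.shrink t) ^ 2

/-- Bounds on the parameters of the system: all constants are absorbed in `L`, the step size `η` is
small, and `μ` is a lower bound for the relative eigenvalues. -/
structure IsBounded (S : ModeSystem ι) (L η μ : ℝ) : Prop where
  one_le : 1 ≤ L
  η_pos : 0 < η
  η_small : 100 * L ^ 4 * η ≤ 1
  M_pos : 0 < S.M
  M_le : S.M ≤ L * η ^ 2
  M_le_mul_μ : S.M ≤ L * μ
  μ_pos : 0 < μ
  μ_le_one : μ ≤ 1
  μ_le_ℓ : ∀ i, μ ≤ S.ℓ i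
  ℓ_le_one : ∀ i, S.ℓ i ≤ 1
  y_unit : S.y₀ ^ 2 + ∑ i, S.y i ^ 2 = 1
  σ_le : ∀ t, S.σ t ≤ L
  ℓ_mul_σ_le_one : ∀ t i, S.ℓ i * S.σ t ≤ 1
  loss_le : ∀ t, S.loss t ≤ L / η

/-- The sharpness rises from below to above `2` and keeps growing until time `T`. Initially the
error is at most `δ`, and the target is nearly orthogonal to the leading mode. -/
structure IsSharpening (S : ModeSystem ι) (L η μ δ : ℝ) (T : ℕ) : Prop
    extends S.IsBounded L η μ, S.IsTrajectory T where
  T_pos : 0 < T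
  δ_nonneg : 0 ≤ δ
  δ_small : 100 * L ^ 4 * δ ≤ 1
  abs_y₀_le : |S.y₀| ≤ δ ^ 2
  loss_zero_le : S.loss 0 ≤ δ ^ 2
  σ_zero_lt : S.σ 0 < 2
  σ_zero_lt_σ_one : S.σ 0 < S.σ 1
  grow : ∀ t, 0 < t → t < T → 2 < S.σ t ∧ S.σ t < S.σ (t + 1)
  two_lt_σ_last : 2 < S.σ T

variable {S : ModeSystem ι} {L η μ δ : ℝ} {N T t : ℕ}

theorem tailSq_nonneg (S : ModeSystem ι) (t : ℕ) : 0 ≤ S.tailSq t :=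
  Finset.sum_nonneg fun _ _ => sq_nonneg _

theorem loss_nonneg (S : ModeSystem ι) (t : ℕ) : 0 ≤ S.loss t :=
  add_nonneg (sq_nonneg _) (S.tailSq_nonneg t)

theorem tailSq_le_loss (S : ModeSystem ι) (t : ℕ) : S.tailSq t ≤ S.loss t :=
  le_add_of_nonneg_left (sq_nonneg _)

theorem sq_e₀_le_loss (S : ModeSystem ι) (t : ℕ) : S.e₀ t ^ 2 ≤ S.loss t :=
  le_add_of_nonneg_right (S.tailSq_nonneg t)

theorem tailCorr_eq (S : ModeSystem ι) (t : ℕ) :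
    S.tailCorr t = S.tailSq t + ∑ i, S.e t i * S.y i := by
  rw [tailCorr, tailSq, ← Finset.sum_add_distrib]
  exact Finset.sum_congr rfl fun i _ => by ring

theorem corr_eq (S : ModeSystem ι) (t : ℕ) :
    S.corr t = S.loss t + (S.e₀ t * S.y₀ + ∑ i, S.e t i * S.y i) := by
  rw [corr, tailCorr_eq, loss]; ring

namespace IsTrajectory

theorem output₀_succ (hS : S.IsTrajectory N) (ht : t ≤ N) :
    S.e₀ (t + 1) + S.y₀ = (1 - S.shrink t) * (S.y₀ + (1 - S.σ t) * S.e₀ t) := by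
  rw [hS.e₀_succ t ht]; ring

theorem output_succ (hS : S.IsTrajectory N) (ht : t ≤ N) (i : ι) :
    S.e (t + 1) i + S.y i = (1 - S.shrink t) * (S.y i + (1 - S.ℓ i * S.σ t) * S.e t i) := by
  rw [hS.e_succ t ht]; ring

end IsTrajectory

namespace IsBounded

theorem ℓ_pos (hB : S.IsBounded L η μ) (i : ι) : 0 < S.ℓ i := hB.μ_pos.trans_le (hB.μ_le_ℓ i)

theorem sum_sq_y_le_one (hB : S.IsBounded L η μ) : ∑ i, S.y i ^ 2 ≤ 1 := by
  linarith [hB.y_unit, sq_nonneg S.y₀]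

theorem outputSq_eq (hB : S.IsBounded L η μ) (t : ℕ) :
    S.outputSq t = 1 + 2 * S.corr t - S.loss t := by
  have hsum : ∑ i, (S.e t i + S.y i) ^ 2 =
      S.tailSq t + 2 * ∑ i, S.e t i * S.y i + ∑ i, S.y i ^ 2 := by
    rw [tailSq, Finset.mul_sum, ← Finset.sum_add_distrib, ← Finset.sum_add_distrib]
    exact Finset.sum_congr rfl fun i _ => by ring
  rw [outputSq, hsum, corr_eq, loss]
  linear_combination hB.y_unit

theorem abs_corr_le (hB : S.IsBounded L η μ) {B : ℝ} (h0 : 0 ≤ B) (h : S.loss t ≤ B ^ 2) :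
    |S.corr t| ≤ B ^ 2 + B := by
  have hinner : |S.e₀ t * S.y₀ + ∑ i, S.e t i * S.y i| ≤ B := by
    simpa [Fintype.sum_option] using abs_sum_mul_le Finset.univ
      (fun j : Option ι => j.elim (S.e₀ t) (S.e t)) (fun j => j.elim S.y₀ S.y) h0 zero_le_one
      (by simpa [Fintype.sum_option, loss, tailSq] using h)
      (by simp [Fintype.sum_option, hB.y_unit])
  rw [corr_eq]
  refine (abs_add_le _ _).trans (add_le_add ?_ hinner)
  rwa [abs_of_nonneg (S.loss_nonneg t)]

theorem hundred_mul_η_le_one (hB : S.IsBounded L η μ) : 100 * η ≤ 1 := by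
  simpa using mul_pow_mul_le_one_of_le hB.one_le hB.η_pos.le (by norm_num) (Nat.zero_le 4)
    hB.η_small

theorem one_le_div (hB : S.IsBounded L η μ) : 1 ≤ L / η := by
  rw [le_div_iff₀ hB.η_pos]
  linarith [hB.hundred_mul_η_le_one, hB.η_pos, hB.one_le]

theorem abs_corr_le_div (hB : S.IsBounded L η μ) (t : ℕ) : |S.corr t| ≤ 2 * (L / η) := by
  have h1 := hB.one_le_div
  have h2 := hB.abs_corr_le (Real.sqrt_nonneg (L / η)) (t := t)
    (by rw [Real.sq_sqrt (by linarith)]; exact hB.loss_le t)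
  rw [Real.sq_sqrt (by linarith)] at h2
  have : √(L / η) ≤ L / η := (Real.sqrt_le_left (by linarith)).2 (by nlinarith)
  linarith

theorem abs_shrink_le (hB : S.IsBounded L η μ) (hσ : 1 ≤ S.σ t) :
    |S.shrink t| ≤ 2 * L ^ 2 * η := by
  have hη := hB.η_pos
  have hL := hB.one_le
  have hM := hB.M_pos
  have hMσ : S.M / S.σ t ≤ L * η ^ 2 := (div_le_self hM.le hσ).trans hB.M_le
  rw [shrink, abs_mul, abs_of_nonneg (by positivity)]
  calc _ ≤ L * η ^ 2 * (2 * (L / η)) :=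
        mul_le_mul hMσ (hB.abs_corr_le_div t) (abs_nonneg _) (by positivity)
    _ = _ := by field_simp

theorem abs_shrink_le_quarter (hB : S.IsBounded L η μ) (hσ : 1 ≤ S.σ t) :
    |S.shrink t| ≤ 1 / 4 := by
  have h := mul_pow_mul_le_one_of_le hB.one_le hB.η_pos.le (by norm_num) (by norm_num : 2 ≤ 4)
    hB.η_small
  linarith [hB.abs_shrink_le hσ]

theorem M_le_quarter (hB : S.IsBounded L η μ) : S.M ≤ 1 / 4 := by
  have h := mul_pow_mul_le_one_of_le hB.one_le hB.η_pos.le (by norm_num) (by norm_num : 1 ≤ 4)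
    hB.η_small
  nlinarith [hB.M_le, hB.η_pos, hB.hundred_mul_η_le_one]

theorem outputSq_le (hB : S.IsBounded L η μ) (t : ℕ) : S.outputSq t ≤ 4 * (L / η) := by
  have hmode (x y : ℝ) : (x + y) ^ 2 ≤ 2 * x ^ 2 + 2 * y ^ 2 := by nlinarith [sq_nonneg (x - y)]
  have hsum : ∑ i, (S.e t i + S.y i) ^ 2 ≤ 2 * S.tailSq t + 2 * ∑ i, S.y i ^ 2 := by
    rw [tailSq, Finset.mul_sum, Finset.mul_sum, ← Finset.sum_add_distrib]
    exact Finset.sum_le_sum fun i _ => hmode _ _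
  have hloss := hB.loss_le t
  rw [loss] at hloss
  rw [outputSq]
  linarith [hmode (S.e₀ t) S.y₀, hB.y_unit, hB.one_le_div]

theorem quarter_mul_sq_le_outputSq_succ (hB : S.IsBounded L η μ) (hS : S.IsTrajectory N)
    (ht : t ≤ N) (hσ : S.σ t ≤ 2) (hloss : S.loss t ≤ 1 / 4) :
    (1 - S.shrink t) ^ 2 * (1 / 4) ≤ S.outputSq (t + 1) := by
  have hσ0 := hS.σ_pos t ht
  have hmode (i) : (1 - S.shrink t) ^ 2 * (S.y i ^ 2 / 2 - S.e t i ^ 2) ≤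
      (S.e (t + 1) i + S.y i) ^ 2 := by
    have hr : 0 ≤ S.ℓ i * S.σ t := mul_nonneg (hB.ℓ_pos i).le hσ0.le
    rw [hS.output_succ ht, mul_pow]
    gcongr
    exact half_sq_sub_sq_le_sq_add_mul (by nlinarith [hB.ℓ_mul_σ_le_one t i])
  have hlead : (1 - S.shrink t) ^ 2 * (S.y₀ ^ 2 / 2 - S.e₀ t ^ 2) ≤ (S.e₀ (t + 1) + S.y₀) ^ 2 := by
    rw [hS.output₀_succ ht, mul_pow]
    gcongr
    exact half_sq_sub_sq_le_sq_add_mul (by nlinarith)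
  calc (1 - S.shrink t) ^ 2 * (1 / 4)
      ≤ (1 - S.shrink t) ^ 2 * ((S.y₀ ^ 2 + ∑ i, S.y i ^ 2) / 2 - S.loss t) := by
        gcongr; linarith [hB.y_unit]
    _ = (1 - S.shrink t) ^ 2 * (S.y₀ ^ 2 / 2 - S.e₀ t ^ 2) +
        ∑ i, (1 - S.shrink t) ^ 2 * (S.y i ^ 2 / 2 - S.e t i ^ 2) := by
        rw [← Finset.mul_sum, Finset.sum_sub_distrib, ← Finset.sum_div, loss, tailSq]; ring
    _ ≤ S.outputSq (t + 1) := add_le_add hlead (Finset.sum_le_sum fun i _ => hmode i)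

theorem decay_nonneg (hB : S.IsBounded L η μ) (t : ℕ) : 0 ≤ (1 - μ / 8) ^ t :=
  pow_nonneg (by linarith [hB.μ_le_one]) t

theorem decay_le_one (hB : S.IsBounded L η μ) (t : ℕ) : (1 - μ / 8) ^ t ≤ 1 :=
  pow_le_one₀ (by linarith [hB.μ_le_one]) (by linarith [hB.μ_pos])

theorem abs_sum_mul_y_le (hB : S.IsBounded L η μ) {B : ℝ} (h0 : 0 ≤ B) (h : S.tailSq t ≤ B ^ 2) :
    |∑ i, S.e t i * S.y i| ≤ B := by
  simpa using abs_sum_mul_le _ (S.e t) S.y h0 zero_le_one h (by simpa using hB.sum_sq_y_le_one)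

end IsBounded

/-- The bound `δ (1 - μ / 8) ^ t + 3 L y₀²` for the error outside the leading mode while the
sharpness grows. -/
noncomputable def decayBound (S : ModeSystem ι) (L μ δ : ℝ) (t : ℕ) : ℝ :=
  δ * (1 - μ / 8) ^ t + 3 * L * S.y₀ ^ 2

namespace IsSharpening

theorem two_lt_σ_one (hS : S.IsSharpening L η μ δ T) : 2 < S.σ 1 := by
  rcases Nat.lt_or_ge 1 T with h | h
  · exact (hS.grow 1 one_pos h).1
  · exact le_antisymm h hS.T_pos ▸ hS.two_lt_σ_last

theorem mul_δ_le (hS : S.IsSharpening L η μ δ T) {k : ℕ} (hk : k ≤ 4) : 100 * L ^ k * δ ≤ 1 :=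
  mul_pow_mul_le_one_of_le hS.one_le hS.δ_nonneg (by norm_num) hk hS.δ_small

theorem hundred_mul_δ_le_one (hS : S.IsSharpening L η μ δ T) : 100 * δ ≤ 1 := by
  simpa using hS.mul_δ_le (Nat.zero_le 4)

theorem η_le_σ_zero (hS : S.IsSharpening L η μ δ T) : η ≤ 8 * L * S.σ 0 := by
  have hσ := hS.σ_pos 0 (Nat.zero_le _)
  have houtput := (hS.toIsBounded.quarter_mul_sq_le_outputSq_succ hS.toIsTrajectory (Nat.zero_le _)
    hS.σ_zero_lt.le (by nlinarith [hS.loss_zero_le, hS.hundred_mul_δ_le_one, hS.δ_nonneg])).trans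
    (hS.outputSq_le 1)
  have hσ₁ := hS.two_lt_σ_one
  have hsucc := hS.σ_succ 0 (Nat.zero_le _)
  rw [zero_add] at hsucc
  rw [hsucc] at hσ₁
  have : (1 - S.shrink 0) ^ 2 * η ≤ 16 * L := by
    rw [← le_div_iff₀ hS.η_pos, mul_div_assoc]; linarith
  nlinarith [hS.η_pos]

theorem abs_shrink_zero_le (hS : S.IsSharpening L η μ δ T) : |S.shrink 0| ≤ 1 / 4 := by
  have hη := hS.η_pos
  have hL := hS.one_le
  have hM := hS.M_pos
  have hσ := hS.σ_pos 0 (Nat.zero_le _)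
  have hcorr : |S.corr 0| ≤ 1 / 4 := by
    nlinarith [hS.abs_corr_le hS.δ_nonneg hS.loss_zero_le, hS.δ_nonneg, hS.hundred_mul_δ_le_one]
  have hMσ : S.M / S.σ 0 ≤ 8 * L ^ 2 * η := by
    rw [div_le_iff₀ hσ]
    calc S.M ≤ L * η * η := hS.M_le.trans_eq (by ring)
      _ ≤ L * η * (8 * L * S.σ 0) := by gcongr; exact hS.η_le_σ_zero
      _ = 8 * L ^ 2 * η * S.σ 0 := by ring
  have hη₂ := mul_pow_mul_le_one_of_le hL hη.le (by norm_num) (by norm_num : 2 ≤ 4) hS.η_small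
  rw [shrink, abs_mul, abs_of_nonneg (by positivity)]
  calc S.M / S.σ 0 * |S.corr 0| ≤ 1 * (1 / 4) := by gcongr; linarith
    _ = 1 / 4 := one_mul _

theorem one_le_σ_zero (hS : S.IsSharpening L η μ δ T) : 1 ≤ S.σ 0 := by
  have hshrink := abs_le.1 hS.abs_shrink_zero_le
  have hσ₁ := hS.two_lt_σ_one
  have hsucc := hS.σ_succ 0 (Nat.zero_le _)
  rw [zero_add] at hsucc
  rw [hsucc] at hσ₁
  have : (1 - S.shrink 0) ^ 2 ≤ 2 := by nlinarith
  nlinarith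

theorem one_le_σ (hS : S.IsSharpening L η μ δ T) (ht : t ≤ T) : 1 ≤ S.σ t := by
  rcases Nat.eq_zero_or_pos t with rfl | h
  · exact hS.one_le_σ_zero
  · rcases ht.lt_or_eq with h' | rfl
    · linarith [(hS.grow t h h').1]
    · linarith [hS.two_lt_σ_last]

theorem shrink_neg (hS : S.IsSharpening L η μ δ T) (ht : t < T) : S.shrink t < 0 := by
  have hgrow : S.σ t < S.σ (t + 1) := by
    rcases Nat.eq_zero_or_pos t with rfl | h
    · exact hS.σ_zero_lt_σ_one
    · exact (hS.grow t h ht).2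
  have hσ := hS.one_le_σ ht.le
  have hshrink := abs_le.1 (hS.abs_shrink_le_quarter hσ)
  rw [hS.σ_succ t ht.le] at hgrow
  by_contra! h
  have : (1 - S.shrink t) ^ 2 ≤ 1 := by nlinarith [hshrink.2]
  nlinarith

theorem corr_neg (hS : S.IsSharpening L η μ δ T) (ht : t < T) : S.corr t < 0 := by
  by_contra! h
  have hσ := hS.one_le_σ ht.le
  exact (hS.shrink_neg ht).not_ge (mul_nonneg (div_nonneg hS.M_pos.le (by linarith)) h)

theorem neg_shrink_le_quarter (hS : S.IsSharpening L η μ δ T) (ht : t ≤ T) :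
    -S.shrink t ≤ 1 / 4 :=
  (neg_le_abs _).trans (hS.abs_shrink_le_quarter (hS.one_le_σ ht))

theorem tailSq_succ_le_add_tailCorr (hS : S.IsSharpening L η μ δ T) (ht : t < T) :
    S.tailSq (t + 1) ≤
      (1 - μ / 4) * S.tailSq t + 2 * -S.shrink t * S.tailCorr t + 4 * (-S.shrink t) ^ 2 := by
  have hσ := hS.one_le_σ ht.le
  set h := -S.shrink t with hh
  have h0 : 0 ≤ h := neg_nonneg.2 (hS.shrink_neg ht).le
  have hmode (i) : S.e (t + 1) i ^ 2 ≤ (1 - μ / 4) * S.e t i ^ 2 +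
      2 * h * (S.e t i * (S.e t i + S.y i)) + 4 * h ^ 2 * (S.e t i + S.y i) ^ 2 := by
    have hr : μ ≤ S.ℓ i * S.σ t := by nlinarith [hS.μ_le_ℓ i, hS.μ_pos]
    have hstep := sq_damped_step_le (e := S.e t i) (f := S.e t i + S.y i) (hS.μ_pos.le.trans hr)
      (hS.ℓ_mul_σ_le_one t i) h0 (hS.neg_shrink_le_quarter ht.le)
    have hsucc : S.e (t + 1) i = (1 - S.ℓ i * S.σ t) * S.e t i +
        h * (S.e t i + S.y i - S.ℓ i * S.σ t * S.e t i) := by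
      rw [hS.e_succ t ht.le, hh]; ring
    rw [hsucc]
    nlinarith [mul_le_mul_of_nonneg_right hr (sq_nonneg (S.e t i))]
  have houtput : ∑ i, (S.e t i + S.y i) ^ 2 ≤ 1 := by
    have := hS.outputSq_eq t
    rw [outputSq] at this
    linarith [S.loss_nonneg t, hS.corr_neg ht, sq_nonneg (S.e₀ t + S.y₀)]
  calc S.tailSq (t + 1) ≤ _ := Finset.sum_le_sum fun i _ => hmode i
    _ = (1 - μ / 4) * S.tailSq t + 2 * h * S.tailCorr t +
        4 * h ^ 2 * ∑ i, (S.e t i + S.y i) ^ 2 := by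
      simp only [Finset.sum_add_distrib, ← Finset.mul_sum, tailSq, tailCorr]
    _ ≤ _ := add_le_add_right (mul_le_of_le_one_right (by positivity) houtput) _

theorem tailCorr_le (hS : S.IsSharpening L η μ δ T) (ht : t < T) :
    S.tailCorr t ≤ S.shrink t / S.M + S.y₀ ^ 2 / 4 := by
  have hσ := hS.one_le_σ ht.le
  have hM := hS.M_pos
  have hcorr : S.corr t ≤ S.shrink t / S.M := by
    have : S.shrink t / S.M = S.corr t / S.σ t := by rw [shrink]; field_simp
    rw [this, le_div_iff₀ (by linarith)]
    nlinarith [hS.corr_neg ht]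
  rw [corr] at hcorr
  nlinarith [sq_nonneg (S.e₀ t + S.y₀ / 2)]

theorem tailSq_succ_le (hS : S.IsSharpening L η μ δ T) (ht : t < T) :
    S.tailSq (t + 1) ≤ (1 - μ / 4) * S.tailSq t + S.M * S.y₀ ^ 4 := by
  have hh : 0 ≤ -S.shrink t := neg_nonneg.2 (hS.shrink_neg ht).le
  have hcorr : 2 * -S.shrink t * S.tailCorr t ≤
      2 * -S.shrink t * (-(-S.shrink t) / S.M + S.y₀ ^ 2 / 4) := by
    rw [neg_neg]
    exact mul_le_mul_of_nonneg_left (hS.tailCorr_le ht) (by linarith)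
  have hsq := two_mul_mul_add_four_mul_sq_le (d := S.y₀ ^ 2) (h := -S.shrink t) hS.M_pos
    hS.M_le_quarter
  rw [← pow_mul] at hsq
  linarith [hS.tailSq_succ_le_add_tailCorr ht]

theorem tailSq_le_geometric (hS : S.IsSharpening L η μ δ T) (ht : t ≤ T) :
    S.tailSq t ≤ δ ^ 2 * (1 - μ / 4) ^ t + 4 * L * S.y₀ ^ 4 := by
  have hL := hS.one_le
  induction t with
  | zero =>
    have : 0 ≤ 4 * L * S.y₀ ^ 4 := by positivity
    simpa using by linarith [(S.tailSq_le_loss 0).trans hS.loss_zero_le]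
  | succ t ih =>
    have hM : S.M * S.y₀ ^ 4 ≤ L * μ * S.y₀ ^ 4 :=
      mul_le_mul_of_nonneg_right hS.M_le_mul_μ (by positivity)
    have hμ := hS.μ_le_one
    calc S.tailSq (t + 1) ≤ (1 - μ / 4) * S.tailSq t + S.M * S.y₀ ^ 4 := hS.tailSq_succ_le ht
      _ ≤ (1 - μ / 4) * (δ ^ 2 * (1 - μ / 4) ^ t + 4 * L * S.y₀ ^ 4) + L * μ * S.y₀ ^ 4 := by
        gcongr
        · linarith
        · exact ih (by omega)
      _ = _ := by ring

theorem tailSq_le_sq (hS : S.IsSharpening L η μ δ T) (ht : t ≤ T) :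
    S.tailSq t ≤ (δ * (1 - μ / 8) ^ t + 2 * L * S.y₀ ^ 2) ^ 2 := by
  have hL := hS.one_le
  have hμ := hS.μ_le_one
  have hp := hS.decay_nonneg t
  have hdecay : (1 - μ / 4) ^ t ≤ ((1 - μ / 8) ^ t) ^ 2 := by
    rw [← pow_mul, mul_comm t 2, pow_mul]
    exact pow_le_pow_left₀ (by linarith) (by nlinarith [sq_nonneg μ]) t
  have hy : 4 * L * S.y₀ ^ 4 ≤ (2 * L * S.y₀ ^ 2) ^ 2 := by
    have : L ≤ L ^ 2 := by nlinarith
    calc 4 * L * S.y₀ ^ 4 ≤ 4 * L ^ 2 * S.y₀ ^ 4 := by gcongr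
      _ = _ := by ring
  have hcross : 0 ≤ δ * (1 - μ / 8) ^ t * (2 * L * S.y₀ ^ 2) :=
    mul_nonneg (mul_nonneg hS.δ_nonneg hp) (by positivity)
  calc S.tailSq t ≤ δ ^ 2 * (1 - μ / 4) ^ t + 4 * L * S.y₀ ^ 4 := hS.tailSq_le_geometric ht
    _ ≤ δ ^ 2 * ((1 - μ / 8) ^ t) ^ 2 + (2 * L * S.y₀ ^ 2) ^ 2 := by gcongr
    _ ≤ _ := by linarith [add_sq (δ * (1 - μ / 8) ^ t) (2 * L * S.y₀ ^ 2)]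

theorem y₀_sq_le (hS : S.IsSharpening L η μ δ T) : S.y₀ ^ 2 ≤ δ ^ 4 := by
  rw [← sq_abs, show δ ^ 4 = (δ ^ 2) ^ 2 by ring]
  exact pow_le_pow_left₀ (abs_nonneg _) hS.abs_y₀_le 2

theorem abs_y₀_le_δ (hS : S.IsSharpening L η μ δ T) : |S.y₀| ≤ δ :=
  hS.abs_y₀_le.trans (by nlinarith [hS.hundred_mul_δ_le_one, hS.δ_nonneg])

theorem three_mul_y₀_sq_le (hS : S.IsSharpening L η μ δ T) : 3 * L * S.y₀ ^ 2 ≤ δ := by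
  have hδ := hS.hundred_mul_δ_le_one
  have hδ0 := hS.δ_nonneg
  have hL := hS.one_le
  have hLδ : 3 * L * δ ≤ 1 := by linarith [hS.mul_δ_le (show 1 ≤ 4 by norm_num)]
  calc 3 * L * S.y₀ ^ 2 ≤ 3 * L * δ ^ 4 := by gcongr; exact hS.y₀_sq_le
    _ = (3 * L * δ) * δ ^ 3 := by ring
    _ ≤ 1 * δ ^ 3 := by gcongr
    _ ≤ δ := by rw [one_mul]; exact pow_le_of_le_one hδ0 (by linarith) (by norm_num)

theorem decayBound_nonneg (hS : S.IsSharpening L η μ δ T) (t : ℕ) :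
    0 ≤ S.decayBound L μ δ t := by
  have h1 := hS.decay_nonneg t
  have h2 := hS.one_le
  have h3 := hS.δ_nonneg
  unfold decayBound; positivity

theorem decayBound_le (hS : S.IsSharpening L η μ δ T) (t : ℕ) :
    S.decayBound L μ δ t ≤ 2 * δ := by
  have := mul_le_of_le_one_right hS.δ_nonneg (hS.decay_le_one t)
  unfold decayBound; linarith [hS.three_mul_y₀_sq_le]

theorem mul_decayBound_le (hS : S.IsSharpening L η μ δ T) (t : ℕ) :
    L * S.decayBound L μ δ t ≤ 1 / 50 := by
  have := mul_le_mul_of_nonneg_left (hS.decayBound_le t) (by linarith [hS.one_le] : 0 ≤ L)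
  linarith [hS.mul_δ_le (show 1 ≤ 4 by norm_num)]

theorem tailSq_le (hS : S.IsSharpening L η μ δ T) (ht : t ≤ T) :
    S.tailSq t ≤ S.decayBound L μ δ t ^ 2 := by
  refine (hS.tailSq_le_sq ht).trans ?_
  have hp := mul_nonneg hS.δ_nonneg (hS.decay_nonneg t)
  have hL := hS.one_le
  unfold decayBound
  gcongr
  norm_num

theorem neg_shrink_le (hS : S.IsSharpening L η μ δ T) (ht : t < T) :
    -S.shrink t ≤ S.M * S.decayBound L μ δ t := by
  have hp := mul_nonneg hS.δ_nonneg (hS.decay_nonneg t)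
  have hL := hS.one_le
  have hσ := hS.one_le_σ ht.le
  have htail := (abs_le.1 (hS.abs_sum_mul_y_le (by positivity) (hS.tailSq_le_sq ht.le))).1
  have hcorr : -S.corr t ≤ S.decayBound L μ δ t := by
    have : S.y₀ ^ 2 ≤ L * S.y₀ ^ 2 := le_mul_of_one_le_left (sq_nonneg _) hL
    rw [corr, tailCorr_eq, decayBound]
    nlinarith [sq_nonneg (S.e₀ t + S.y₀ / 2), S.tailSq_nonneg t]
  calc -S.shrink t = S.M / S.σ t * (-S.corr t) := by rw [shrink]; ring
    _ ≤ S.M * S.decayBound L μ δ t :=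
      mul_le_mul (div_le_self hS.M_pos.le hσ) hcorr (by linarith [hS.corr_neg ht]) hS.M_pos.le

theorem neg_shrink_le_ℓ (hS : S.IsSharpening L η μ δ T) (ht : t < T) (i : ι) :
    -S.shrink t ≤ S.ℓ i / 50 := by
  have hb := hS.decayBound_nonneg t
  have hL := hS.one_le
  calc -S.shrink t ≤ L * μ * S.decayBound L μ δ t :=
        (hS.neg_shrink_le ht).trans (mul_le_mul_of_nonneg_right hS.M_le_mul_μ hb)
    _ = μ * (L * S.decayBound L μ δ t) := by ring
    _ ≤ S.ℓ i * (1 / 50) :=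
      mul_le_mul (hS.μ_le_ℓ i) (hS.mul_decayBound_le t) (by positivity) (hS.ℓ_pos i).le
    _ = _ := by ring

theorem abs_e_succ_le (hS : S.IsSharpening L η μ δ T) (ht : t < T) (i : ι) :
    |S.e (t + 1) i| ≤
      (1 - S.ℓ i / 2) * |S.e t i| + S.M * S.decayBound L μ δ t * |S.y i| := by
  have hℓ := hS.ℓ_pos i
  have hshrink := hS.shrink_neg ht
  have hr1 := hS.ℓ_mul_σ_le_one t i
  have hr0 : S.ℓ i ≤ S.ℓ i * S.σ t := le_mul_of_one_le_right hℓ.le (hS.one_le_σ ht.le)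
  have hfac0 : 0 ≤ (1 - S.shrink t) * (1 - S.ℓ i * S.σ t) :=
    mul_nonneg (by linarith) (by linarith)
  have hfac : (1 - S.shrink t) * (1 - S.ℓ i * S.σ t) ≤ 1 - S.ℓ i / 2 := by
    calc _ ≤ (1 + S.ℓ i / 50) * (1 - S.ℓ i) := by
          apply mul_le_mul <;> linarith [hS.neg_shrink_le_ℓ ht i]
      _ ≤ _ := by nlinarith
  rw [hS.e_succ t ht.le]
  refine (abs_sub _ _).trans ?_
  rw [abs_mul, abs_mul (S.shrink t), abs_of_nonneg hfac0, abs_of_neg hshrink]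
  gcongr
  exact hS.neg_shrink_le ht

theorem mul_decayBound_le_succ (hS : S.IsSharpening L η μ δ T) (i : ι) (t : ℕ) :
    (1 - S.ℓ i / 4) * S.decayBound L μ δ t ≤ S.decayBound L μ δ (t + 1) := by
  have hℓ := hS.μ_le_ℓ i
  have hμ := hS.μ_pos
  have h1 := mul_nonneg hS.δ_nonneg (hS.decay_nonneg t)
  have h2 : 0 ≤ 3 * L * S.y₀ ^ 2 := by have := hS.one_le; positivity
  rw [decayBound, decayBound, pow_succ (1 - μ / 8)]
  nlinarith

theorem ℓ_mul_abs_e_le (hS : S.IsSharpening L η μ δ T) (i : ι) (ht : t ≤ T) :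
    S.ℓ i * |S.e t i| ≤ S.ℓ i * (1 - S.ℓ i / 2) ^ t * |S.e 0 i| +
      4 * S.M * S.decayBound L μ δ t * |S.y i| := by
  have hℓ := hS.ℓ_pos i
  have hℓ1 := hS.ℓ_le_one i
  have hM := hS.M_pos
  induction t with
  | zero =>
    have := hS.decayBound_nonneg 0
    simpa using (by positivity : 0 ≤ 4 * S.M * S.decayBound L μ δ 0 * |S.y i|)
  | succ t ih =>
    calc S.ℓ i * |S.e (t + 1) i|
        ≤ S.ℓ i * ((1 - S.ℓ i / 2) * |S.e t i| + S.M * S.decayBound L μ δ t * |S.y i|) := by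
          gcongr; exact hS.abs_e_succ_le ht i
      _ = (1 - S.ℓ i / 2) * (S.ℓ i * |S.e t i|) +
          S.ℓ i * (S.M * S.decayBound L μ δ t * |S.y i|) := by ring
      _ ≤ (1 - S.ℓ i / 2) * (S.ℓ i * (1 - S.ℓ i / 2) ^ t * |S.e 0 i| +
          4 * S.M * S.decayBound L μ δ t * |S.y i|) +
          S.ℓ i * (S.M * S.decayBound L μ δ t * |S.y i|) := by
          gcongr
          · linarith
          · exact ih (by omega)
      _ = S.ℓ i * (1 - S.ℓ i / 2) ^ (t + 1) * |S.e 0 i| +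
          4 * S.M * ((1 - S.ℓ i / 4) * S.decayBound L μ δ t) * |S.y i| := by ring
      _ ≤ _ := by gcongr; exact hS.mul_decayBound_le_succ i t

theorem σ_le_two_add (hS : S.IsSharpening L η μ δ T) (ht : t ≤ T) : S.σ t ≤ 2 + 3 * L * S.M *
      (8 * δ / μ * (1 - (1 - μ / 8) ^ t) + 3 * L * S.y₀ ^ 2 * t) := by
  induction t with
  | zero => simpa using hS.σ_zero_lt.le
  | succ t ih =>
    have hL := hS.one_le
    have hμ := hS.μ_pos
    have hneg := hS.shrink_neg ht
    have hstep : S.σ (t + 1) ≤ S.σ t + 3 * L * (-S.shrink t) := by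
      rw [hS.σ_succ t (by omega)]
      have : (1 - S.shrink t) ^ 2 ≤ 1 + 3 * (-S.shrink t) := by
        nlinarith [hS.neg_shrink_le_quarter (show t ≤ T by omega)]
      nlinarith [hS.σ_le t, hS.one_le_σ (show t ≤ T by omega)]
    have hshrink : 3 * L * (-S.shrink t) ≤ 3 * L * (S.M * S.decayBound L μ δ t) := by
      gcongr; exact hS.neg_shrink_le ht
    refine (hstep.trans (add_le_add (ih (by omega)) hshrink)).trans_eq ?_
    rw [decayBound]
    push_cast
    field_simp
    ring

end IsSharpening

namespace IsTrajectory

theorem σ_le_of_shrink (hN : S.IsTrajectory N) (hTt : T ≤ t) (htN : t ≤ N)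
    (h : ∀ s, T ≤ s → s < t → 0 ≤ S.shrink s ∧ S.shrink s ≤ 1) : S.σ t ≤ S.σ T := by
  induction t, hTt using Nat.le_induction with
  | base => exact le_rfl
  | succ t hTt ih =>
    obtain ⟨h0, h1⟩ := h t hTt (Nat.lt_succ_self t)
    have hstep : S.σ (t + 1) ≤ S.σ t := by
      rw [hN.σ_succ t (by omega)]
      exact mul_le_of_le_one_right (hN.σ_pos t (by omega)).le (by nlinarith)
    exact hstep.trans (ih (by omega) fun s hs hst => h s hs (by omega))

/-- Here `A` is what is left of the initial error, and `- B * y` accumulates the decrease of the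
output. -/
theorem exists_e_eq_sub (hN : S.IsTrajectory N) (hB : S.IsBounded L η μ) (i : ι)
    (hTt : T ≤ t) (htN : t ≤ N + 1)
    (h : ∀ s, T ≤ s → s < t → 1 ≤ S.σ s ∧ 0 ≤ S.shrink s ∧ S.shrink s ≤ 1) :
    ∃ A B : ℝ, S.e t i = A - B * S.y i ∧ 0 ≤ B ∧ B ≤ 1 ∧
      |A| ≤ (1 - μ) ^ (t - T) * |S.e T i| := by
  induction t, hTt using Nat.le_induction with
  | base => exact ⟨S.e T i, 0, by simp, le_rfl, zero_le_one, by simp⟩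
  | succ t hTt ih =>
    obtain ⟨A, B, he, hB0, hB1, hA⟩ := ih (by omega) fun s h1 h2 => h s h1 (by omega)
    obtain ⟨hσ, hg0, hg1⟩ := h t hTt (by omega)
    have hr1 := hB.ℓ_mul_σ_le_one t i
    have hr0 : μ ≤ S.ℓ i * S.σ t :=
      (hB.μ_le_ℓ i).trans (le_mul_of_one_le_right (hB.ℓ_pos i).le hσ)
    have hμ := hB.μ_pos
    have hfac0 : 0 ≤ (1 - S.shrink t) * (1 - S.ℓ i * S.σ t) :=
      mul_nonneg (by linarith) (by linarith)
    refine ⟨(1 - S.shrink t) * (1 - S.ℓ i * S.σ t) * A,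
      (1 - S.shrink t) * (1 - S.ℓ i * S.σ t) * B + S.shrink t, ?_, by positivity, ?_, ?_⟩
    · rw [hN.e_succ t (by omega), he]; ring
    · have : (1 - S.shrink t) * (1 - S.ℓ i * S.σ t) * B ≤ (1 - S.shrink t) * 1 * 1 := by
        gcongr
        linarith
      linarith
    · have : (1 - S.shrink t) * (1 - S.ℓ i * S.σ t) ≤ 1 * (1 - μ) := by
        apply mul_le_mul <;> linarith
      rw [abs_mul, abs_of_nonneg hfac0, show t + 1 - T = t - T + 1 by omega, pow_succ',
        mul_assoc (1 - μ)]
      exact mul_le_mul (by linarith) hA (abs_nonneg _) (by linarith)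

theorem e_mul_output_le (hN : S.IsTrajectory N) (hB : S.IsBounded L η μ) (i : ι)
    (hTt : T ≤ t) (htN : t ≤ N + 1)
    (h : ∀ s, T ≤ s → s < t → 1 ≤ S.σ s ∧ 0 ≤ S.shrink s ∧ S.shrink s ≤ 1) :
    S.e t i * (S.e t i + S.y i) ≤
      (1 - μ) ^ (t - T) * (|S.e T i| * (|S.e T i| + |S.y i|)) := by
  obtain ⟨A, B, he, hB0, hB1, hA⟩ := hN.exists_e_eq_sub hB i hTt htN h
  have hdecay : (1 - μ) ^ (t - T) ≤ 1 :=
    pow_le_one₀ (by linarith [hB.μ_le_one]) (by linarith [hB.μ_pos])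
  have hA' : |A| ≤ |S.e T i| := hA.trans (mul_le_of_le_one_left (abs_nonneg _) hdecay)
  have hcross : (1 - 2 * B) * (A * S.y i) ≤ |A| * |S.y i| := by
    refine (le_abs_self _).trans ?_
    rw [abs_mul, abs_mul A]
    exact mul_le_of_le_one_left (by positivity) (abs_le.2 ⟨by linarith, by linarith⟩)
  have htarget : 0 ≤ B * (1 - B) * S.y i ^ 2 :=
    mul_nonneg (mul_nonneg hB0 (by linarith)) (sq_nonneg _)
  calc S.e t i * (S.e t i + S.y i)
      = A ^ 2 + (1 - 2 * B) * (A * S.y i) - B * (1 - B) * S.y i ^ 2 := by rw [he]; ring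
    _ ≤ |A| * (|A| + |S.y i|) := by linarith [sq_abs A, mul_add |A| |A| |S.y i|]
    _ ≤ (1 - μ) ^ (t - T) * |S.e T i| * (|S.e T i| + |S.y i|) :=
      mul_le_mul hA (by linarith) (by positivity) ((abs_nonneg _).trans hA)
    _ = _ := mul_assoc _ _ _

end IsTrajectory

namespace IsBounded

theorem fall_bounds (hB : S.IsBounded L η μ) (hσ : 1 ≤ S.σ t) (hc : 0 < S.corr t) :
    1 ≤ S.σ t ∧ 0 ≤ S.shrink t ∧ S.shrink t ≤ 1 :=
  ⟨hσ, mul_nonneg (div_nonneg hB.M_pos.le (by linarith)) hc.le,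
    by linarith [(abs_le.1 (hB.abs_shrink_le_quarter hσ)).2]⟩

end IsBounded

namespace IsSharpening

theorem ℓ_mul_abs_e_last_le (hS : S.IsSharpening L η μ δ T) (i : ι) :
    S.ℓ i * |S.e T i| ≤
      2 / T * |S.e 0 i| + 4 * S.M * S.decayBound L μ δ T * |S.y i| := by
  have hT : (0 : ℝ) < T := Nat.cast_pos.2 hS.T_pos
  have hpow : S.ℓ i * (1 - S.ℓ i / 2) ^ T ≤ 2 / T := by
    rw [le_div_iff₀ hT]
    linarith [natCast_mul_mul_one_sub_pow_le_one (x := S.ℓ i / 2) (by linarith [hS.ℓ_pos i])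
      (by linarith [hS.ℓ_le_one i]) T]
  exact (hS.ℓ_mul_abs_e_le i le_rfl).trans (by gcongr)

theorem M_mul_decayBound_last_le (hS : S.IsSharpening L η μ δ T) :
    S.M * S.decayBound L μ δ T ≤ 8 * (L * (δ / T)) + 3 * L * S.M * S.y₀ ^ 2 := by
  have hT : (0 : ℝ) < T := Nat.cast_pos.2 hS.T_pos
  have hL := hS.one_le
  have hpow : μ * (1 - μ / 8) ^ T ≤ 8 / T := by
    rw [le_div_iff₀ hT]
    linarith [natCast_mul_mul_one_sub_pow_le_one (x := μ / 8) (by linarith [hS.μ_pos])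
      (by linarith [hS.μ_le_one]) T]
  have hMpow : S.M * (1 - μ / 8) ^ T ≤ L * (8 / T) :=
    calc S.M * (1 - μ / 8) ^ T ≤ L * μ * (1 - μ / 8) ^ T :=
          mul_le_mul_of_nonneg_right hS.M_le_mul_μ (hS.decay_nonneg T)
      _ = L * (μ * (1 - μ / 8) ^ T) := by ring
      _ ≤ L * (8 / T) := by gcongr
  calc S.M * S.decayBound L μ δ T
      = δ * (S.M * (1 - μ / 8) ^ T) + 3 * L * S.M * S.y₀ ^ 2 := by rw [decayBound]; ring
    _ ≤ δ * (L * (8 / T)) + 3 * L * S.M * S.y₀ ^ 2 := by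
      gcongr; exact hS.δ_nonneg
    _ = _ := by ring

theorem sum_ℓ_mul_abs_le (hS : S.IsSharpening L η μ δ T) :
    ∑ i, S.ℓ i * (|S.e T i| * (|S.e T i| + |S.y i|)) ≤
      68 * (L * (δ / T)) + 24 * L * S.M * S.y₀ ^ 2 := by
  have hT : (0 : ℝ) < T := Nat.cast_pos.2 hS.T_pos
  have hδ := hS.δ_nonneg
  set b := S.decayBound L μ δ T
  have hMb : 0 ≤ S.M * b := mul_nonneg hS.M_pos.le (hS.decayBound_nonneg T)
  have hb : b ≤ 1 := by linarith [hS.decayBound_le T, hS.hundred_mul_δ_le_one]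
  have hterm (i) : S.ℓ i * (|S.e T i| * (|S.e T i| + |S.y i|)) ≤
      2 / T * (|S.e 0 i| * |S.e T i| + |S.e 0 i| * |S.y i|) +
        4 * (S.M * b) * (|S.y i| * |S.e T i| + |S.y i| * |S.y i|) := by
    calc _ = S.ℓ i * |S.e T i| * (|S.e T i| + |S.y i|) := by ring
      _ ≤ (2 / T * |S.e 0 i| + 4 * S.M * b * |S.y i|) * (|S.e T i| + |S.y i|) := by
        gcongr; exact hS.ℓ_mul_abs_e_last_le i
      _ = _ := by ring
  have hstart : S.tailSq 0 ≤ δ ^ 2 := (S.tailSq_le_loss 0).trans hS.loss_zero_le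
  have hend : S.tailSq T ≤ 1 ^ 2 :=
    (hS.tailSq_le le_rfl).trans (pow_le_pow_left₀ (hS.decayBound_nonneg T) hb 2)
  have hy : ∑ i, S.y i ^ 2 ≤ 1 ^ 2 := by simpa using hS.sum_sq_y_le_one
  calc _ ≤ 2 / T * (∑ i, |S.e 0 i| * |S.e T i| + ∑ i, |S.e 0 i| * |S.y i|) +
        4 * (S.M * b) * (∑ i, |S.y i| * |S.e T i| + ∑ i, |S.y i| * |S.y i|) := by
        refine (Finset.sum_le_sum fun i _ => hterm i).trans_eq ?_
        simp only [Finset.sum_add_distrib, ← Finset.mul_sum]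
    _ ≤ 2 / T * (δ * 1 + δ * 1) + 4 * (S.M * b) * (1 * 1 + 1 * 1) := by
        gcongr
        · exact sum_abs_mul_abs_le _ _ _ hδ zero_le_one hstart hend
        · exact sum_abs_mul_abs_le _ _ _ hδ zero_le_one hstart hy
        · exact sum_abs_mul_abs_le _ _ _ zero_le_one zero_le_one hy hend
        · exact sum_abs_mul_abs_le _ _ _ zero_le_one zero_le_one hy hy
    _ = 4 * (δ / T) + 8 * (S.M * b) := by ring
    _ ≤ 4 * (L * (δ / T)) + 8 * (8 * (L * (δ / T)) + 3 * L * S.M * S.y₀ ^ 2) := by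
        gcongr
        · exact le_mul_of_one_le_left (by positivity) hS.one_le
        · exact hS.M_mul_decayBound_last_le
    _ = _ := by ring

theorem σ_last_le (hS : S.IsSharpening L η μ δ T) :
    S.σ T ≤ 2 + 12 * L ^ 2 * S.M * δ * T := by
  have hμ := hS.μ_pos
  have hL := hS.one_le
  have hδ := hS.δ_nonneg
  have hM := hS.M_pos
  have bernoulli : 1 + (T : ℝ) * (-(μ / 8)) ≤ (1 + -(μ / 8)) ^ T :=
    one_add_mul_le_pow (by linarith [hS.μ_le_one]) T
  rw [← sub_eq_add_neg] at bernoulli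
  have hgrowth : 8 * δ / μ * (1 - (1 - μ / 8) ^ T) ≤ δ * T :=
    calc _ ≤ 8 * δ / μ * (T * (μ / 8)) := by gcongr; linarith
      _ = _ := by field_simp
  have hsum : 8 * δ / μ * (1 - (1 - μ / 8) ^ T) + 3 * L * S.y₀ ^ 2 * T ≤ 4 * L * δ * T :=
    calc _ ≤ δ * T + δ * T := by gcongr; exact hS.three_mul_y₀_sq_le
      _ ≤ 4 * L * (δ * T) := by nlinarith [mul_nonneg hδ (Nat.cast_nonneg (α := ℝ) T)]
      _ = _ := by ring
  calc S.σ T ≤ 2 + 3 * L * S.M * (8 * δ / μ * (1 - (1 - μ / 8) ^ T) + 3 * L * S.y₀ ^ 2 * T) :=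
        hS.σ_le_two_add le_rfl
    _ ≤ 2 + 3 * L * S.M * (4 * L * δ * T) := by gcongr
    _ = _ := by ring

/-- Overshooting the threshold by `m` takes a long time, as the sharpness grows slowly. -/
theorem inv_last_le (hS : S.IsSharpening L η μ δ T) {m : ℝ} (hηm : η ≤ m)
    (hσ : m < S.σ T - 2) : 1 / (T : ℝ) ≤ 12 * L ^ 3 * m * δ := by
  have hT : (0 : ℝ) < T := Nat.cast_pos.2 hS.T_pos
  have hm : 0 < m := hS.η_pos.trans_le hηm
  have hη := hS.η_pos
  have hL := hS.one_le
  have hδ := hS.δ_nonneg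
  have hM : S.M ≤ L * m ^ 2 := hS.M_le.trans (by gcongr)
  rw [div_le_iff₀ hT]
  refine le_of_mul_le_mul_left ?_ hm
  calc m * 1 ≤ 12 * L ^ 2 * S.M * δ * T := by linarith [hS.σ_last_le]
    _ ≤ 12 * L ^ 2 * (L * m ^ 2) * δ * T := by gcongr
    _ = _ := by ring

theorem sum_ℓ_mul_e_mul_output_le (hS : S.IsSharpening L η μ δ T) (hN : S.IsTrajectory N)
    (hTt : T ≤ t) (htN : t ≤ N) (hfall : ∀ s, T ≤ s → s ≤ t → 2 < S.σ s ∧ 0 < S.corr s)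
    {m : ℝ} (hηm : η ≤ m) (hm1 : m ≤ 1) (hy : |S.y₀| ≤ δ) (hσ : m < S.σ T - 2) :
    ∑ i, S.ℓ i * (S.e t i * (S.e t i + S.y i)) ≤ 840 * L ^ 4 * m * δ ^ 2 := by
  have hm : 0 < m := hS.η_pos.trans_le hηm
  have hη := hS.η_pos
  have hL := hS.one_le
  have hδ := hS.δ_nonneg
  have hM : S.M ≤ L * m ^ 2 := hS.M_le.trans (by gcongr)
  have hmode (i) : S.ℓ i * (S.e t i * (S.e t i + S.y i)) ≤
      S.ℓ i * (|S.e T i| * (|S.e T i| + |S.y i|)) := by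
    have hdecay : (1 - μ) ^ (t - T) ≤ 1 :=
      pow_le_one₀ (by linarith [hS.μ_le_one]) (by linarith [hS.μ_pos])
    refine mul_le_mul_of_nonneg_left ((hN.e_mul_output_le hS.toIsBounded i hTt (by omega)
      fun s h1 h2 => ?_).trans (mul_le_of_le_one_left (by positivity) hdecay)) (hS.ℓ_pos i).le
    exact hS.fall_bounds (by linarith [(hfall s h1 h2.le).1]) (hfall s h1 h2.le).2
  have hlong : 68 * (L * (δ / T)) ≤ 816 * L ^ 4 * m * δ ^ 2 :=
    calc 68 * (L * (δ / T)) = 68 * L * δ * (1 / T) := by ring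
      _ ≤ 68 * L * δ * (12 * L ^ 3 * m * δ) := by gcongr; exact hS.inv_last_le hηm hσ
      _ = _ := by ring
  have htarget : 24 * L * S.M * S.y₀ ^ 2 ≤ 24 * L ^ 4 * m * δ ^ 2 :=
    calc 24 * L * S.M * S.y₀ ^ 2 ≤ 24 * L * (L * m ^ 2) * δ ^ 2 := by
          gcongr 24 * L * ?_ * ?_
          exact sq_le_sq.2 (hy.trans (le_abs_self δ))
      _ = 24 * (L ^ 2 * m ^ 2) * δ ^ 2 := by ring
      _ ≤ 24 * (L ^ 4 * m) * δ ^ 2 := by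
        gcongr
        · norm_num
        · exact pow_le_of_le_one hm.le hm1 two_ne_zero
      _ = _ := by ring
  refine (Finset.sum_le_sum fun i _ => hmode i).trans (hS.sum_ℓ_mul_abs_le.trans ?_)
  linarith

theorem abs_y₀_le_mul (hS : S.IsSharpening L η μ δ T) {m : ℝ} (hm : 0 ≤ m)
    (hy : |S.y₀| ≤ L * m ^ 2) : |S.y₀| ≤ L * m * δ := by
  have hL := hS.one_le
  have hδ := hS.δ_nonneg
  refine (abs_le_of_sq_le_sq' ?_ (by positivity)).2
  calc |S.y₀| ^ 2 = |S.y₀| * |S.y₀| := sq _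
    _ ≤ L * m ^ 2 * δ ^ 2 := mul_le_mul hy hS.abs_y₀_le (abs_nonneg _) (by positivity)
    _ ≤ L ^ 2 * m ^ 2 * δ ^ 2 := by gcongr; exact le_self_pow₀ hL two_ne_zero
    _ = _ := by ring

/-- The leading mode gains `(σ - 2) e₀²`, which exceeds what the other modes and the target can
take away: `m` measures the latter, and `C` makes the excess dominate. -/
theorem lead_gain_pos (hS : S.IsSharpening L η μ δ T) {m c₁ C : ℝ} (hm : 0 < m)
    (hy : |S.y₀| ≤ L * m * δ) (hc₁ : 0 < c₁) (hδ : 0 < δ) (he : c₁ * δ ≤ |S.e₀ t|)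
    (hσ : C * m < S.σ t - 2) (hC : 2 * L / c₁ + 1680 * L ^ 4 / c₁ ^ 2 ≤ C) :
    0 < (S.σ t - 2) * S.e₀ t ^ 2 - 2 * (S.e₀ t * S.y₀) - 2 * (840 * L ^ 4 * m * δ ^ 2) := by
  have hL := hS.one_le
  rw [← sq_abs (S.e₀ t)]
  have hcross : S.e₀ t * S.y₀ ≤ |S.e₀ t| * |S.y₀| := (le_abs_self _).trans_eq (abs_mul _ _)
  set x := |S.e₀ t|
  have hx : 0 < x := (mul_pos hc₁ hδ).trans_le he
  have hδx : δ ≤ x / c₁ := by rw [le_div_iff₀ hc₁]; linarith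
  have hyx : S.e₀ t * S.y₀ ≤ L * m * (x ^ 2 / c₁) :=
    calc S.e₀ t * S.y₀ ≤ x * (L * m * δ) := hcross.trans (by gcongr)
      _ ≤ x * (L * m * (x / c₁)) := by gcongr
      _ = _ := by ring
  have htail : 840 * L ^ 4 * m * δ ^ 2 ≤ 840 * L ^ 4 * m * (x ^ 2 / c₁ ^ 2) := by
    rw [← div_pow]; gcongr
  have hlead : C * m * x ^ 2 < (S.σ t - 2) * x ^ 2 := mul_lt_mul_of_pos_right hσ (by positivity)
  have hC' : m * x ^ 2 * (2 * L / c₁ + 1680 * L ^ 4 / c₁ ^ 2) ≤ m * x ^ 2 * C :=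
    mul_le_mul_of_nonneg_left hC (by positivity)
  have hexpand : m * x ^ 2 * (2 * L / c₁ + 1680 * L ^ 4 / c₁ ^ 2) =
      2 * (L * m * (x ^ 2 / c₁)) + 2 * (840 * L ^ 4 * m * (x ^ 2 / c₁ ^ 2)) := by ring
  linarith

theorem first_layer_grows (hS : S.IsSharpening L η μ δ T) (hN : S.IsTrajectory N)
    (hTt : T ≤ t) (htN : t ≤ N) (hfall : ∀ s, T ≤ s → s ≤ t → 2 < S.σ s ∧ 0 < S.corr s)
    {m c₁ C : ℝ} (hy : |S.y₀| ≤ L * m ^ 2) (hηm : η ≤ m) (hm1 : m ≤ 1) (hc₁ : 0 < c₁)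
    (he : c₁ * δ ≤ |S.e₀ t|) (hσ : C * m < S.σ t - 2) (hC1 : 1 ≤ C)
    (hC : 2 * L / c₁ + 1680 * L ^ 4 / c₁ ^ 2 ≤ C) :
    0 < S.σ t * (S.σ t * S.e₀ t ^ 2 - 2 * (S.e₀ t * (S.e₀ t + S.y₀))) +
      ∑ i, S.ℓ i * S.σ t * (S.ℓ i * S.σ t * S.e t i ^ 2 -
        2 * (S.e t i * (S.e t i + S.y i))) := by
  have hm : 0 < m := hS.η_pos.trans_le hηm
  have hσ0 : 0 < S.σ t := by linarith [(hfall t hTt le_rfl).1]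
  have hσT : m < S.σ T - 2 := by
    have hfalling := hN.σ_le_of_shrink hTt htN fun s h1 h2 =>
      (hS.fall_bounds (by linarith [(hfall s h1 h2.le).1]) (hfall s h1 h2.le).2).2
    nlinarith
  have hδ : 0 < δ := hS.δ_nonneg.lt_of_ne' fun h => by
    have := hS.inv_last_le hηm hσT
    rw [h, mul_zero] at this
    exact this.not_gt (one_div_pos.2 (Nat.cast_pos.2 hS.T_pos))
  have hlead := hS.lead_gain_pos hm (hS.abs_y₀_le_mul hm.le hy) hc₁ hδ he hσ hC
  have hsum := hS.sum_ℓ_mul_e_mul_output_le hN hTt htN hfall hηm hm1 hS.abs_y₀_le_δ hσT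
  have htail : -(2 * S.σ t) * ∑ i, S.ℓ i * (S.e t i * (S.e t i + S.y i)) ≤
      ∑ i, S.ℓ i * S.σ t * (S.ℓ i * S.σ t * S.e t i ^ 2 -
        2 * (S.e t i * (S.e t i + S.y i))) := by
    rw [Finset.mul_sum]
    exact Finset.sum_le_sum fun i _ => by nlinarith [sq_nonneg (S.ℓ i * S.σ t * S.e t i)]
  nlinarith [mul_pos hσ0 hlead, mul_le_mul_of_nonneg_left hsum hσ0.le]

theorem y₀_sq_le_sq (hS : S.IsSharpening L η μ δ T) : S.y₀ ^ 2 ≤ δ ^ 2 := by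
  rw [← sq_abs]
  exact pow_le_pow_left₀ (abs_nonneg _) hS.abs_y₀_le_δ 2

theorem e₀_sq_le (hS : S.IsSharpening L η μ δ T) (ht : t < T) :
    S.e₀ t ^ 2 ≤ 2 * S.decayBound L μ δ t + S.y₀ ^ 2 := by
  have htail := (abs_le.1 (hS.abs_sum_mul_y_le (hS.decayBound_nonneg t) (hS.tailSq_le ht.le))).1
  have hcorr := hS.corr_neg ht
  rw [corr, tailCorr_eq] at hcorr
  nlinarith [sq_nonneg (S.e₀ t + S.y₀), S.tailSq_nonneg t]

theorem e₀_sq_le_five_mul (hS : S.IsSharpening L η μ δ T) (ht : t < T) :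
    S.e₀ t ^ 2 ≤ 5 * δ := by
  have hy : S.y₀ ^ 2 ≤ 3 * L * S.y₀ ^ 2 :=
    le_mul_of_one_le_left (sq_nonneg _) (by linarith [hS.one_le])
  linarith [hS.e₀_sq_le ht, hS.decayBound_le t, hS.three_mul_y₀_sq_le]

theorem loss_last_le (hS : S.IsSharpening L η μ δ T) : S.loss T ≤ 50 * L ^ 2 * δ := by
  obtain ⟨t, rfl⟩ := Nat.exists_eq_succ_of_ne_zero hS.T_pos.ne'
  rw [Nat.succ_eq_add_one] at *
  have hL := hS.one_le
  have hδ := hS.δ_nonneg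
  have hσ := hS.one_le_σ t.lt_succ_self.le
  have hshrink0 := hS.shrink_neg t.lt_succ_self
  have hshrink := hS.neg_shrink_le_quarter t.lt_succ_self.le
  have hfac : ((1 - S.shrink t) * (1 - S.σ t)) ^ 2 ≤ (2 * L) ^ 2 :=
    sq_le_sq' (by nlinarith [hS.σ_le t]) (by nlinarith [hS.σ_le t])
  have hlead : S.e₀ (t + 1) ^ 2 ≤ 8 * L ^ 2 * S.e₀ t ^ 2 + 2 * S.y₀ ^ 2 := by
    rw [hS.e₀_succ t (by omega)]
    have hy : S.shrink t ^ 2 * S.y₀ ^ 2 ≤ 1 * S.y₀ ^ 2 :=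
      mul_le_mul_of_nonneg_right (by nlinarith) (sq_nonneg _)
    have he := mul_le_mul_of_nonneg_right hfac (sq_nonneg (S.e₀ t))
    nlinarith [sq_nonneg ((1 - S.shrink t) * (1 - S.σ t) * S.e₀ t + S.shrink t * S.y₀)]
  have hprev : 8 * L ^ 2 * S.e₀ t ^ 2 ≤ 8 * L ^ 2 * (5 * δ) := by
    gcongr; exact hS.e₀_sq_le_five_mul t.lt_succ_self
  have hy : S.y₀ ^ 2 ≤ δ := hS.y₀_sq_le_sq.trans (by nlinarith [hS.hundred_mul_δ_le_one])
  have htail : S.tailSq (t + 1) ≤ δ := by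
    refine (hS.tailSq_le le_rfl).trans ?_
    nlinarith [hS.decayBound_le (t + 1), hS.decayBound_nonneg (t + 1), hS.hundred_mul_δ_le_one]
  have hδL : δ ≤ L ^ 2 * δ := le_mul_of_one_le_left hδ (one_le_pow₀ hL)
  rw [loss]
  linarith

theorem max_σ_sub_two_le (hS : S.IsSharpening L η μ δ T) (ht : t ≤ T) :
    max (S.σ t - 2) 0 ≤ 24 * L ^ 2 * δ + 9 * L ^ 2 * S.M * S.y₀ ^ 2 * t := by
  have hL := hS.one_le
  have hM := hS.M_pos
  have hδ := hS.δ_nonneg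
  have hMμ : S.M / μ ≤ L := by rw [div_le_iff₀ hS.μ_pos]; exact hS.M_le_mul_μ
  refine max_le ?_ (by positivity)
  have h : 3 * L * S.M * (8 * δ / μ * (1 - (1 - μ / 8) ^ t)) ≤ 24 * L ^ 2 * δ :=
    calc _ = 24 * L * δ * (S.M / μ) * (1 - (1 - μ / 8) ^ t) := by ring
      _ ≤ 24 * L * δ * L * 1 := by
        gcongr
        · linarith [hS.decay_le_one t]
        · linarith [hS.decay_nonneg t]
      _ = _ := by ring
  linarith [hS.σ_le_two_add ht]

theorem M_mul_decay_le (hS : S.IsSharpening L η μ δ T) (t : ℕ) :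
    S.M * t * (1 - μ / 8) ^ t ≤ 8 * L := by
  have hL := hS.one_le
  have hp := hS.decay_nonneg t
  have h := natCast_mul_mul_one_sub_pow_le_one (x := μ / 8) (by linarith [hS.μ_pos])
    (by linarith [hS.μ_le_one]) t
  calc S.M * t * (1 - μ / 8) ^ t ≤ L * μ * t * (1 - μ / 8) ^ t := by
        gcongr; exact hS.M_le_mul_μ
    _ = 8 * L * (t * (μ / 8) * (1 - μ / 8) ^ t) := by ring
    _ ≤ 8 * L := mul_le_of_le_one_right (by linarith) h

/-- When the sharpness is large the leading error has already decayed, which makes the product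
quadratically small. -/
theorem excess_mul_e₀_sq_le (hS : S.IsSharpening L η μ δ T) (ht : t < T) :
    max (S.σ t - 2) 0 * S.e₀ t ^ 2 ≤ 199 * L ^ 3 * δ ^ 2 := by
  have hL := hS.one_le
  have hδ := hS.δ_nonneg
  have hp0 := hS.decay_nonneg t
  have hp1 := hS.decay_le_one t
  have hXt := hS.max_σ_sub_two_le ht.le
  have hMp := hS.M_mul_decay_le t
  have he : S.e₀ t ^ 2 ≤ 2 * δ * (1 - μ / 8) ^ t + 7 * L * S.y₀ ^ 2 := by
    have := hS.e₀_sq_le ht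
    rw [decayBound] at this
    linarith [le_mul_of_one_le_left (sq_nonneg S.y₀) hL]
  set p := (1 - μ / 8) ^ t
  set X := max (S.σ t - 2) 0
  have hXL : X ≤ L := max_le (by linarith [hS.σ_le t]) (by linarith)
  have hdecaying : X * (2 * δ * p) ≤ 48 * L ^ 2 * δ ^ 2 + 144 * L ^ 3 * δ * S.y₀ ^ 2 :=
    calc X * (2 * δ * p)
        ≤ (24 * L ^ 2 * δ + 9 * L ^ 2 * S.M * S.y₀ ^ 2 * t) * (2 * δ * p) := by gcongr
      _ = 48 * L ^ 2 * δ ^ 2 * p + 18 * L ^ 2 * δ * S.y₀ ^ 2 * (S.M * t * p) := by ring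
      _ ≤ 48 * L ^ 2 * δ ^ 2 * 1 + 18 * L ^ 2 * δ * S.y₀ ^ 2 * (8 * L) := by gcongr
      _ = _ := by ring
  calc X * S.e₀ t ^ 2 ≤ X * (2 * δ * p) + X * (7 * L * S.y₀ ^ 2) := by
        rw [← mul_add]; gcongr
    _ ≤ (48 * L ^ 2 * δ ^ 2 + 144 * L ^ 3 * δ * S.y₀ ^ 2) + L * (7 * L * S.y₀ ^ 2) := by gcongr
    _ ≤ (48 * L ^ 2 * δ ^ 2 + 144 * L ^ 3 * 1 * δ ^ 2) + L * (7 * L * δ ^ 2) := by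
      gcongr 48 * L ^ 2 * δ ^ 2 + 144 * L ^ 3 * ?_ * ?_ + L * (7 * L * ?_)
      · linarith [hS.hundred_mul_δ_le_one]
      · exact hS.y₀_sq_le_sq
      · exact hS.y₀_sq_le_sq
    _ = 55 * L ^ 2 * δ ^ 2 + 144 * L ^ 3 * δ ^ 2 := by ring
    _ ≤ 55 * L ^ 3 * δ ^ 2 + 144 * L ^ 3 * δ ^ 2 := by gcongr; norm_num
    _ = _ := by ring

theorem e₀_mul_output_succ_le (hS : S.IsSharpening L η μ δ T) (ht : t < T) :
    S.e₀ (t + 1) * (S.e₀ (t + 1) + S.y₀) ≤ S.e₀ t ^ 2 + 813 * L ^ 4 * δ ^ 2 := by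
  have hL := hS.one_le
  have hδ := hS.δ_nonneg
  set h := -S.shrink t with hh
  have hh0 : 0 ≤ h := neg_nonneg.2 (hS.shrink_neg ht).le
  have hstep := lead_corr_succ_le (x := S.e₀ t) (y := S.y₀) hh0 (hS.neg_shrink_le_quarter ht.le)
    (hS.one_le_σ ht.le) (hS.σ_le t)
  have hsucc : S.e₀ (t + 1) = (1 + h) * (1 - S.σ t) * S.e₀ t + h * S.y₀ := by
    rw [hS.e₀_succ t ht.le, hh]; ring
  have he5 := hS.e₀_sq_le_five_mul ht
  have he1 : |S.e₀ t| ≤ 1 :=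
    (sq_le_one_iff₀ (abs_nonneg _)).1 (by rw [sq_abs]; linarith [hS.hundred_mul_δ_le_one])
  have hhδ : h ≤ δ / 2 :=
    calc h ≤ S.M * S.decayBound L μ δ t := hS.neg_shrink_le ht
      _ ≤ 1 / 4 * (2 * δ) :=
        mul_le_mul hS.M_le_quarter (hS.decayBound_le t) (hS.decayBound_nonneg t) (by norm_num)
      _ = _ := by ring
  have hshrink : L * h * S.e₀ t ^ 2 ≤ 3 * L * δ ^ 2 :=
    calc L * h * S.e₀ t ^ 2 ≤ L * (δ / 2) * (5 * δ) := by gcongr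
      _ ≤ _ := by nlinarith [mul_nonneg (zero_le_one.trans hL) (sq_nonneg δ)]
  have hmain : 4 * L * ((max (S.σ t - 2) 0 + L * h) * S.e₀ t ^ 2) ≤
      4 * L * (199 * L ^ 3 * δ ^ 2 + 3 * L * δ ^ 2) := by
    rw [add_mul]
    exact mul_le_mul_of_nonneg_left (add_le_add (hS.excess_mul_e₀_sq_le ht) hshrink)
      (by linarith)
  have hcross : 4 * L * (|S.e₀ t| * |S.y₀|) ≤ 4 * L * (1 * δ ^ 2) := by
    gcongr; exact hS.abs_y₀_le
  have hL14 : L * δ ^ 2 ≤ L ^ 4 * δ ^ 2 := by gcongr; exact le_self_pow₀ hL (by norm_num)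
  have hL24 : L ^ 2 * δ ^ 2 ≤ L ^ 4 * δ ^ 2 := by gcongr; norm_num
  have hL04 : δ ^ 2 ≤ L ^ 4 * δ ^ 2 := le_mul_of_one_le_left (sq_nonneg _) (one_le_pow₀ hL)
  rw [hsucc]
  linarith [hS.y₀_sq_le_sq]

theorem sum_e_succ_mul_y_le (hS : S.IsSharpening L η μ δ T) (ht : t < T) {ζ : ℝ} (hζ : 0 ≤ ζ)
    (hy : ∑ i, (S.ℓ i * S.y i) ^ 2 ≤ ζ ^ 2) : ∑ i, S.e (t + 1) i * S.y i ≤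
      ∑ i, S.e t i * S.y i + 2 * L * ζ * δ + 4 * S.M * δ := by
  have hL := hS.one_le
  have hδ := hS.δ_nonneg
  have hσ := hS.one_le_σ ht.le
  set h := -S.shrink t
  have hh0 : 0 ≤ h := neg_nonneg.2 (hS.shrink_neg ht).le
  have hhδ : h ≤ S.M * (2 * δ) :=
    (hS.neg_shrink_le ht).trans (mul_le_mul_of_nonneg_left (hS.decayBound_le t) hS.M_pos.le)
  have hmode (i) : S.e (t + 1) i * S.y i ≤ S.e t i * S.y i +
      L * (|S.e t i| * |S.ℓ i * S.y i|) + h * S.y i ^ 2 + h * (|S.e t i| * |S.y i|) := by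
    have hr0 : 0 ≤ S.ℓ i * S.σ t := mul_nonneg (hS.ℓ_pos i).le (by linarith)
    have hdecay : S.σ t * (-(S.e t i * (S.ℓ i * S.y i))) ≤ L * (|S.e t i| * |S.ℓ i * S.y i|) := by
      rw [← abs_mul]
      exact (mul_le_mul_of_nonneg_left (neg_le_abs _) (by linarith)).trans
        (mul_le_mul_of_nonneg_right (hS.σ_le t) (abs_nonneg _))
    have hcross : (1 - S.ℓ i * S.σ t) * (S.e t i * S.y i) ≤ |S.e t i| * |S.y i| := by
      rw [← abs_mul]
      exact (mul_le_mul_of_nonneg_left (le_abs_self _)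
        (by linarith [hS.ℓ_mul_σ_le_one t i])).trans
        (mul_le_of_le_one_left (abs_nonneg _) (by linarith))
    rw [hS.e_succ t ht.le]
    linarith [mul_le_mul_of_nonneg_left hcross hh0]
  have htail : S.tailSq t ≤ (2 * δ) ^ 2 := (hS.tailSq_le ht.le).trans
    (pow_le_pow_left₀ (hS.decayBound_nonneg t) (hS.decayBound_le t) 2)
  have hy1 := hS.sum_sq_y_le_one
  calc _ ≤ ∑ i, S.e t i * S.y i + L * ∑ i, |S.e t i| * |S.ℓ i * S.y i| + h * ∑ i, S.y i ^ 2 +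
        h * ∑ i, |S.e t i| * |S.y i| := by
        refine (Finset.sum_le_sum fun i _ => hmode i).trans_eq ?_
        simp only [Finset.sum_add_distrib, ← Finset.mul_sum]
    _ ≤ ∑ i, S.e t i * S.y i + L * (2 * δ * ζ) + h * 1 + h * (2 * δ * 1) := by
        gcongr
        · exact sum_abs_mul_abs_le _ _ _ (by positivity) hζ htail hy
        · exact sum_abs_mul_abs_le _ _ _ (by positivity) zero_le_one htail (by simpa using hy1)
    _ ≤ _ := by nlinarith [hS.hundred_mul_δ_le_one]

theorem corr_last_le (hS : S.IsSharpening L η μ δ T) {ζ : ℝ} (hζ : 0 ≤ ζ)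
    (hy : ∑ i, (S.ℓ i * S.y i) ^ 2 ≤ ζ ^ 2) :
    S.corr T ≤ 1000 * L ^ 4 * (δ + ζ + S.M) * δ := by
  obtain ⟨t, rfl⟩ := Nat.exists_eq_succ_of_ne_zero hS.T_pos.ne'
  rw [Nat.succ_eq_add_one] at *
  have ht := t.lt_succ_self
  have hL := hS.one_le
  have hδ := hS.δ_nonneg
  have hM := hS.M_pos
  have htail : S.tailSq (t + 1) ≤ 4 * δ ^ 2 := by
    refine (hS.tailSq_le le_rfl).trans ?_
    nlinarith [hS.decayBound_le (t + 1), hS.decayBound_nonneg (t + 1)]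
  have hprev : S.e₀ t ^ 2 + ∑ i, S.e t i * S.y i ≤ δ ^ 2 := by
    have hcorr := hS.corr_neg ht
    have he1 : |S.e₀ t| ≤ 1 := (sq_le_one_iff₀ (abs_nonneg _)).1
      (by rw [sq_abs]; linarith [hS.hundred_mul_δ_le_one, hS.e₀_sq_le_five_mul ht])
    have hcross : -(S.e₀ t * S.y₀) ≤ 1 * δ ^ 2 := by
      refine (neg_le_abs _).trans ?_
      rw [abs_mul]
      exact mul_le_mul he1 hS.abs_y₀_le (abs_nonneg _) zero_le_one
    rw [corr, tailCorr_eq] at hcorr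
    linarith [S.tailSq_nonneg t]
  have htotal : S.corr (t + 1) ≤ 813 * L ^ 4 * δ ^ 2 + 5 * δ ^ 2 + 2 * L * ζ * δ + 4 * S.M * δ := by
    rw [corr, tailCorr_eq]
    linarith [hS.e₀_mul_output_succ_le ht, hS.sum_e_succ_mul_y_le ht hζ hy]
  have hL4 : 1 ≤ L ^ 4 := one_le_pow₀ hL
  calc S.corr (t + 1) ≤ _ := htotal
    _ ≤ 813 * L ^ 4 * δ ^ 2 + 5 * L ^ 4 * δ ^ 2 + 2 * L ^ 4 * ζ * δ + 4 * L ^ 4 * S.M * δ := by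
      gcongr
      · linarith
      · exact le_self_pow₀ hL (by norm_num)
      · linarith
    _ ≤ _ := by
      have h1 : 0 ≤ L ^ 4 * δ ^ 2 := by positivity
      have h2 : 0 ≤ L ^ 4 * ζ * δ := by positivity
      have h3 : 0 ≤ L ^ 4 * S.M * δ := by positivity
      linarith

end IsSharpening

/-- The potential which controls how far the sharpness falls below `2` after time `T`, when `b`
bounds the error outside the leading mode at time `T`. Up to the correction terms it is the squared
distance to the threshold plus the energy still stored in the error. -/
noncomputable def edgePotential (S : ModeSystem ι) (L η μ b : ℝ) (T t : ℕ) : ℝ :=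
  (2 - S.σ t) ^ 2 - 40 * L ^ 2 * η * (2 - S.σ t) +
    8 * S.M * (|S.e₀ t| ^ 2 + |S.y₀| * |S.e₀ t|) + 8 * S.M * (2 * b * (1 - μ) ^ (t - T) / μ)

namespace IsBounded

theorem one_sub_pow_nonneg (hB : S.IsBounded L η μ) (t : ℕ) : 0 ≤ (1 - μ) ^ t :=
  pow_nonneg (by linarith [hB.μ_le_one]) t

theorem abs_e₀_sq_le (hB : S.IsBounded L η μ) (t : ℕ) : |S.e₀ t| ^ 2 ≤ L / η := by
  rw [sq_abs]; exact (S.sq_e₀_le_loss t).trans (hB.loss_le t)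

theorem abs_e₀_le (hB : S.IsBounded L η μ) (t : ℕ) : |S.e₀ t| ≤ L / η := by
  nlinarith [hB.abs_e₀_sq_le t, hB.one_le_div]

theorem M_mul_abs_e₀_add_one_le (hB : S.IsBounded L η μ) (t : ℕ) :
    S.M * (|S.e₀ t| + 1) ≤ 2 * L ^ 2 * η := by
  have hη := hB.η_pos
  have hL := hB.one_le
  calc S.M * (|S.e₀ t| + 1) ≤ L * η ^ 2 * (L / η + L / η) := by
        gcongr
        · exact hB.M_le
        · exact hB.abs_e₀_le t
        · exact hB.one_le_div
    _ = _ := by field_simp; ring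

theorem abs_y₀_le_one (hB : S.IsBounded L η μ) : |S.y₀| ≤ 1 :=
  (sq_le_one_iff₀ (abs_nonneg _)).1 <| by
    rw [sq_abs, ← hB.y_unit]
    exact le_add_of_nonneg_right (Finset.sum_nonneg fun _ _ => sq_nonneg _)

theorem one_le_σ_of_edgePotential_le (hB : S.IsBounded L η μ) {b : ℝ} (hb : 0 ≤ b)
    (hσ : 0 < S.σ t) (h : S.edgePotential L η μ b T t ≤ 1 / 2) : 1 ≤ S.σ t := by
  by_contra! hlt
  have hM := hB.M_pos
  have hη := mul_pow_mul_le_one_of_le hB.one_le hB.η_pos.le (by norm_num)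
    (by norm_num : 2 ≤ 4) hB.η_small
  have hlead : 0 ≤ 8 * S.M * (|S.e₀ t| ^ 2 + |S.y₀| * |S.e₀ t|) := by positivity
  have htail : 0 ≤ 8 * S.M * (2 * b * (1 - μ) ^ (t - T) / μ) := by
    have := hB.one_sub_pow_nonneg (t - T)
    have := hB.μ_pos
    positivity
  rw [edgePotential] at h
  nlinarith

theorem shrink_le_M_mul (hB : S.IsBounded L η μ) {P : ℝ} (hσ : 1 ≤ S.σ t) (hcorr : 0 < S.corr t)
    (hP : S.tailCorr t ≤ P) :
    S.shrink t ≤ S.M * (|S.e₀ t| ^ 2 + |S.y₀| * |S.e₀ t| + P) := by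
  have hcorr_le : S.corr t ≤ |S.e₀ t| ^ 2 + |S.y₀| * |S.e₀ t| + P := by
    rw [corr, sq_abs, ← abs_mul]
    linarith [le_abs_self (S.y₀ * S.e₀ t)]
  exact mul_le_mul (div_le_self hB.M_pos.le hσ) hcorr_le hcorr.le hB.M_pos.le

end IsBounded

theorem IsTrajectory.abs_e₀_succ_le (hN : S.IsTrajectory N) (htN : t ≤ N) (hσ1 : 1 ≤ S.σ t)
    (hg0 : 0 ≤ S.shrink t) (hg1 : S.shrink t ≤ 1) :
    |S.e₀ (t + 1)| ≤ (1 - (2 - S.σ t)) * |S.e₀ t| + S.shrink t * |S.y₀| := by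
  rw [hN.e₀_succ t htN]
  refine (abs_sub _ _).trans ?_
  rw [abs_mul, abs_mul (S.shrink t), abs_of_nonneg hg0, abs_mul,
    abs_of_nonneg (sub_nonneg.2 hg1), abs_of_nonpos (sub_nonpos.2 hσ1)]
  refine add_le_add_left (mul_le_mul_of_nonneg_right ?_ (abs_nonneg _)) _
  nlinarith

namespace IsSharpening

theorem tailCorr_le_of_fall (hS : S.IsSharpening L η μ δ T) (hN : S.IsTrajectory N)
    (hTt : T ≤ t) (htN : t ≤ N)
    (h : ∀ s, T ≤ s → s < t → 1 ≤ S.σ s ∧ 0 ≤ S.shrink s ∧ S.shrink s ≤ 1) :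
    S.tailCorr t ≤ 2 * S.decayBound L μ δ T * (1 - μ) ^ (t - T) := by
  have hb0 := hS.decayBound_nonneg T
  have htail := hS.tailSq_le le_rfl
  have hb1 : S.decayBound L μ δ T ≤ 1 := by
    linarith [hS.decayBound_le T, hS.hundred_mul_δ_le_one]
  set b := S.decayBound L μ δ T
  have hp := hS.one_sub_pow_nonneg (t - T)
  calc S.tailCorr t ≤ ∑ i, (1 - μ) ^ (t - T) * (|S.e T i| * (|S.e T i| + |S.y i|)) :=
        Finset.sum_le_sum fun i _ => hN.e_mul_output_le hS.toIsBounded i hTt (by omega) h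
    _ = (1 - μ) ^ (t - T) * (∑ i, |S.e T i| * |S.e T i| + ∑ i, |S.e T i| * |S.y i|) := by
        simp only [← Finset.mul_sum, mul_add, Finset.sum_add_distrib]
    _ ≤ (1 - μ) ^ (t - T) * (b * 1 + b * 1) := by
        gcongr
        · exact sum_abs_mul_abs_le _ _ _ hb0 zero_le_one htail
            (htail.trans (pow_le_pow_left₀ hb0 hb1 2))
        · exact sum_abs_mul_abs_le _ _ _ hb0 zero_le_one htail (by simpa using hS.sum_sq_y_le_one)
    _ = _ := by ring

theorem edgePotential_succ_le (hS : S.IsSharpening L η μ δ T) (hN : S.IsTrajectory N)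
    (hTt : T ≤ t) (htN : t ≤ N) (hσ : ∀ s, T ≤ s → s ≤ t → 1 ≤ S.σ s)
    (hcorr : ∀ s, T ≤ s → s ≤ t → 0 < S.corr s) (hσ2 : S.σ t ≤ 2) :
    S.edgePotential L η μ (S.decayBound L μ δ T) T (t + 1) ≤
      S.edgePotential L η μ (S.decayBound L μ δ T) T t := by
  have hM := hS.M_pos
  have hσt := hσ t hTt le_rfl
  obtain ⟨-, hg0, hg1⟩ := hS.fall_bounds hσt (hcorr t hTt le_rfl)
  have hshrink := hS.shrink_le_M_mul hσt (hcorr t hTt le_rfl) <|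
    hS.tailCorr_le_of_fall hN hTt htN fun s h1 h2 =>
      hS.fall_bounds (hσ s h1 h2.le) (hcorr s h1 h2.le)
  obtain ⟨hgap, hgap_sq⟩ := edge_gap_succ (D := 2 - S.σ t) (D' := 2 - S.σ (t + 1))
    (k := L ^ 2 * η) (by linarith) (by linarith) hg0 hg1
    (by linarith [(abs_le.1 (hS.abs_shrink_le hσt)).2]) (by rw [hN.σ_succ t htN]; ring)
  have hlead := sq_add_mul_damped_le (by linarith) (by linarith) hg0 hg1 (abs_nonneg S.y₀)
    hS.abs_y₀_le_one (abs_nonneg (S.e₀ t)) (abs_nonneg _) (hN.abs_e₀_succ_le htN hσt hg0 hg1)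
  have hP0 : 0 ≤ 2 * S.decayBound L μ δ T * (1 - μ) ^ (t - T) :=
    mul_nonneg (by linarith [hS.decayBound_nonneg T]) (hS.one_sub_pow_nonneg _)
  have hPsucc : 2 * S.decayBound L μ δ T * (1 - μ) ^ (t + 1 - T) / μ =
      2 * S.decayBound L μ δ T * (1 - μ) ^ (t - T) / μ -
        2 * S.decayBound L μ δ T * (1 - μ) ^ (t - T) := by
    have := hS.μ_pos
    rw [show t + 1 - T = t - T + 1 by omega, pow_succ]
    field_simp
  rw [edgePotential, edgePotential, hPsucc]
  set P := 2 * S.decayBound L μ δ T * (1 - μ) ^ (t - T)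
  set W := |S.e₀ t| ^ 2 + |S.y₀| * |S.e₀ t|
  have hrate : S.shrink t * (2 - S.σ t) ≤ S.M * (W * (2 - S.σ t) + P) := by
    have hPD : P * (2 - S.σ t) ≤ P := mul_le_of_le_one_right hP0 (by linarith)
    nlinarith [mul_le_mul_of_nonneg_right hshrink (by linarith : 0 ≤ 2 - S.σ t)]
  have herror : 8 * S.M * (S.shrink t * (2 * |S.e₀ t| + 2)) ≤
      32 * L ^ 2 * η * (2 - S.σ (t + 1) - (2 - S.σ t)) := by
    linarith [mul_le_mul hgap (hS.M_mul_abs_e₀_add_one_le t) (by positivity) (hg0.trans hgap)]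
  linarith [mul_le_mul_of_nonneg_left hlead (by linarith : 0 ≤ 8 * S.M)]

theorem edgePotential_crossing_le (hS : S.IsSharpening L η μ δ T) (hN : S.IsTrajectory N)
    (htN : t ≤ N) (hσ : 2 < S.σ t) (hcorr : 0 < S.corr t)
    (hσ' : S.σ (t + 1) < 2) :
    S.edgePotential L η μ (S.decayBound L μ δ T) T (t + 1) ≤ 1 / 2 := by
  have hη := hS.η_pos
  have hL := hS.one_le
  have hb := hS.decayBound_nonneg T
  have hη2 := mul_pow_mul_le_one_of_le hL hη.le (by norm_num) (by norm_num : 2 ≤ 4) hS.η_small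
  have hg0 := (hS.fall_bounds (by linarith) hcorr).2.1
  have hg := (abs_le.1 (hS.abs_shrink_le (by linarith : 1 ≤ S.σ t))).2
  have hgap : 2 - S.σ (t + 1) ≤ 8 * L ^ 2 * η := by
    rw [hN.σ_succ t htN]
    nlinarith [sq_nonneg (1 - S.shrink t)]
  have hgap_sq : (2 - S.σ (t + 1)) ^ 2 ≤ (8 / 100) ^ 2 :=
    pow_le_pow_left₀ (by linarith) (by linarith) 2
  have hgap0 : 0 ≤ 40 * L ^ 2 * η * (2 - S.σ (t + 1)) := mul_nonneg (by positivity) (by linarith)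
  have hlead : 8 * S.M * (|S.e₀ (t + 1)| ^ 2 + |S.y₀| * |S.e₀ (t + 1)|) ≤ 16 / 100 :=
    calc _ ≤ 8 * (L * η ^ 2) * (L / η + 1 * (L / η)) := by
          gcongr
          · exact hS.M_le
          · exact hS.abs_e₀_sq_le _
          · exact hS.abs_y₀_le_one
          · exact hS.abs_e₀_le _
      _ = 16 * (L ^ 2 * η) := by field_simp; ring
      _ ≤ _ := by linarith
  have htail : 8 * S.M * (2 * S.decayBound L μ δ T * (1 - μ) ^ (t + 1 - T) / μ) ≤ 16 / 50 :=
    calc _ = 16 * (S.M / μ) * S.decayBound L μ δ T * (1 - μ) ^ (t + 1 - T) := by ring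
      _ ≤ 16 * L * S.decayBound L μ δ T * 1 := by
        gcongr
        · exact hS.one_sub_pow_nonneg _
        · rw [div_le_iff₀ hS.μ_pos]; exact hS.M_le_mul_μ
        · exact pow_le_one₀ (by linarith [hS.μ_le_one]) (by linarith [hS.μ_pos])
      _ ≤ _ := by linarith [hS.mul_decayBound_le T]
  rw [edgePotential]
  linarith

theorem one_le_σ_of_fall (hS : S.IsSharpening L η μ δ T) (hN : S.IsTrajectory N) {T' : ℕ}
    (hT' : T ≤ T') (habove : ∀ s, T ≤ s → s ≤ T' → 2 < S.σ s)
    (hbelow : ∀ s, T' < s → s ≤ N → S.σ s < 2) (hcorr : ∀ s, T ≤ s → s ≤ N → 0 < S.corr s)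
    (hTt : T ≤ t) (htN : t ≤ N) : 1 ≤ S.σ t := by
  suffices H : ∀ s, T' + 1 ≤ s → s ≤ N → (∀ r, T ≤ r → r ≤ s → 1 ≤ S.σ r) ∧
      S.edgePotential L η μ (S.decayBound L μ δ T) T s ≤ 1 / 2 by
    rcases le_or_gt t T' with h | h
    · linarith [habove t hTt h]
    · exact (H t h htN).1 t hTt le_rfl
  have hσ {s : ℕ} (hs : s ≤ N)
      (h : S.edgePotential L η μ (S.decayBound L μ δ T) T s ≤ 1 / 2) : 1 ≤ S.σ s :=
    hS.one_le_σ_of_edgePotential_le (hS.decayBound_nonneg T) (hN.σ_pos s hs) h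
  intro s hs
  induction s, hs using Nat.le_induction with
  | base =>
    intro hsN
    have hpot := hS.edgePotential_crossing_le hN (by omega) (habove T' hT' le_rfl)
      (hcorr T' hT' (by omega)) (hbelow _ (Nat.lt_succ_self _) hsN)
    refine ⟨fun r h1 h2 => ?_, hpot⟩
    rcases Nat.le_succ_iff.1 h2 with h | rfl
    · linarith [habove r h1 h]
    · exact hσ hsN hpot
  | succ s hs ih =>
    intro hsN
    obtain ⟨ih1, ih2⟩ := ih (by omega)
    have hpot := (hS.edgePotential_succ_le hN (by omega) (by omega) ih1
      (fun r h1 h2 => hcorr r h1 (by omega)) (hbelow s (by omega) (by omega)).le).trans ih2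
    refine ⟨fun r h1 h2 => ?_, hpot⟩
    rcases Nat.le_succ_iff.1 h2 with h | rfl
    · exact ih1 r h1 h
    · exact hσ hsN hpot

end IsSharpening

theorem outputSq_nonneg (S : ModeSystem ι) (t : ℕ) : 0 ≤ S.outputSq t :=
  add_nonneg (sq_nonneg _) (Finset.sum_nonneg fun _ _ => sq_nonneg _)

theorem IsBounded.outputSq_div_sq_lt (hB : S.IsBounded L η μ) {t' : ℕ} {x : ℝ} (hx : 0 ≤ x)
    (hσ : 2 + x ≤ S.σ t) (hσ' : 0 < S.σ t') (hσ'2 : S.σ t' < 2) (hcorr : S.corr t ≤ x / 8)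
    (hcorr' : 0 < S.corr t') (hloss : S.loss t ≤ 1 / 4) (hloss' : S.loss t' ≤ S.loss t) :
    S.outputSq t / S.σ t ^ 2 < S.outputSq t' / S.σ t' ^ 2 := by
  have hout : S.outputSq t ≤ 1 - S.loss t + x / 4 := by linarith [hB.outputSq_eq t]
  have hout' : 1 - S.loss t < S.outputSq t' := by linarith [hB.outputSq_eq t']
  have hσsq : 4 + 4 * x ≤ S.σ t ^ 2 := by nlinarith
  rw [div_lt_div_iff₀ (by nlinarith) (by positivity)]
  calc S.outputSq t * S.σ t' ^ 2 ≤ S.outputSq t * 2 ^ 2 :=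
        mul_le_mul_of_nonneg_left (by gcongr) (S.outputSq_nonneg t)
    _ ≤ (1 - S.loss t) * (4 + 4 * x) := by nlinarith
    _ < S.outputSq t' * (4 + 4 * x) := by gcongr
    _ ≤ S.outputSq t' * S.σ t ^ 2 := by
        gcongr
        exact S.outputSq_nonneg t'

end ModeSystem

section EuclideanCoordinates

variable {m : ℕ}

theorem l2norm_nonneg (x : Fin m → ℝ) : 0 ≤ l2norm x := norm_nonneg _

theorem l2norm_sq (x : Fin m → ℝ) : l2norm x ^ 2 = x ⬝ᵥ x := by
  rw [l2norm, EuclideanSpace.real_norm_sq_eq]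
  simp only [dotProduct, sq]

theorem l2norm_neg (x : Fin m → ℝ) : l2norm (-x) = l2norm x := by
  rw [l2norm, WithLp.toLp_neg, norm_neg, l2norm]

theorem l2norm_smul (k : ℝ) (x : Fin m → ℝ) : l2norm (k • x) = |k| * l2norm x := by
  rw [l2norm, WithLp.toLp_smul, norm_smul, Real.norm_eq_abs, l2norm]

theorem l2norm_sub_sq (x y : Fin m → ℝ) :
    l2norm (x - y) ^ 2 = l2norm x ^ 2 - 2 * (x ⬝ᵥ y) + l2norm y ^ 2 := by
  simp only [l2norm_sq, sub_dotProduct, dotProduct_sub, dotProduct_comm y x]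
  ring

theorem cosAngle_smul_left {k : ℝ} (hk : 0 < k) (x y : Fin m → ℝ) :
    cosAngle (k • x) y = cosAngle x y := by
  rw [cosAngle, cosAngle, l2norm_smul, smul_dotProduct, abs_of_pos hk, smul_eq_mul, mul_assoc,
    mul_div_mul_left _ _ hk.ne']

theorem one_sub_le_cosAngle {x y : Fin m → ℝ} {ε : ℝ} (hy : 0 < l2norm y) (hε₀ : 0 ≤ ε)
    (hε₁ : ε < 1) (h : l2norm (x - y) ^ 2 ≤ ε * l2norm y ^ 2) : 1 - ε ≤ cosAngle x y := by
  have hdot := l2norm_sub_sq x y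
  have hx : 0 < l2norm x := by
    refine (l2norm_nonneg x).lt_of_ne' fun h0 => ?_
    have hx0 : x = 0 := by rwa [← dotProduct_self_eq_zero, ← l2norm_sq, sq_eq_zero_iff]
    rw [hx0, zero_sub, l2norm_neg] at h
    nlinarith [pow_pos hy 2]
  rw [cosAngle, le_div_iff₀ (mul_pos hx hy)]
  nlinarith [sq_nonneg (l2norm x - (1 - ε) * l2norm y),
    mul_nonneg (mul_nonneg hε₀ (by linarith : 0 ≤ 1 - ε)) (sq_nonneg (l2norm y))]

theorem mulVec_vecMul_dotProduct {r : ℕ} {X : Matrix (Fin r) (Fin m) ℝ} {w : Fin m → ℝ} {l : ℝ}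
    (hw : (Xᵀ * X) *ᵥ w = l • w) (x : Fin m → ℝ) : ((X *ᵥ x) ᵥ* X) ⬝ᵥ w = l * (x ⬝ᵥ w) := by
  rw [← Matrix.dotProduct_mulVec, ← Matrix.vecMul_transpose, ← Matrix.dotProduct_mulVec,
    Matrix.mulVec_mulVec, hw, dotProduct_smul, smul_eq_mul]

variable {q : Fin m → Fin m → ℝ}

theorem sum_dotProduct_mul_dotProduct
    (hq : Orthonormal ℝ fun i => (WithLp.toLp 2 (q i) : EuclideanSpace ℝ (Fin m)))
    (x y : Fin m → ℝ) : ∑ i, (x ⬝ᵥ q i) * (y ⬝ᵥ q i) = x ⬝ᵥ y := by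
  have hcard : Fintype.card (Fin m) = Module.finrank ℝ (EuclideanSpace ℝ (Fin m)) :=
    finrank_euclideanSpace.symm
  let b := OrthonormalBasis.mk hq (hq.linearIndependent.span_eq_top_of_card_eq_finrank' hcard).ge
  have hsum := b.sum_inner_mul_inner (WithLp.toLp 2 x) (WithLp.toLp 2 y)
  simp only [b, OrthonormalBasis.coe_mk, EuclideanSpace.inner_toLp_toLp, star_trivial] at hsum
  rw [dotProduct_comm x y, ← hsum]
  simp only [dotProduct_comm x]

theorem sum_sq_dotProduct
    (hq : Orthonormal ℝ fun i => (WithLp.toLp 2 (q i) : EuclideanSpace ℝ (Fin m)))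
    (x : Fin m → ℝ) : ∑ i, (x ⬝ᵥ q i) ^ 2 = l2norm x ^ 2 := by
  rw [l2norm_sq, ← sum_dotProduct_mul_dotProduct hq]
  simp only [sq]

theorem dotProduct_eq_zero_of_eigenvectors {A : Matrix (Fin m) (Fin m) ℝ} (hA : A.IsSymm)
    {x y : Fin m → ℝ} {l l' : ℝ} (hx : A *ᵥ x = l • x) (hy : A *ᵥ y = l' • y) (hl : l ≠ l') :
    x ⬝ᵥ y = 0 := by
  have hswap : (A *ᵥ x) ⬝ᵥ y = x ⬝ᵥ (A *ᵥ y) := by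
    rw [Matrix.dotProduct_mulVec, ← Matrix.mulVec_transpose, hA.eq]
  rw [hx, hy, smul_dotProduct, dotProduct_smul, smul_eq_mul, smul_eq_mul] at hswap
  exact (mul_eq_zero.1 (by linarith : (l - l') * (x ⬝ᵥ y) = 0)).resolve_left (sub_ne_zero.2 hl)

end EuclideanCoordinates

section Gradient

variable {n d h : ℕ} (X : Matrix (Fin d) (Fin n) ℝ) (Y : Fin n → ℝ)
  (W₁ : Matrix (Fin h) (Fin d) ℝ) (W₂ : Fin h → ℝ)

theorem deriv_mul_l2norm_sq (a : ℝ) (x b : Fin n → ℝ) :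
    deriv (fun s : ℝ => a * l2norm (x + s • b) ^ 2) 0 = 2 * a * (x ⬝ᵥ b) := by
  have hexpand : (fun s : ℝ => a * l2norm (x + s • b) ^ 2) =
      fun s : ℝ => a * (x ⬝ᵥ x + s * (2 * (x ⬝ᵥ b)) + s ^ 2 * (b ⬝ᵥ b)) := by
    funext s
    simp only [l2norm_sq, add_dotProduct, dotProduct_add, smul_dotProduct, dotProduct_smul,
      smul_eq_mul, dotProduct_comm b x]
    ring
  have hderiv := ((((hasDerivAt_id (0 : ℝ)).mul_const (2 * (x ⬝ᵥ b))).const_add (x ⬝ᵥ x)).add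
    (((hasDerivAt_id (0 : ℝ)).pow 2).mul_const (b ⬝ᵥ b))).const_mul a
  rw [hexpand]
  refine (hderiv.congr_deriv ?_).deriv
  simp only [id_eq, Nat.cast_ofNat, Nat.add_one_sub_one, pow_one, mul_zero, zero_mul, add_zero]
  ring

theorem gradFirst_eq : gradFirst X Y W₁ W₂ =
    (1 / (n : ℝ)) • Matrix.vecMulVec W₂ (X *ᵥ (W₂ ᵥ* (W₁ * X) - Y)) := by
  ext i j
  have hrow : W₂ ᵥ* (Matrix.single i j (1 : ℝ) * X) = W₂ i • X j := by
    ext k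
    rw [← Matrix.vecMul_vecMul, Matrix.single_eq_single_vecMulVec_single,
      Matrix.vecMul_vecMulVec, Matrix.smul_vecMul, Matrix.single_one_vecMul,
      dotProduct_single_one]
    rfl
  have hpert (s : ℝ) : W₂ ᵥ* ((W₁ + s • Matrix.single i j (1 : ℝ)) * X) - Y =
      (W₂ ᵥ* (W₁ * X) - Y) + s • (W₂ i • X j) := by
    rw [Matrix.add_mul, Matrix.vecMul_add, Matrix.smul_mul, Matrix.vecMul_smul, hrow]
    abel
  simp only [gradFirst, Matrix.of_apply, sqLoss, hpert, deriv_mul_l2norm_sq, Matrix.smul_apply,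
    Matrix.vecMulVec_apply, Matrix.mulVec, dotProduct_smul, smul_eq_mul, dotProduct_comm (X j)]
  ring

theorem gradSecond_eq : gradSecond X Y W₁ W₂ =
    (1 / (n : ℝ)) • ((W₁ * X) *ᵥ (W₂ ᵥ* (W₁ * X) - Y)) := by
  ext i
  have hpert (s : ℝ) : (W₂ + s • Pi.single i (1 : ℝ)) ᵥ* (W₁ * X) - Y =
      (W₂ ᵥ* (W₁ * X) - Y) + s • (W₁ * X) i := by
    rw [Matrix.add_vecMul, Matrix.smul_vecMul, Matrix.single_one_vecMul, Matrix.row]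
    abel
  simp only [gradSecond, sqLoss, hpert, deriv_mul_l2norm_sq, Pi.smul_apply, Matrix.mulVec,
    smul_eq_mul, dotProduct_comm ((W₁ * X) i)]
  ring

end Gradient

namespace Run

variable {n d h : ℕ} {R : Run n d h} {t t₀ : ℕ}

/-- The rank-one structure `W₁ X = u vᵀ`, `W₂ = c uᵀ` of the weights at iteration `t`. -/
structure IsRankOne (R : Run n d h) (t : ℕ) : Prop where
  unit : l2norm R.u = 1
  first : R.W₁ t * R.X = Matrix.vecMulVec R.u (R.v t)
  second : R.W₂ t = R.c t • R.u

/-- The curvature `(λ_i / n) c_t²` of the loss in the eigendirection `q_i`; the sharpness is its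
largest value. -/
noncomputable def curvature (R : Run n d h) (t : ℕ) (i : Fin n) : ℝ := R.lam i / n * R.c t ^ 2

/-- The relative decrease of the second layer `c` in one step, see `IsGD.c_succ_eq_mul`. -/
noncomputable def shrink (R : Run n d h) (t : ℕ) : ℝ := R.η / (n * R.c t ^ 2) * (R.E t ⬝ᵥ R.F t)

theorem E_add_Y (R : Run n d h) (t : ℕ) : R.E t + R.Y = R.F t := sub_add_cancel _ _

theorem v_eq_of_unit (hu : l2norm R.u = 1) {w : Fin n → ℝ}
    (h : R.W₁ t * R.X = Matrix.vecMulVec R.u w) : R.v t = w := by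
  rw [v, h, Matrix.vecMul_vecMulVec, ← l2norm_sq, hu, one_pow, one_smul]

theorem c_eq_of_unit (hu : l2norm R.u = 1) {k : ℝ} (h : R.W₂ t = k • R.u) : R.c t = k := by
  rw [c, h, smul_dotProduct, ← l2norm_sq, hu, one_pow, smul_eq_mul, mul_one]

theorem IsRankOne.F_eq (hr : R.IsRankOne t) : R.F t = R.c t • R.v t := by
  rw [F, hr.second, Matrix.smul_vecMul, v]

theorem IsGD.first_succ (hgd : R.IsGD) (hr : R.IsRankOne t) :
    R.W₁ (t + 1) * R.X =
      Matrix.vecMulVec R.u (R.v t - (R.η / n * R.c t) • ((R.X *ᵥ R.E t) ᵥ* R.X)) := by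
  have hE : R.W₂ t ᵥ* (R.W₁ t * R.X) - R.Y = R.E t := rfl
  rw [(hgd t).1, gradFirst_eq, hE, Matrix.sub_mul, hr.first, hr.second, Matrix.smul_mul,
    Matrix.smul_mul, Matrix.vecMulVec_mul]
  ext i j
  simp only [Matrix.sub_apply, Matrix.smul_apply, Matrix.vecMulVec_apply, Pi.sub_apply,
    Pi.smul_apply, smul_eq_mul]
  ring

theorem IsGD.second_succ (hgd : R.IsGD) (hr : R.IsRankOne t) :
    R.W₂ (t + 1) = (R.c t - R.η / n * (R.E t ⬝ᵥ R.v t)) • R.u := by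
  have hE : R.W₂ t ᵥ* (R.W₁ t * R.X) - R.Y = R.E t := rfl
  rw [(hgd t).2, gradSecond_eq, hE, hr.first, hr.second, Matrix.vecMulVec_mulVec,
    dotProduct_comm (R.E t)]
  ext i
  simp only [Pi.sub_apply, Pi.smul_apply, smul_eq_mul, MulOpposite.smul_eq_mul_unop,
    MulOpposite.unop_op]
  ring

theorem IsGD.v_succ (hgd : R.IsGD) (hr : R.IsRankOne t) :
    R.v (t + 1) = R.v t - (R.η / n * R.c t) • ((R.X *ᵥ R.E t) ᵥ* R.X) :=
  v_eq_of_unit hr.unit (hgd.first_succ hr)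

theorem IsGD.c_succ (hgd : R.IsGD) (hr : R.IsRankOne t) :
    R.c (t + 1) = R.c t - R.η / n * (R.E t ⬝ᵥ R.v t) :=
  c_eq_of_unit hr.unit (hgd.second_succ hr)

theorem IsGD.isRankOne_succ (hgd : R.IsGD) (hr : R.IsRankOne t) : R.IsRankOne (t + 1) where
  unit := hr.unit
  first := by rw [hgd.v_succ hr, hgd.first_succ hr]
  second := by rw [hgd.c_succ hr, hgd.second_succ hr]

theorem IsGD.isRankOne (hgd : R.IsGD) (hr : R.IsRankOne t₀) (ht : t₀ ≤ t) : R.IsRankOne t :=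
  Nat.le_induction hr (fun _ _ => hgd.isRankOne_succ) t ht

theorem IsGD.v_succ_dotProduct_q (hgd : R.IsGD) (hs : R.IsSpectral) (hr : R.IsRankOne t)
    (i : Fin n) : R.v (t + 1) ⬝ᵥ R.q i =
      R.v t ⬝ᵥ R.q i - R.η / n * R.c t * (R.lam i * (R.E t ⬝ᵥ R.q i)) := by
  rw [hgd.v_succ hr, sub_dotProduct, smul_dotProduct, mulVec_vecMul_dotProduct (hs.q_eigen i),
    smul_eq_mul]

theorem IsRankOne.c_mul_v_dotProduct (hr : R.IsRankOne t) (x : Fin n → ℝ) :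
    R.c t * (R.v t ⬝ᵥ x) = R.F t ⬝ᵥ x := by
  rw [hr.F_eq, smul_dotProduct, smul_eq_mul]

section Positive

variable [NeZero n]

theorem IsGD.c_succ_eq_mul (hgd : R.IsGD) (hr : R.IsRankOne t) (hc : R.c t ≠ 0) :
    R.c (t + 1) = R.c t * (1 - R.shrink t) := by
  have hn : (n : ℝ) ≠ 0 := NeZero.ne _
  rw [hgd.c_succ hr, shrink, hr.F_eq, dotProduct_smul, smul_eq_mul]
  field_simp

theorem IsGD.E_succ_dotProduct_q (hgd : R.IsGD) (hs : R.IsSpectral) (hr : R.IsRankOne t)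
    (hc : R.c t ≠ 0) (i : Fin n) : R.E (t + 1) ⬝ᵥ R.q i =
      (1 - R.shrink t) * (1 - R.η * R.curvature t i) * (R.E t ⬝ᵥ R.q i) -
        R.shrink t * (R.Y ⬝ᵥ R.q i) :=
  calc R.E (t + 1) ⬝ᵥ R.q i
      = R.c (t + 1) * (R.v (t + 1) ⬝ᵥ R.q i) - R.Y ⬝ᵥ R.q i := by
        rw [(hgd.isRankOne_succ hr).c_mul_v_dotProduct, ← E_add_Y, add_dotProduct,
          add_sub_cancel_right]
    _ = (1 - R.shrink t) * (R.c t * (R.v t ⬝ᵥ R.q i) -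
          R.η * R.curvature t i * (R.E t ⬝ᵥ R.q i)) - R.Y ⬝ᵥ R.q i := by
        rw [hgd.c_succ_eq_mul hr hc, hgd.v_succ_dotProduct_q hs hr, curvature]
        ring
    _ = _ := by
        rw [hr.c_mul_v_dotProduct, ← E_add_Y, add_dotProduct]
        ring

end Positive

theorem IsGD.v_growth (hgd : R.IsGD) (hs : R.IsSpectral) (hr : R.IsRankOne t) :
    R.c t ^ 2 * (l2norm (R.v (t + 1)) ^ 2 - l2norm (R.v t) ^ 2) =
      ∑ i, R.η * R.curvature t i * (R.η * R.curvature t i * (R.E t ⬝ᵥ R.q i) ^ 2 -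
        2 * ((R.E t ⬝ᵥ R.q i) * (R.F t ⬝ᵥ R.q i))) := by
  rw [← sum_sq_dotProduct hs.q_orthonormal, ← sum_sq_dotProduct hs.q_orthonormal,
    ← Finset.sum_sub_distrib, Finset.mul_sum]
  refine Finset.sum_congr rfl fun i _ => ?_
  rw [hgd.v_succ_dotProduct_q hs hr, ← hr.c_mul_v_dotProduct, curvature]
  ring

variable [NeZero n]

/-- The training run from iteration `T` on in the eigenbasis of `Xᵀ X`. Vectors are divided by
`‖Y‖`, eigenvalues by `λ₁`, and time is counted from `T`. -/
noncomputable def modes (R : Run n d h) (T : ℕ) : ModeSystem {i : Fin n // i ≠ 0} where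
  M := R.η ^ 2 * R.lam 0 * l2norm R.Y ^ 2 / n ^ 2
  ℓ i := R.lam i / R.lam 0
  y₀ := R.Y ⬝ᵥ R.q 0 / l2norm R.Y
  y i := R.Y ⬝ᵥ R.q i / l2norm R.Y
  e₀ t := R.E (T + t) ⬝ᵥ R.q 0 / l2norm R.Y
  e t i := R.E (T + t) ⬝ᵥ R.q i / l2norm R.Y
  σ t := R.η * R.sharpness (T + t)

variable {T N : ℕ}

theorem modes_output₀ (R : Run n d h) (T t : ℕ) :
    (R.modes T).e₀ t + (R.modes T).y₀ = R.F (T + t) ⬝ᵥ R.q 0 / l2norm R.Y := by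
  rw [← E_add_Y, add_dotProduct, add_div]
  rfl

theorem modes_output (R : Run n d h) (T t : ℕ) (i : {i : Fin n // i ≠ 0}) :
    (R.modes T).e t i + (R.modes T).y i = R.F (T + t) ⬝ᵥ R.q i / l2norm R.Y := by
  rw [← E_add_Y, add_dotProduct, add_div]
  rfl

theorem modes_ℓ_mul_σ (hl : R.lam 0 ≠ 0) (T t : ℕ) (i : {i : Fin n // i ≠ 0}) :
    (R.modes T).ℓ i * (R.modes T).σ t = R.η * R.curvature (T + t) i := by
  simp only [modes, sharpness, curvature]
  field_simp

theorem modes_σ (R : Run n d h) (T t : ℕ) : (R.modes T).σ t = R.η * R.curvature (T + t) 0 := rfl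

theorem modes_y_unit (hs : R.IsSpectral) (hY : l2norm R.Y ≠ 0) (T : ℕ) :
    (R.modes T).y₀ ^ 2 + ∑ i, (R.modes T).y i ^ 2 = 1 := by
  simp only [modes, div_pow]
  rw [← Finset.sum_div, ← add_div,
    ← Fintype.sum_eq_add_sum_subtype_ne (fun i => (R.Y ⬝ᵥ R.q i) ^ 2),
    sum_sq_dotProduct hs.q_orthonormal, div_self (pow_ne_zero 2 hY)]

theorem modes_loss (hs : R.IsSpectral) (T t : ℕ) :
    (R.modes T).loss t = l2norm (R.E (T + t)) ^ 2 / l2norm R.Y ^ 2 := by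
  simp only [ModeSystem.loss, ModeSystem.tailSq, modes, div_pow]
  rw [← Finset.sum_div, ← add_div,
    ← Fintype.sum_eq_add_sum_subtype_ne (fun i => (R.E (T + t) ⬝ᵥ R.q i) ^ 2),
    sum_sq_dotProduct hs.q_orthonormal]

theorem modes_outputSq (hs : R.IsSpectral) (T t : ℕ) :
    (R.modes T).outputSq t = l2norm (R.F (T + t)) ^ 2 / l2norm R.Y ^ 2 := by
  simp only [ModeSystem.outputSq, modes_output₀, modes_output, div_pow]
  rw [← Finset.sum_div, ← add_div,
    ← Fintype.sum_eq_add_sum_subtype_ne (fun i => (R.F (T + t) ⬝ᵥ R.q i) ^ 2),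
    sum_sq_dotProduct hs.q_orthonormal]

theorem modes_corr (hs : R.IsSpectral) (T t : ℕ) :
    (R.modes T).corr t = R.E (T + t) ⬝ᵥ R.F (T + t) / l2norm R.Y ^ 2 := by
  rw [ModeSystem.corr, ModeSystem.tailCorr]
  simp only [modes_output₀, modes_output]
  simp only [modes, div_mul_div_comm, ← sq]
  rw [← Finset.sum_div, ← add_div, ← Fintype.sum_eq_add_sum_subtype_ne
      (fun i => R.E (T + t) ⬝ᵥ R.q i * (R.F (T + t) ⬝ᵥ R.q i)),
    sum_dotProduct_mul_dotProduct hs.q_orthonormal]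

theorem modes_shrink (hs : R.IsSpectral) (hη : R.η ≠ 0) (hl : R.lam 0 ≠ 0) (hY : l2norm R.Y ≠ 0)
    (hc : R.c (T + t) ≠ 0) : (R.modes T).shrink t = R.shrink (T + t) := by
  have hn : (n : ℝ) ≠ 0 := NeZero.ne _
  rw [ModeSystem.shrink, modes_corr hs, shrink]
  simp only [modes, sharpness]
  field_simp

theorem modes_α (hs : R.IsSpectral) (hr : R.IsRankOne (T + t)) (hη : R.η ≠ 0) (hl : R.lam 0 ≠ 0)
    (hY : l2norm R.Y ≠ 0) (hc : R.c (T + t) ≠ 0) :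
    R.α (T + t) = (R.η * R.lam 0 * l2norm R.Y / n) ^ 2 *
      ((R.modes T).outputSq t / (R.modes T).σ t ^ 2) := by
  have hn : (n : ℝ) ≠ 0 := NeZero.ne _
  rw [α, modes_outputSq hs, hr.F_eq, l2norm_smul, mul_pow, sq_abs]
  simp only [modes, sharpness]
  field_simp

theorem modes_v_growth (hgd : R.IsGD) (hs : R.IsSpectral) (hr : R.IsRankOne (T + t))
    (hl : R.lam 0 ≠ 0) (hY : l2norm R.Y ≠ 0) :
    R.c (T + t) ^ 2 * (l2norm (R.v (T + t + 1)) ^ 2 - l2norm (R.v (T + t)) ^ 2) =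
      l2norm R.Y ^ 2 * ((R.modes T).σ t * ((R.modes T).σ t * (R.modes T).e₀ t ^ 2 -
        2 * ((R.modes T).e₀ t * ((R.modes T).e₀ t + (R.modes T).y₀))) +
      ∑ i, (R.modes T).ℓ i * (R.modes T).σ t *
        ((R.modes T).ℓ i * (R.modes T).σ t * (R.modes T).e t i ^ 2 -
          2 * ((R.modes T).e t i * ((R.modes T).e t i + (R.modes T).y i)))) := by
  rw [hgd.v_growth hs hr, Fintype.sum_eq_add_sum_subtype_ne _ 0, mul_add, Finset.mul_sum]
  simp only [modes_ℓ_mul_σ hl, modes_output₀, modes_output]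
  congr 1
  · rw [modes_σ]
    simp only [modes]
    field_simp
  · refine Finset.sum_congr rfl fun i _ => ?_
    simp only [modes]
    field_simp

theorem isTrajectory_modes (hgd : R.IsGD) (hs : R.IsSpectral) (hr : R.IsRankOne T) (hη : 0 < R.η)
    (hl : 0 < R.lam 0) (hY : l2norm R.Y ≠ 0) (hc : ∀ t ≤ N, R.c (T + t) ≠ 0) :
    (R.modes T).IsTrajectory N where
  σ_pos t ht := by
    have hn : (0 : ℝ) < n := Nat.cast_pos.2 (NeZero.pos n)
    have := hc t ht
    simp only [modes, sharpness]
    positivity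
  e₀_succ t ht := by
    rw [modes_shrink hs hη.ne' hl.ne' hY (hc t ht), modes_σ]
    simp only [modes, ← add_assoc]
    rw [hgd.E_succ_dotProduct_q hs (hgd.isRankOne hr (Nat.le_add_right _ _)) (hc t ht)]
    ring
  e_succ t ht i := by
    rw [modes_shrink hs hη.ne' hl.ne' hY (hc t ht), modes_ℓ_mul_σ hl.ne']
    simp only [modes, ← add_assoc]
    rw [hgd.E_succ_dotProduct_q hs (hgd.isRankOne hr (Nat.le_add_right _ _)) (hc t ht)]
    ring
  σ_succ t ht := by
    rw [modes_shrink hs hη.ne' hl.ne' hY (hc t ht)]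
    simp only [modes, sharpness, ← add_assoc]
    rw [hgd.c_succ_eq_mul (hgd.isRankOne hr (Nat.le_add_right _ _)) (hc t ht)]
    ring

end Run

theorem sum_eigenvalue_mul_sq {m r : ℕ} {X : Matrix (Fin r) (Fin m) ℝ} {q : Fin m → Fin m → ℝ}
    {l : Fin m → ℝ} (hq : Orthonormal ℝ fun i => (WithLp.toLp 2 (q i) : EuclideanSpace ℝ (Fin m)))
    (he : ∀ i, (Xᵀ * X) *ᵥ q i = l i • q i) (x : Fin m → ℝ) :
    ∑ i, l i * (x ⬝ᵥ q i) ^ 2 = (X *ᵥ x) ⬝ᵥ (X *ᵥ x) := by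
  rw [Matrix.dotProduct_mulVec, ← sum_dotProduct_mul_dotProduct hq]
  exact Finset.sum_congr rfl fun i _ => by rw [mulVec_vecMul_dotProduct (he i)]; ring

namespace Run

section RightSingular

variable {n d h : ℕ} {R : Run n d h}

/-- The right singular vectors of `X` that correspond to the left singular vectors `p`. They give
a second eigenbasis of `Xᵀ X`, in which the coordinates of `Y` are those of `β` along `p`. -/
noncomputable def rightSingular (R : Run n d h) (i : Fin n) : Fin n → ℝ :=
  (√(R.lam i))⁻¹ • (R.Xᵀ *ᵥ R.p i)

theorem IsSpectral.vecMul_dotProduct (hs : R.IsSpectral) (x : Fin d → ℝ) (i : Fin n) :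
    (x ᵥ* R.X) ⬝ᵥ (R.Xᵀ *ᵥ R.p i) = R.lam i * (x ⬝ᵥ R.p i) := by
  rw [← Matrix.dotProduct_mulVec, Matrix.mulVec_mulVec, hs.p_eigen, dotProduct_smul, smul_eq_mul]

theorem IsSpectral.p_dotProduct_p (hs : R.IsSpectral) (i j : Fin n) :
    R.p i ⬝ᵥ R.p j = if i = j then 1 else 0 := by
  rw [← orthonormal_iff_ite.1 hs.p_orthonormal i j, EuclideanSpace.inner_toLp_toLp, star_trivial,
    dotProduct_comm]

theorem IsSpectral.orthonormal_rightSingular (hs : R.IsSpectral) (hl : ∀ i, 0 < R.lam i) :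
    Orthonormal ℝ fun i => (WithLp.toLp 2 (R.rightSingular i) : EuclideanSpace ℝ (Fin n)) := by
  refine orthonormal_iff_ite.2 fun i j => ?_
  rw [EuclideanSpace.inner_toLp_toLp, star_trivial, rightSingular, rightSingular, smul_dotProduct,
    dotProduct_smul, Matrix.mulVec_transpose R.X (R.p j), hs.vecMul_dotProduct, hs.p_dotProduct_p,
    smul_eq_mul, smul_eq_mul]
  rcases eq_or_ne i j with rfl | hij
  · have hsqrt := Real.sqrt_pos.2 (hl i)
    simp only [if_true]
    field_simp
    rw [Real.sq_sqrt (hl i).le]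
  · rw [if_neg hij, if_neg hij.symm, mul_zero, mul_zero, mul_zero]

theorem IsSpectral.mulVec_rightSingular (hs : R.IsSpectral) (i : Fin n) :
    (R.Xᵀ * R.X) *ᵥ R.rightSingular i = R.lam i • R.rightSingular i := by
  rw [rightSingular, Matrix.mulVec_smul, ← Matrix.mulVec_mulVec, Matrix.mulVec_mulVec _ R.X,
    hs.p_eigen, Matrix.mulVec_smul, smul_comm]

theorem IsSpectral.Y_dotProduct_rightSingular_sq (hs : R.IsSpectral) {i : Fin n}
    (hl : 0 < R.lam i) : (R.Y ⬝ᵥ R.rightSingular i) ^ 2 = R.lam i * (R.β ⬝ᵥ R.p i) ^ 2 := by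
  rw [rightSingular, dotProduct_smul, Y, hs.vecMul_dotProduct, smul_eq_mul, mul_pow, inv_pow,
    Real.sq_sqrt hl.le]
  field_simp

theorem IsSpectral.sum_lam_mul_target_sq (hs : R.IsSpectral) (hl : ∀ i, 0 < R.lam i) :
    ∑ i, R.lam i * (R.β ⬝ᵥ R.p i) ^ 2 = l2norm R.Y ^ 2 := by
  rw [← sum_sq_dotProduct (hs.orthonormal_rightSingular hl)]
  exact Finset.sum_congr rfl fun i _ => (hs.Y_dotProduct_rightSingular_sq (hl i)).symm

theorem IsSpectral.sum_lam_mul_Y_sq (hs : R.IsSpectral) (hl : ∀ i, 0 < R.lam i) :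
    ∑ i, R.lam i * (R.Y ⬝ᵥ R.q i) ^ 2 = ∑ i, R.lam i ^ 2 * (R.β ⬝ᵥ R.p i) ^ 2 := by
  rw [sum_eigenvalue_mul_sq hs.q_orthonormal hs.q_eigen,
    ← sum_eigenvalue_mul_sq (hs.orthonormal_rightSingular hl) hs.mulVec_rightSingular]
  exact Finset.sum_congr rfl fun i _ => by rw [hs.Y_dotProduct_rightSingular_sq (hl i)]; ring

theorem IsSpectral.Y_dotProduct_q_sq (hs : R.IsSpectral) (hl : ∀ i, 0 < R.lam i) {i : Fin n}
    (hsimple : ∀ j, j ≠ i → R.lam j ≠ R.lam i) :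
    (R.Y ⬝ᵥ R.q i) ^ 2 = R.lam i * (R.β ⬝ᵥ R.p i) ^ 2 := by
  have hb := hs.orthonormal_rightSingular hl
  have hort (j : Fin n) (hj : j ≠ i) : R.q i ⬝ᵥ R.rightSingular j = 0 :=
    dotProduct_eq_zero_of_eigenvectors
      (by rw [Matrix.IsSymm, Matrix.transpose_mul, Matrix.transpose_transpose])
      (hs.q_eigen i) (hs.mulVec_rightSingular j) (hsimple j hj).symm
  have hY : R.Y ⬝ᵥ R.q i = (R.Y ⬝ᵥ R.rightSingular i) * (R.q i ⬝ᵥ R.rightSingular i) := by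
    rw [← sum_dotProduct_mul_dotProduct hb]
    exact Fintype.sum_eq_single i fun j hj => by rw [hort j hj, mul_zero]
  have hq : (R.q i ⬝ᵥ R.rightSingular i) ^ 2 = 1 := by
    rw [← Fintype.sum_eq_single (f := fun j => (R.q i ⬝ᵥ R.rightSingular j) ^ 2) i
        fun j hj => by rw [hort j hj, sq, mul_zero],
      sum_sq_dotProduct hb, l2norm, hs.q_orthonormal.1 i, one_pow]
  rw [hY, mul_pow, hq, mul_one, hs.Y_dotProduct_rightSingular_sq (hl i)]

end RightSingular

namespace DataAssumption

variable {n d h : ℕ} {R : Run n d h} [NeZero n] {a γ K ρ : ℝ}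

theorem lam_ge (hd : R.DataAssumption a γ K ρ) (hs : R.IsSpectral) (i : Fin n) :
    (n : ℝ) ^ a / K ≤ R.lam i := by
  obtain ⟨k, -, hkn, -, hbulk, -⟩ := hd.spectrum
  rcases le_or_gt k i with hi | hi
  · exact (hbulk i hi).1
  · exact (hbulk ⟨k, hkn⟩ le_rfl).1.trans (hs.antitone (Fin.le_def.2 hi.le))

theorem lam_pos (hd : R.DataAssumption a γ K ρ) (hs : R.IsSpectral) (hK : 0 < K) (i : Fin n) :
    0 < R.lam i := by
  have hn : (0 : ℝ) < n := Nat.cast_pos.2 (NeZero.pos n)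
  exact (by positivity : 0 < (n : ℝ) ^ a / K).trans_le (hd.lam_ge hs i)

theorem rpow_div_le_lam_div_lam_zero (hd : R.DataAssumption a γ K ρ) (hs : R.IsSpectral)
    (hK : 0 < K) (i : Fin n) : (n : ℝ) ^ a / (K ^ 2 * n) ≤ R.lam i / R.lam 0 := by
  have hn : (0 : ℝ) < n := Nat.cast_pos.2 (NeZero.pos n)
  calc (n : ℝ) ^ a / (K ^ 2 * n) = (n : ℝ) ^ a / K / (K * n) := by field_simp
    _ ≤ R.lam i / R.lam 0 := by
        gcongr
        · exact (hd.lam_pos hs hK i).le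
        · exact hd.lam_pos hs hK 0
        · exact hd.lam_ge hs i
        · exact hd.top.2

theorem Y_pos (hd : R.DataAssumption a γ K ρ) (hK : 0 < K) : 0 < l2norm R.Y := by
  have hn : (0 : ℝ) < n := Nat.cast_pos.2 (NeZero.pos n)
  exact (by positivity : 0 < √(n : ℝ) / K).trans_le hd.label.1

theorem natCast_le_Y_sq (hd : R.DataAssumption a γ K ρ) (hK : 0 < K) :
    n ≤ K ^ 2 * l2norm R.Y ^ 2 := by
  have hlabel := (div_le_iff₀ hK).1 hd.label.1
  calc (n : ℝ) = √n ^ 2 := (Real.sq_sqrt n.cast_nonneg).symm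
    _ ≤ (l2norm R.Y * K) ^ 2 := by gcongr
    _ = _ := by ring

theorem Y_sq_le (hd : R.DataAssumption a γ K ρ) : l2norm R.Y ^ 2 ≤ K ^ 2 * n := by
  calc l2norm R.Y ^ 2 ≤ (K * √n) ^ 2 := pow_le_pow_left₀ (l2norm_nonneg _) hd.label.2 2
    _ = _ := by rw [mul_pow, Real.sq_sqrt n.cast_nonneg]

theorem β_pos (hd : R.DataAssumption a γ K ρ) (hK : 0 < K) : 0 < l2norm R.β := by
  have hn : (0 : ℝ) < n := Nat.cast_pos.2 (NeZero.pos n)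
  refine (l2norm_nonneg _).lt_of_ne fun h0 => ?_
  have htarget := (hd.target 0).1
  rw [← h0, div_zero] at htarget
  exact htarget.not_gt (by positivity)

theorem β_sq_le_target_sq (hd : R.DataAssumption a γ K ρ) (hK : 0 < K) (i : Fin n) :
    l2norm R.β ^ 2 ≤ K ^ 2 * n * (R.β ⬝ᵥ R.p i) ^ 2 := by
  have hn : (0 : ℝ) < n := Nat.cast_pos.2 (NeZero.pos n)
  have htarget := (hd.target i).1
  rw [div_le_div_iff₀ (by positivity) (hd.β_pos hK), one_mul] at htarget
  calc l2norm R.β ^ 2 ≤ (|R.β ⬝ᵥ R.p i| * (K * √n)) ^ 2 :=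
        pow_le_pow_left₀ (l2norm_nonneg _) htarget 2
    _ = _ := by rw [mul_pow, mul_pow, Real.sq_sqrt hn.le, sq_abs]; ring

theorem target_sq_le_β_sq (hd : R.DataAssumption a γ K ρ) (hK : 0 < K) (i : Fin n) :
    n * (R.β ⬝ᵥ R.p i) ^ 2 ≤ K ^ 2 * l2norm R.β ^ 2 := by
  have hn : (0 : ℝ) < n := Nat.cast_pos.2 (NeZero.pos n)
  have htarget := (hd.target i).2
  rw [div_le_div_iff₀ (hd.β_pos hK) (Real.sqrt_pos.2 hn)] at htarget
  calc n * (R.β ⬝ᵥ R.p i) ^ 2 = (|R.β ⬝ᵥ R.p i| * √n) ^ 2 := by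
        rw [mul_pow, Real.sq_sqrt hn.le, sq_abs]; ring
    _ ≤ (K * l2norm R.β) ^ 2 := pow_le_pow_left₀ (by positivity) htarget 2
    _ = _ := by ring

theorem β_sq_le (hd : R.DataAssumption a γ K ρ) (hs : R.IsSpectral) (hK : 0 < K) :
    (n : ℝ) ^ a * l2norm R.β ^ 2 ≤ K ^ 5 * n := by
  have hn : (0 : ℝ) < n := Nat.cast_pos.2 (NeZero.pos n)
  have hterm (i : Fin n) : (n : ℝ) ^ a * l2norm R.β ^ 2 / (K ^ 3 * n) ≤
      R.lam i * (R.β ⬝ᵥ R.p i) ^ 2 := by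
    rw [div_le_iff₀ (by positivity)]
    calc (n : ℝ) ^ a * l2norm R.β ^ 2
        ≤ R.lam i * K * (K ^ 2 * n * (R.β ⬝ᵥ R.p i) ^ 2) :=
          mul_le_mul ((div_le_iff₀ hK).1 (hd.lam_ge hs i)) (hd.β_sq_le_target_sq hK i)
            (sq_nonneg _) (mul_nonneg (hd.lam_pos hs hK i).le hK.le)
      _ = _ := by ring
  have hsum := (Finset.sum_le_sum fun i (_ : i ∈ Finset.univ) => hterm i).trans_eq
    (hs.sum_lam_mul_target_sq (hd.lam_pos hs hK))
  rw [Finset.sum_const, Finset.card_univ, Fintype.card_fin, nsmul_eq_mul] at hsum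
  calc (n : ℝ) ^ a * l2norm R.β ^ 2
      = K ^ 3 * (n * ((n : ℝ) ^ a * l2norm R.β ^ 2 / (K ^ 3 * n))) := by field_simp
    _ ≤ K ^ 3 * (K ^ 2 * n) := by gcongr K ^ 3 * ?_; exact hsum.trans hd.Y_sq_le
    _ = _ := by ring

theorem rpow_mul_δ₁_sq_le (hd : R.DataAssumption a γ K ρ) (hs : R.IsSpectral) (hK : 0 < K)
    (hgap : ∀ i, i ≠ 0 → R.lam i < R.lam 0) : (n : ℝ) ^ a * R.δ₁ ^ 2 ≤ K ^ 10 := by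
  have hn : (0 : ℝ) < n := Nat.cast_pos.2 (NeZero.pos n)
  have hY := hd.Y_pos hK
  rw [δ₁, div_pow, sq_abs, hs.Y_dotProduct_q_sq (hd.lam_pos hs hK) fun i hi => (hgap i hi).ne,
    mul_div_assoc', div_le_iff₀ (by positivity)]
  calc (n : ℝ) ^ a * (R.lam 0 * (R.β ⬝ᵥ R.p 0) ^ 2)
      ≤ (n : ℝ) ^ a * (K * n * (R.β ⬝ᵥ R.p 0) ^ 2) := by gcongr; exact hd.top.2
    _ = (n : ℝ) ^ a * K * (n * (R.β ⬝ᵥ R.p 0) ^ 2) := by ring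
    _ ≤ (n : ℝ) ^ a * K * (K ^ 2 * l2norm R.β ^ 2) := by
        gcongr _ * ?_; exact hd.target_sq_le_β_sq hK 0
    _ = K ^ 3 * ((n : ℝ) ^ a * l2norm R.β ^ 2) := by ring
    _ ≤ K ^ 3 * (K ^ 5 * (K ^ 2 * l2norm R.Y ^ 2)) := by
        gcongr K ^ 3 * ?_
        exact (hd.β_sq_le hs hK).trans (by gcongr; exact hd.natCast_le_Y_sq hK)
    _ = _ := by ring

theorem lam_sq_le (hd : R.DataAssumption a γ K ρ) (hs : R.IsSpectral) (hK : 0 < K) (hγ : 1 < γ)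
    (i : Fin n) : R.lam i ^ 2 ≤ (K * n) ^ 2 * γ⁻¹ ^ (i : ℕ) + (K * (n : ℝ) ^ a) ^ 2 := by
  obtain ⟨k, -, -, hgeo, hbulk, -⟩ := hd.spectrum
  rcases le_or_gt k i with hi | hi
  · calc R.lam i ^ 2 ≤ (K * (n : ℝ) ^ a) ^ 2 :=
          pow_le_pow_left₀ (hd.lam_pos hs hK i).le (hbulk i hi).2 2
      _ ≤ _ := le_add_of_nonneg_left (by positivity)
  have hdecay (j : ℕ) : ∀ hj : j < n, j < k → R.lam ⟨j, hj⟩ ≤ R.lam 0 * γ⁻¹ ^ j := by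
    induction j with
    | zero => exact fun _ _ => (mul_one (R.lam 0)).ge
    | succ j ih =>
      intro hj hjk
      calc R.lam ⟨j + 1, hj⟩ ≤ R.lam ⟨j, by omega⟩ / γ := hgeo _ _ rfl hjk
        _ ≤ R.lam 0 * γ⁻¹ ^ j / γ := by gcongr; exact ih (by omega) (by omega)
        _ = _ := by ring
  calc R.lam i ^ 2 ≤ (K * n * γ⁻¹ ^ (i : ℕ)) ^ 2 :=
        pow_le_pow_left₀ (hd.lam_pos hs hK i).le
          ((hdecay i i.2 hi).trans (by gcongr; exact hd.top.2)) 2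
    _ = (K * n) ^ 2 * (γ⁻¹ ^ (i : ℕ)) ^ 2 := mul_pow _ _ _
    _ ≤ (K * n) ^ 2 * γ⁻¹ ^ (i : ℕ) := by
        gcongr
        exact pow_le_of_le_one (by positivity)
          (pow_le_one₀ (by positivity) (inv_le_one_of_one_le₀ hγ.le)) two_ne_zero
    _ ≤ _ := le_add_of_nonneg_right (sq_nonneg _)

theorem sum_lam_sq_le (hd : R.DataAssumption a γ K ρ) (hs : R.IsSpectral) (hK : 0 < K)
    (hγ : 1 < γ) :
    ∑ i, R.lam i ^ 2 ≤ K ^ 2 * ((1 - γ⁻¹)⁻¹ * n ^ 2 + n * ((n : ℝ) ^ a) ^ 2) := by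
  have hr₀ : 0 ≤ γ⁻¹ := inv_nonneg.2 (by linarith)
  have hr₁ : γ⁻¹ < 1 := inv_lt_one_of_one_lt₀ hγ
  have hgeom : ∑ i : Fin n, γ⁻¹ ^ (i : ℕ) ≤ (1 - γ⁻¹)⁻¹ := by
    rw [Fin.sum_univ_eq_sum_range (γ⁻¹ ^ ·), ← tsum_geometric_of_lt_one hr₀ hr₁]
    exact (summable_geometric_of_lt_one hr₀ hr₁).sum_le_tsum _ fun j _ => pow_nonneg hr₀ j
  calc ∑ i, R.lam i ^ 2
      ≤ ∑ i : Fin n, ((K * n) ^ 2 * γ⁻¹ ^ (i : ℕ) + (K * (n : ℝ) ^ a) ^ 2) :=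
        Finset.sum_le_sum fun i _ => hd.lam_sq_le hs hK hγ i
    _ = (K * n) ^ 2 * ∑ i : Fin n, γ⁻¹ ^ (i : ℕ) + n * (K * (n : ℝ) ^ a) ^ 2 := by
        rw [Finset.sum_add_distrib, ← Finset.mul_sum, Finset.sum_const, Finset.card_univ,
          Fintype.card_fin, nsmul_eq_mul]
    _ ≤ (K * n) ^ 2 * (1 - γ⁻¹)⁻¹ + n * (K * (n : ℝ) ^ a) ^ 2 := by gcongr
    _ = _ := by ring

theorem sum_lam_sq_mul_target_sq_le (hd : R.DataAssumption a γ K ρ) (hs : R.IsSpectral)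
    (hK : 0 < K) (hγ : 1 < γ) : ∑ i, R.lam i ^ 2 * (R.β ⬝ᵥ R.p i) ^ 2 ≤
      K ^ 9 * ((1 - γ⁻¹)⁻¹ / (n : ℝ) ^ a + (n : ℝ) ^ a / n) * n ^ 2 := by
  have hn : (0 : ℝ) < n := Nat.cast_pos.2 (NeZero.pos n)
  have hP : 0 < (n : ℝ) ^ a := by positivity
  have hβ : l2norm R.β ^ 2 ≤ K ^ 5 * n / (n : ℝ) ^ a := by
    rw [le_div_iff₀' hP]; exact hd.β_sq_le hs hK
  refine le_of_mul_le_mul_left ?_ hn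
  calc n * ∑ i, R.lam i ^ 2 * (R.β ⬝ᵥ R.p i) ^ 2
      = ∑ i, R.lam i ^ 2 * (n * (R.β ⬝ᵥ R.p i) ^ 2) := by
        rw [Finset.mul_sum]
        exact Finset.sum_congr rfl fun _ _ => by ring
    _ ≤ ∑ i, R.lam i ^ 2 * (K ^ 2 * l2norm R.β ^ 2) := by
        gcongr ∑ i, R.lam i ^ 2 * ?_ with i; exact hd.target_sq_le_β_sq hK i
    _ = (K ^ 2 * l2norm R.β ^ 2) * ∑ i, R.lam i ^ 2 := by rw [← Finset.sum_mul, mul_comm]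
    _ ≤ K ^ 2 * (K ^ 5 * n / (n : ℝ) ^ a) *
          (K ^ 2 * ((1 - γ⁻¹)⁻¹ * n ^ 2 + n * ((n : ℝ) ^ a) ^ 2)) := by
        gcongr; exact hd.sum_lam_sq_le hs hK hγ
    _ = _ := by field_simp

theorem modes_sum_sq_le (hd : R.DataAssumption a γ K ρ) (hs : R.IsSpectral) (hK : 0 < K)
    (hγ : 1 < γ) (T : ℕ) : ∑ i, ((R.modes T).ℓ i * (R.modes T).y i) ^ 2 ≤
      K ^ 12 * ((1 - γ⁻¹)⁻¹ / (n : ℝ) ^ a + (n : ℝ) ^ a / n) := by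
  have hl := hd.lam_pos hs hK
  have hY := hd.Y_pos hK
  have hΓ : 0 ≤ (1 - γ⁻¹)⁻¹ := inv_nonneg.2 (sub_nonneg.2 (inv_le_one_of_one_le₀ hγ.le))
  have hmode (i : Fin n) : (R.lam i / R.lam 0 * (R.Y ⬝ᵥ R.q i / l2norm R.Y)) ^ 2 ≤
      R.lam i * (R.Y ⬝ᵥ R.q i) ^ 2 / (R.lam 0 * l2norm R.Y ^ 2) := by
    have hle : R.lam i / R.lam 0 ≤ 1 := (div_le_one (hl 0)).2 (hs.antitone (Fin.zero_le i))
    calc (R.lam i / R.lam 0 * (R.Y ⬝ᵥ R.q i / l2norm R.Y)) ^ 2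
        = (R.lam i / R.lam 0) ^ 2 * (R.Y ⬝ᵥ R.q i / l2norm R.Y) ^ 2 := mul_pow _ _ _
      _ ≤ R.lam i / R.lam 0 * (R.Y ⬝ᵥ R.q i / l2norm R.Y) ^ 2 := by
          gcongr
          exact pow_le_of_le_one (div_nonneg (hl i).le (hl 0).le) hle two_ne_zero
      _ = _ := by rw [div_pow, div_mul_div_comm]
  have hscale : (n : ℝ) ^ 2 ≤ K ^ 3 * (R.lam 0 * l2norm R.Y ^ 2) :=
    calc (n : ℝ) ^ 2 = n * n := sq _
      _ ≤ R.lam 0 * K * (K ^ 2 * l2norm R.Y ^ 2) :=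
          mul_le_mul ((div_le_iff₀ hK).1 hd.top.1) (hd.natCast_le_Y_sq hK) n.cast_nonneg
            (mul_pos (hl 0) hK).le
      _ = _ := by ring
  calc ∑ i, ((R.modes T).ℓ i * (R.modes T).y i) ^ 2
      ≤ ∑ i, R.lam i * (R.Y ⬝ᵥ R.q i) ^ 2 / (R.lam 0 * l2norm R.Y ^ 2) := by
        rw [Fintype.sum_eq_add_sum_subtype_ne
          (fun i => R.lam i * (R.Y ⬝ᵥ R.q i) ^ 2 / (R.lam 0 * l2norm R.Y ^ 2)) 0]
        exact (Finset.sum_le_sum fun i (_ : i ∈ Finset.univ) => hmode i.1).trans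
          (le_add_of_nonneg_left ((sq_nonneg _).trans (hmode 0)))
    _ = (∑ i, R.lam i ^ 2 * (R.β ⬝ᵥ R.p i) ^ 2) / (R.lam 0 * l2norm R.Y ^ 2) := by
        rw [← Finset.sum_div, hs.sum_lam_mul_Y_sq hl]
    _ ≤ K ^ 9 * ((1 - γ⁻¹)⁻¹ / (n : ℝ) ^ a + (n : ℝ) ^ a / n) *
          (K ^ 3 * (R.lam 0 * l2norm R.Y ^ 2)) / (R.lam 0 * l2norm R.Y ^ 2) := by
        gcongr
        · exact (mul_pos (hl 0) (pow_pos hY 2)).le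
        · exact (hd.sum_lam_sq_mul_target_sq_le hs hK hγ).trans (by gcongr)
    _ = _ := by
        have := hl 0
        field_simp

end DataAssumption

end Run

/-- All quantities that vanish as `n → ∞` are below the accuracy `θ`, and `θ` is itself small.
Besides the `o(1)` terms `ρ` of the assumptions, these are the bounds for the step size `η`, for
`δ₁²` and for `∑ (λ_i / λ₁)² ⟨Y, q_i⟩² / ‖Y‖²`. -/
structure IsAccuracy (n : ℕ) (a γ K ρ θ : ℝ) : Prop where
  pos : 0 < θ
  small : 200 * (K ^ 7) ^ 4 * θ ≤ 1
  ρ_le : ρ ≤ θ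
  rate_le : K * (n : ℝ) ^ (-(1 - a) / 2) ≤ θ
  lead_le : K ^ 10 / (n : ℝ) ^ a ≤ θ ^ 4
  tail_le : K ^ 12 * ((1 - γ⁻¹)⁻¹ / (n : ℝ) ^ a + (n : ℝ) ^ a / n) ≤ θ ^ 2

theorem eventually_isAccuracy {a K θ : ℝ} (γ : ℝ) (ha₀ : 0 < a) (ha₁ : a < 1) (hθ : 0 < θ)
    (hθK : 200 * (K ^ 7) ^ 4 * θ ≤ 1) {ρ : ℕ → ℝ} (hρ : Tendsto ρ atTop (𝓝 0)) :
    ∀ᶠ n : ℕ in atTop, IsAccuracy n a γ K (ρ n) θ := by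
  have hpow (b : ℝ) (hb : 0 < b) : Tendsto (fun n : ℕ => (n : ℝ) ^ (-b)) atTop (𝓝 0) :=
    (tendsto_rpow_neg_atTop hb).comp tendsto_natCast_atTop_atTop
  have hrate := (hpow ((1 - a) / 2) (by linarith)).const_mul K
  have hlead := (hpow a ha₀).const_mul (K ^ 10)
  have htail := (((hpow a ha₀).const_mul (1 - γ⁻¹)⁻¹).add
    (hpow (1 - a) (by linarith))).const_mul (K ^ 12)
  simp only [mul_zero, add_zero] at hrate hlead htail
  filter_upwards [hρ.eventually_le_const hθ, hrate.eventually_le_const hθ,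
    hlead.eventually_le_const (pow_pos hθ 4), htail.eventually_le_const (pow_pos hθ 2),
    eventually_ne_atTop 0] with n hn_ρ hn_rate hn_lead hn_tail hn₀
  rw [Real.rpow_neg n.cast_nonneg, ← div_eq_mul_inv] at hn_lead
  rw [Real.rpow_neg n.cast_nonneg, ← div_eq_mul_inv, neg_sub,
    Real.rpow_sub_one (Nat.cast_ne_zero.2 hn₀)] at hn_tail
  exact ⟨hθ, hθK, hn_ρ, by rwa [neg_div], hn_lead, hn_tail⟩

namespace IsAccuracy

variable {n : ℕ} {a γ K ρ θ : ℝ}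

theorem mul_le_one (hθ : IsAccuracy n a γ K ρ θ) {x : ℝ} (hx : x ≤ θ) :
    100 * (K ^ 7) ^ 4 * x ≤ 1 := by
  have hK4 : 100 * (K ^ 7) ^ 4 * x ≤ 100 * (K ^ 7) ^ 4 * θ :=
    mul_le_mul_of_nonneg_left hx (by positivity)
  linarith [hθ.small]

theorem le_one (hθ : IsAccuracy n a γ K ρ θ) (hK : 1 ≤ K) : θ ≤ 1 := by
  have hK4 : 1 ≤ (K ^ 7) ^ 4 := one_le_pow₀ (one_le_pow₀ hK)
  nlinarith [hθ.small, hθ.pos]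

end IsAccuracy

namespace Run

variable {n d h : ℕ} {R : Run n d h} {t : ℕ}

theorem δ₀_nonneg (R : Run n d h) (T : ℕ) : 0 ≤ R.δ₀ T :=
  div_nonneg (l2norm_nonneg _) (l2norm_nonneg _)

theorem IsRankOne.cosAngle_v (hr : R.IsRankOne t) (hc : 0 < R.c t) (x : Fin n → ℝ) :
    cosAngle (R.v t) x = cosAngle (R.F t) x := by
  rw [hr.F_eq, cosAngle_smul_left hc]

theorem IsRankOne.c_ne_zero_of_F_ne_zero (hr : R.IsRankOne t) (hF : R.F t ≠ 0) : R.c t ≠ 0 :=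
  fun hc => hF (by rw [hr.F_eq, hc, zero_smul])

theorem IsRankOne.c_ne_zero_of_corr_ne_zero (hr : R.IsRankOne t) (h : R.E t ⬝ᵥ R.F t ≠ 0) :
    R.c t ≠ 0 :=
  hr.c_ne_zero_of_F_ne_zero fun hF => h (by rw [hF, dotProduct_zero])

theorem F_ne_zero_of_δ₀_lt_one (hY : l2norm R.Y ≠ 0) (hδ : R.δ₀ t < 1) : R.F t ≠ 0 := by
  intro hF
  rw [δ₀, E, hF, zero_sub, l2norm_neg, div_self hY] at hδ
  exact lt_irrefl _ hδ

variable [NeZero n] {a γ K ρ θ : ℝ} {t₀ t₁ t₂ T₁ T N : ℕ}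

theorem IsGD.c_succ_sq_lt (hgd : R.IsGD) (hr : R.IsRankOne t) (hc : R.c t ≠ 0)
    (h₀ : 0 < R.shrink t) (h₂ : R.shrink t < 2) : R.c (t + 1) ^ 2 < R.c t ^ 2 := by
  rw [hgd.c_succ_eq_mul hr hc, mul_pow]
  exact mul_lt_of_lt_one_right (by positivity) (by nlinarith)

theorem δ₁_nonneg (R : Run n d h) : 0 ≤ R.δ₁ := div_nonneg (abs_nonneg _) (l2norm_nonneg _)

theorem δ₂_nonneg (R : Run n d h) (T : ℕ) : 0 ≤ R.δ₂ T := (R.δ₀_nonneg T).trans (le_max_left _ _)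

theorem δ₁_le_δ₂_sq (R : Run n d h) (T : ℕ) : R.δ₁ ≤ R.δ₂ T ^ 2 :=
  calc R.δ₁ = √R.δ₁ ^ 2 := (Real.sq_sqrt R.δ₁_nonneg).symm
    _ ≤ _ := pow_le_pow_left₀ (Real.sqrt_nonneg _) (le_max_right _ _) 2

theorem abs_modes_y₀ (R : Run n d h) (T : ℕ) : |(R.modes T).y₀| = R.δ₁ := by
  simp only [modes, abs_div, abs_of_nonneg (l2norm_nonneg R.Y), δ₁]

theorem two_lt_modes_σ (hη : 0 < R.η) (h : 2 / R.η < R.sharpness (T + t)) :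
    2 < (R.modes T).σ t := (div_lt_iff₀' hη).1 h

theorem modes_σ_lt_two (hη : 0 < R.η) (h : R.sharpness (T + t) < 2 / R.η) :
    (R.modes T).σ t < 2 := (lt_div_iff₀' hη).1 h

theorem modes_σ_sub_two (hη : R.η ≠ 0) : (R.modes T).σ t - 2 = R.η * R.excess (T + t) := by
  rw [excess, mul_sub, mul_div_cancel₀ _ hη]
  rfl

theorem modes_corr_pos (hs : R.IsSpectral) (hY : 0 < l2norm R.Y)
    (h : 0 < R.E (T + t) ⬝ᵥ R.F (T + t)) : 0 < (R.modes T).corr t := by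
  rw [modes_corr hs]
  positivity

namespace RateAssumption

theorem η_pos (hr : R.RateAssumption a K) (hK : 0 < K) : 0 < R.η :=
  (div_pos (Real.rpow_pos_of_pos (Nat.cast_pos.2 (NeZero.pos n)) _) hK).trans_le hr.1

theorem η_sq_le (hr : R.RateAssumption a K) (hK : 0 < K) :
    R.η ^ 2 ≤ K ^ 2 * ((n : ℝ) ^ a / n) := by
  have hn : (0 : ℝ) < n := Nat.cast_pos.2 (NeZero.pos n)
  have hpow : ((n : ℝ) ^ (-(1 - a) / 2)) ^ 2 = (n : ℝ) ^ a / n := by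
    rw [← Real.rpow_mul_natCast hn.le, ← Real.rpow_sub_one hn.ne']
    congr 1
    push_cast
    ring
  calc R.η ^ 2 ≤ (K * (n : ℝ) ^ (-(1 - a) / 2)) ^ 2 := pow_le_pow_left₀ (hr.η_pos hK).le hr.2 2
    _ = _ := by rw [mul_pow, hpow]

end RateAssumption

namespace Assumptions

theorem isRankOne (hA : R.Assumptions a γ K ρ t₀ T₁) (ht : t₀ ≤ t) : R.IsRankOne t :=
  hA.gd.isRankOne ⟨hA.rankOne.unit, hA.rankOne.first, hA.rankOne.second⟩ ht

theorem η_le (hA : R.Assumptions a γ K ρ t₀ T₁) (hθ : IsAccuracy n a γ K ρ θ) : R.η ≤ θ :=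
  hA.rate.2.trans hθ.rate_le

theorem lam_lt_lam_zero (hA : R.Assumptions a γ K ρ t₀ T₁) (hK : 1 ≤ K)
    (hS : R.StartsPhaseIII t₀ T₁ t₁) (i : Fin n) (hi : i ≠ 0) : R.lam i < R.lam 0 := by
  obtain ⟨ht₀, ht₁, -, -, hσ, -⟩ := hS
  have hη := hA.rate.η_pos (by linarith)
  have htail := (hA.sharp t₁ (by omega)).2 i hi
  have hlt : R.lam i / n * R.c t₁ ^ 2 < R.lam 0 / n * R.c t₁ ^ 2 :=
    htail.trans (lt_trans (by gcongr; norm_num) hσ)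
  exact (div_lt_div_iff_of_pos_right (Nat.cast_pos.2 (NeZero.pos n))).1
    (lt_of_mul_lt_mul_right hlt (sq_nonneg _))

theorem δ₂_le (hA : R.Assumptions a γ K ρ t₀ T₁) (hK : 1 ≤ K) (hS : R.StartsPhaseIII t₀ T₁ t₁)
    (hθ : IsAccuracy n a γ K ρ θ) : R.δ₂ T₁ ≤ θ := by
  have hlead := hA.data.rpow_mul_δ₁_sq_le hA.spectral (by linarith) (hA.lam_lt_lam_zero hK hS)
  have hδ₁ : R.δ₁ ^ 2 ≤ (θ ^ 2) ^ 2 := by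
    rw [← pow_mul]
    refine le_trans ?_ hθ.lead_le
    rwa [le_div_iff₀' (Real.rpow_pos_of_pos (Nat.cast_pos.2 (NeZero.pos n)) a)]
  exact max_le (hA.loss.2.trans hθ.ρ_le)
    ((Real.sqrt_le_left hθ.pos.le).2 (le_of_sq_le_sq hδ₁ (by positivity)))

theorem δ₁_le_mul_sq (hA : R.Assumptions a γ K ρ t₀ T₁) (hK : 1 ≤ K)
    (hS : R.StartsPhaseIII t₀ T₁ t₁) {m : ℝ} (hm : 1 ≤ m * (n : ℝ) ^ (a / 4)) :
    R.δ₁ ≤ K ^ 5 * m ^ 2 := by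
  have hn : (0 : ℝ) < n := Nat.cast_pos.2 (NeZero.pos n)
  have hlead := hA.data.rpow_mul_δ₁_sq_le hA.spectral (by linarith) (hA.lam_lt_lam_zero hK hS)
  have hpow : (n : ℝ) ^ a = ((n : ℝ) ^ (a / 4)) ^ 4 := by
    rw [← Real.rpow_mul_natCast hn.le]
    congr 1
    push_cast
    ring
  rw [hpow] at hlead
  set Q := (n : ℝ) ^ (a / 4)
  have hδQ : R.δ₁ * Q ^ 2 ≤ K ^ 5 := by
    refine le_of_sq_le_sq ?_ (by positivity)
    linarith
  calc R.δ₁ ≤ R.δ₁ * (m * Q) ^ 2 := le_mul_of_one_le_right R.δ₁_nonneg (one_le_pow₀ hm)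
    _ = R.δ₁ * Q ^ 2 * m ^ 2 := by ring
    _ ≤ K ^ 5 * m ^ 2 := mul_le_mul_of_nonneg_right hδQ (sq_nonneg _)

theorem c_ne_zero (hA : R.Assumptions a γ K ρ t₀ T₁) (hK : 1 ≤ K)
    (hS : R.StartsPhaseIII t₀ T₁ (T₁ + T)) (hθ : IsAccuracy n a γ K ρ θ)
    (hcorr : ∀ s, T ≤ s → s ≤ N → 0 < R.E (T₁ + s) ⬝ᵥ R.F (T₁ + s)) (ht : t ≤ N) :
    R.c (T₁ + t) ≠ 0 := by
  obtain ⟨hT₁, -, -, hII, -⟩ := hS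
  have hr : R.IsRankOne (T₁ + t) := hA.isRankOne (by omega)
  rcases lt_or_ge t T with h | h
  · rcases Nat.eq_zero_or_pos t with rfl | h₀
    · have hδ : R.δ₀ T₁ < 1 := by
        have hK4 : 1 ≤ (K ^ 7) ^ 4 := one_le_pow₀ (one_le_pow₀ hK)
        nlinarith [hA.loss.2, hθ.ρ_le, hθ.small, hθ.pos]
      exact hr.c_ne_zero_of_F_ne_zero
        (F_ne_zero_of_δ₀_lt_one (hA.data.Y_pos (by linarith)).ne' hδ)
    · intro hc
      have hσ := (hII (T₁ + t) (by omega) (by omega)).1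
      rw [sharpness, hc, zero_pow two_ne_zero, mul_zero] at hσ
      exact hσ.not_ge (div_nonneg zero_le_two (hA.rate.η_pos (by linarith)).le)
  · exact hr.c_ne_zero_of_corr_ne_zero (hcorr t h ht).ne'

theorem isTrajectory_modes (hA : R.Assumptions a γ K ρ t₀ T₁) (hK : 1 ≤ K)
    (hS : R.StartsPhaseIII t₀ T₁ (T₁ + T)) (hθ : IsAccuracy n a γ K ρ θ)
    (hcorr : ∀ s, T ≤ s → s ≤ N → 0 < R.E (T₁ + s) ⬝ᵥ R.F (T₁ + s)) :
    (R.modes T₁).IsTrajectory N :=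
  have hK₀ : 0 < K := by linarith
  Run.isTrajectory_modes hA.gd hA.spectral (hA.isRankOne hS.1) (hA.rate.η_pos hK₀)
    (hA.data.lam_pos hA.spectral hK₀ 0) (hA.data.Y_pos hK₀).ne'
    fun _ => hA.c_ne_zero hK hS hθ hcorr

theorem modes_M_le (hA : R.Assumptions a γ K ρ t₀ T₁) (hK : 0 < K) (T : ℕ) :
    (R.modes T).M ≤ K ^ 3 * R.η ^ 2 := by
  have hn : (0 : ℝ) < n := Nat.cast_pos.2 (NeZero.pos n)
  refine (div_le_iff₀ (by positivity)).2 ?_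
  calc R.η ^ 2 * R.lam 0 * l2norm R.Y ^ 2 ≤ R.η ^ 2 * (K * n) * (K ^ 2 * n) := by
        gcongr
        · exact hA.data.top.2
        · exact hA.data.Y_sq_le
    _ = _ := by ring

theorem modes_loss_le (hA : R.Assumptions a γ K ρ t₀ T₁) (hK : 0 < K) (hT : t₀ ≤ T) (t : ℕ) :
    (R.modes T).loss t ≤ K ^ 3 / R.η := by
  have hη := hA.rate.η_pos hK
  have hY := hA.data.Y_pos hK
  rw [modes_loss hA.spectral, div_le_iff₀ (by positivity)]
  calc l2norm (R.E (T + t)) ^ 2 ≤ K * (n / R.η) := hA.loss.1 (T + t) (by omega)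
    _ ≤ K * (K ^ 2 * l2norm R.Y ^ 2 / R.η) := by
        gcongr
        exact hA.data.natCast_le_Y_sq hK
    _ = _ := by ring

theorem isBounded_modes (hA : R.Assumptions a γ K ρ t₀ T₁) (hK : 1 ≤ K) (hT : t₀ ≤ T)
    (hθ : IsAccuracy n a γ K ρ θ) :
    (R.modes T).IsBounded (K ^ 7) R.η ((n : ℝ) ^ a / (K ^ 2 * n)) := by
  have hK₀ : 0 < K := by linarith
  have hn : (0 : ℝ) < n := Nat.cast_pos.2 (NeZero.pos n)
  have hη := hA.rate.η_pos hK₀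
  have hlam := hA.data.lam_pos hA.spectral hK₀ 0
  have hY := hA.data.Y_pos hK₀
  have hM := hA.modes_M_le hK₀ T
  have hratio (i : Fin n) := hA.data.rpow_div_le_lam_div_lam_zero hA.spectral hK₀ i
  have hratio_le_one (i : Fin n) : R.lam i / R.lam 0 ≤ 1 :=
    (div_le_one hlam).2 (hA.spectral.antitone (Fin.zero_le i))
  have hK37 : K ^ 3 ≤ K ^ 7 := pow_le_pow_right₀ hK (by norm_num)
  exact
    { one_le := one_le_pow₀ hK
      η_pos := hη
      η_small := hθ.mul_le_one (hA.η_le hθ)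
      M_pos := by simp only [modes]; positivity
      M_le := hM.trans (by gcongr)
      M_le_mul_μ :=
        calc (R.modes T).M ≤ K ^ 3 * R.η ^ 2 := hM
          _ ≤ K ^ 3 * (K ^ 2 * ((n : ℝ) ^ a / n)) :=
            mul_le_mul_of_nonneg_left (hA.rate.η_sq_le hK₀) (by positivity)
          _ = K ^ 7 * ((n : ℝ) ^ a / (K ^ 2 * n)) := by field_simp
      μ_pos := by positivity
      μ_le_one := (hratio 0).trans (hratio_le_one 0)
      μ_le_ℓ := fun i => hratio i
      ℓ_le_one := fun i => hratio_le_one i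
      y_unit := modes_y_unit hA.spectral hY.ne' T
      σ_le := fun t => ((le_div_iff₀' hη).1 (hA.sharp (T + t) (by omega)).1).trans
        (le_self_pow₀ hK (by norm_num))
      ℓ_mul_σ_le_one := fun t i => by
        rw [modes_ℓ_mul_σ hlam.ne']
        exact ((lt_div_iff₀' hη).1 ((hA.sharp (T + t) (by omega)).2 i i.2)).le
      loss_le := fun t => (hA.modes_loss_le hK₀ hT t).trans (by gcongr) }

theorem isSharpening_modes (hA : R.Assumptions a γ K ρ t₀ T₁) (hK : 1 ≤ K)
    (hS : R.StartsPhaseIII t₀ T₁ (T₁ + T)) (hθ : IsAccuracy n a γ K ρ θ) :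
    (R.modes T₁).IsSharpening (K ^ 7) R.η ((n : ℝ) ^ a / (K ^ 2 * n)) (R.δ₂ T₁) T := by
  have hK₀ : 0 < K := by linarith
  have hn : (0 : ℝ) < n := Nat.cast_pos.2 (NeZero.pos n)
  have hη := hA.rate.η_pos hK₀
  have hlam := hA.data.lam_pos hA.spectral hK₀ 0
  have hmono (t : ℕ) (hc : R.c (T₁ + t) ^ 2 < R.c (T₁ + t + 1) ^ 2) :
      (R.modes T₁).σ t < (R.modes T₁).σ (t + 1) :=
    mul_lt_mul_of_pos_left (mul_lt_mul_of_pos_left hc (by positivity)) hη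
  have htraj : (R.modes T₁).IsTrajectory T := hA.isTrajectory_modes hK hS hθ fun s h₁ h₂ => by
    obtain rfl := le_antisymm h₁ h₂
    exact hS.2.2.2.2.2
  obtain ⟨hT₁, hT, hI, hII, hIII⟩ := hS
  exact
    { toIsBounded := hA.isBounded_modes hK hT₁ hθ
      toIsTrajectory := htraj
      T_pos := by omega
      δ_nonneg := R.δ₂_nonneg T₁
      δ_small := hθ.mul_le_one (hA.δ₂_le hK ⟨hT₁, hT, hI, hII, hIII⟩ hθ)
      abs_y₀_le := (R.abs_modes_y₀ T₁).trans_le (R.δ₁_le_δ₂_sq T₁)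
      loss_zero_le := by
        rw [modes_loss hA.spectral, add_zero, ← div_pow]
        exact pow_le_pow_left₀ (R.δ₀_nonneg T₁) (le_max_left _ _) 2
      σ_zero_lt := modes_σ_lt_two hη hI.1
      σ_zero_lt_σ_one := hmono 0 hI.2
      grow := fun t h₀ ht =>
        have hphase := hII (T₁ + t) (by omega) (by omega)
        ⟨two_lt_modes_σ hη hphase.1, hmono t hphase.2⟩
      two_lt_σ_last := two_lt_modes_σ hη hIII.1 }

theorem second_layer_falls (hA : R.Assumptions a γ K ρ t₀ T₁) (hK : 1 ≤ K) (hT : t₀ ≤ T)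
    (hθ : IsAccuracy n a γ K ρ θ) (hIII : R.PhaseIII (T + t)) :
    R.c (T + t + 1) ^ 2 < R.c (T + t) ^ 2 := by
  have hK₀ : 0 < K := by linarith
  have hη := hA.rate.η_pos hK₀
  have hY := hA.data.Y_pos hK₀
  have hB := hA.isBounded_modes hK hT hθ
  have hr : R.IsRankOne (T + t) := hA.isRankOne (by omega)
  have hc := hr.c_ne_zero_of_corr_ne_zero hIII.2.ne'
  have hσ := two_lt_modes_σ hη hIII.1
  have hshrink₀ : 0 < (R.modes T).shrink t :=
    mul_pos (div_pos hB.M_pos (by linarith)) (modes_corr_pos hA.spectral hY hIII.2)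
  have hshrink₁ := abs_le.1 (hB.abs_shrink_le_quarter (by linarith))
  rw [modes_shrink hA.spectral hη.ne' (hA.data.lam_pos hA.spectral hK₀ 0).ne' hY.ne' hc]
    at hshrink₀ hshrink₁
  exact hA.gd.c_succ_sq_lt hr hc hshrink₀ (by linarith [hshrink₁.2])

end Assumptions

theorem InPhaseIV.phaseIII_or_phaseIV (hIV : R.InPhaseIV t₁ t₂) (h₁ : t₁ ≤ t) (h₂ : t ≤ t₂) :
    R.PhaseIII t ∨ R.PhaseIV t := by
  obtain ⟨T₃, hIII, -, hIV⟩ := hIV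
  rcases le_or_gt t T₃ with h | h
  exacts [Or.inl (hIII.2 t h₁ h), Or.inr (hIV t h h₂)]

theorem InPhaseIV.corr_pos (hIV : R.InPhaseIV t₁ t₂) (h₁ : t₁ ≤ t) (h₂ : t ≤ t₂) :
    0 < R.E t ⬝ᵥ R.F t :=
  (hIV.phaseIII_or_phaseIV h₁ h₂).elim And.right And.right

theorem InPhaseIV.le (hIV : R.InPhaseIV t₁ t₂) : t₁ ≤ t₂ :=
  let ⟨_, hIII, h, _⟩ := hIV
  hIII.1.trans h.le

theorem InPhaseIV.phaseIV (hIV : R.InPhaseIV t₁ t₂) : R.PhaseIV t₂ :=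
  let ⟨_, _, h, hIV⟩ := hIV
  hIV t₂ h le_rfl

namespace Assumptions

theorem first_layer_grows (hA : R.Assumptions a γ K ρ t₀ T₁) (ha : 0 ≤ a) (hK : 1 ≤ K)
    (hS : R.StartsPhaseIII t₀ T₁ (T₁ + T)) (hθ : IsAccuracy n a γ K ρ θ)
    (hIII : R.InPhaseIII (T₁ + T) (T₁ + t)) {c₁ C : ℝ} (hc₁ : 0 < c₁) (hC₁ : 1 ≤ C)
    (hC : 2 * K ^ 7 / c₁ + 1680 * (K ^ 7) ^ 4 / c₁ ^ 2 ≤ C)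
    (hE : c₁ * (R.δ₂ T₁ * l2norm R.Y) ≤ |R.E (T₁ + t) ⬝ᵥ R.q 0|)
    (hexcess : C * max 1 (1 / (R.η * (n : ℝ) ^ (a / 4))) < R.excess (T₁ + t)) :
    l2norm (R.v (T₁ + t)) ^ 2 < l2norm (R.v (T₁ + t + 1)) ^ 2 := by
  have hK₀ : 0 < K := by linarith
  have hη := hA.rate.η_pos hK₀
  have hY := hA.data.Y_pos hK₀
  have hlam := hA.data.lam_pos hA.spectral hK₀ 0
  have hroot : 1 ≤ (n : ℝ) ^ (a / 4) :=
    Real.one_le_rpow (Nat.one_le_cast.2 (NeZero.one_le)) (by linarith)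
  have hphase (s : ℕ) (h₁ : T ≤ s) (h₂ : s ≤ t) : R.PhaseIII (T₁ + s) :=
    hIII.2 _ (by omega) (by omega)
  have hTt : T ≤ t := Nat.le_of_add_le_add_left hIII.1
  set m := R.η * max 1 (1 / (R.η * (n : ℝ) ^ (a / 4))) with hm_def
  have hm : m = max R.η (1 / (n : ℝ) ^ (a / 4)) := by
    rw [hm_def, mul_max_of_nonneg _ _ hη.le, mul_one]
    congr 1
    field_simp
  have hηm : R.η ≤ m := hm ▸ le_max_left _ _
  have hm₁ : m ≤ 1 := hm ▸ max_le ((hA.η_le hθ).trans (hθ.le_one hK))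
    ((div_le_one (by linarith)).2 hroot)
  have hδ₁ : |(R.modes T₁).y₀| ≤ K ^ 7 * m ^ 2 := by
    rw [abs_modes_y₀]
    refine (hA.δ₁_le_mul_sq hK hS ((div_le_iff₀ (by linarith)).1 (hm ▸ le_max_right _ _))).trans ?_
    gcongr
    norm_num
  have hgain := (hA.isSharpening_modes hK hS hθ).first_layer_grows
    (hA.isTrajectory_modes hK hS hθ fun s h₁ h₂ => (hphase s h₁ h₂).2) hTt le_rfl
    (fun s h₁ h₂ => ⟨two_lt_modes_σ hη (hphase s h₁ h₂).1,
      modes_corr_pos hA.spectral hY (hphase s h₁ h₂).2⟩) hδ₁ hηm hm₁ hc₁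
    (by
      simp only [modes, abs_div, abs_of_pos hY]
      rwa [le_div_iff₀ hY, mul_assoc])
    (by
      rw [modes_σ_sub_two hη.ne', hm_def, mul_left_comm]
      exact mul_lt_mul_of_pos_left hexcess hη) hC₁ hC
  have hgrowth := modes_v_growth hA.gd hA.spectral
    (hA.isRankOne (hS.1.trans (Nat.le_add_right _ t))) hlam.ne' hY.ne'
  have hpos := hgrowth.trans_gt (mul_pos (by positivity) hgain)
  exact sub_pos.1 (pos_of_mul_pos_right hpos (sq_nonneg _))

theorem one_le_modes_σ (hA : R.Assumptions a γ K ρ t₀ T₁) (hK : 1 ≤ K)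
    (hS : R.StartsPhaseIII t₀ T₁ (T₁ + T)) (hθ : IsAccuracy n a γ K ρ θ)
    (hIV : R.InPhaseIV (T₁ + T) (T₁ + N)) (hTt : T ≤ t) (htN : t ≤ N) :
    1 ≤ (R.modes T₁).σ t := by
  have hη := hA.rate.η_pos (by linarith)
  have hcorr (s : ℕ) (h₁ : T ≤ s) (h₂ : s ≤ N) : 0 < R.E (T₁ + s) ⬝ᵥ R.F (T₁ + s) :=
    hIV.corr_pos (by omega) (by omega)
  obtain ⟨T₃, hIII, -, hIV⟩ := hIV
  obtain ⟨T', rfl⟩ := Nat.exists_eq_add_of_le ((Nat.le_add_right T₁ T).trans hIII.1)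
  exact (hA.isSharpening_modes hK hS hθ).one_le_σ_of_fall
    (hA.isTrajectory_modes hK hS hθ hcorr) (Nat.le_of_add_le_add_left hIII.1)
    (fun s h₁ h₂ => two_lt_modes_σ hη (hIII.2 _ (by omega) (by omega)).1)
    (fun s h₁ h₂ => modes_σ_lt_two hη (hIV _ (by omega) (by omega)).1)
    (fun s h₁ h₂ => modes_corr_pos hA.spectral (hA.data.Y_pos (by linarith)) (hcorr s h₁ h₂))
    hTt htN

theorem shrink_lt_one (hA : R.Assumptions a γ K ρ t₀ T₁) (hK : 1 ≤ K)
    (hS : R.StartsPhaseIII t₀ T₁ (T₁ + T)) (hθ : IsAccuracy n a γ K ρ θ)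
    (hIV : R.InPhaseIV (T₁ + T) (T₁ + N)) (ht : t ≤ N) : (R.modes T₁).shrink t < 1 := by
  have hsharp := hA.isSharpening_modes hK hS hθ
  rcases lt_or_ge t T with h | h
  · exact (hsharp.shrink_neg h).trans one_pos
  · linarith [(abs_le.1 (hsharp.abs_shrink_le_quarter (hA.one_le_modes_σ hK hS hθ hIV h ht))).2]

theorem c_pos (hA : R.Assumptions a γ K ρ t₀ T₁) (hK : 1 ≤ K)
    (hS : R.StartsPhaseIII t₀ T₁ (T₁ + T)) (hθ : IsAccuracy n a γ K ρ θ)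
    (hIV : R.InPhaseIV (T₁ + T) (T₁ + N)) (hc : 0 < R.c T₁) (ht : t ≤ N) :
    0 < R.c (T₁ + t) := by
  induction t with
  | zero => exact hc
  | succ t ih =>
    have hK₀ : 0 < K := by linarith
    have hct := ih (Nat.le_of_succ_le ht)
    have hshrink := hA.shrink_lt_one hK hS hθ hIV (Nat.le_of_succ_le ht)
    rw [modes_shrink hA.spectral (hA.rate.η_pos hK₀).ne' (hA.data.lam_pos hA.spectral hK₀ 0).ne'
      (hA.data.Y_pos hK₀).ne' hct.ne'] at hshrink
    have hr : R.IsRankOne (T₁ + t) := hA.isRankOne (hS.1.trans (Nat.le_add_right _ _))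
    rw [← add_assoc, hA.gd.c_succ_eq_mul hr hct.ne']
    exact mul_pos hct (by linarith)

theorem E_sq_le (hA : R.Assumptions a γ K ρ t₀ T₁) (hK : 1 ≤ K)
    (hS : R.StartsPhaseIII t₀ T₁ (T₁ + T)) (hθ : IsAccuracy n a γ K ρ θ) :
    l2norm (R.E (T₁ + T)) ^ 2 ≤ 50 * (K ^ 7) ^ 2 * R.δ₂ T₁ * l2norm R.Y ^ 2 := by
  have hY := hA.data.Y_pos (by linarith)
  have hloss := (hA.isSharpening_modes hK hS hθ).loss_last_le
  rwa [modes_loss hA.spectral, div_le_iff₀ (by positivity)] at hloss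

theorem mul_δ₂_le_quarter (hA : R.Assumptions a γ K ρ t₀ T₁) (hK : 1 ≤ K)
    (hS : R.StartsPhaseIII t₀ T₁ t₁) (hθ : IsAccuracy n a γ K ρ θ) :
    50 * (K ^ 7) ^ 2 * R.δ₂ T₁ ≤ 1 / 4 := by
  have hpow : (K ^ 7) ^ 2 ≤ (K ^ 7) ^ 4 := pow_le_pow_right₀ (one_le_pow₀ hK) (by norm_num)
  calc 50 * (K ^ 7) ^ 2 * R.δ₂ T₁ ≤ 50 * (K ^ 7) ^ 4 * θ := by
        gcongr
        · exact R.δ₂_nonneg T₁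
        · exact hA.δ₂_le hK hS hθ
    _ ≤ 1 / 4 := by linarith [hθ.small]

theorem one_sub_le_cosAngle_v (hA : R.Assumptions a γ K ρ t₀ T₁) (hK : 1 ≤ K)
    (hS : R.StartsPhaseIII t₀ T₁ t₁) (hθ : IsAccuracy n a γ K ρ θ) (ht : t₀ ≤ t)
    (hc : 0 < R.c t)
    (hE : l2norm (R.E t) ^ 2 ≤ 50 * (K ^ 7) ^ 2 * R.δ₂ T₁ * l2norm R.Y ^ 2) :
    1 - 50 * (K ^ 7) ^ 2 * R.δ₂ T₁ ≤ cosAngle (R.v t) R.Y := by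
  rw [(hA.isRankOne ht).cosAngle_v hc]
  exact one_sub_le_cosAngle (hA.data.Y_pos (by linarith))
    (mul_nonneg (by positivity) (R.δ₂_nonneg T₁))
    ((hA.mul_δ₂_le_quarter hK hS hθ).trans_lt (by norm_num)) hE

theorem modes_corr_last_le (hA : R.Assumptions a γ K ρ t₀ T₁) (hγ : 1 < γ) (hK : 1 ≤ K)
    (hS : R.StartsPhaseIII t₀ T₁ (T₁ + T)) (hθ : IsAccuracy n a γ K ρ θ) :
    (R.modes T₁).corr T ≤ 3000 * (K ^ 7) ^ 4 * θ * R.δ₂ T₁ := by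
  have hsharp := hA.isSharpening_modes hK hS hθ
  have hM : (R.modes T₁).M ≤ θ := by
    have hKη := mul_pow_mul_le_one_of_le hsharp.one_le hsharp.η_pos.le (by norm_num)
      (by norm_num : 1 ≤ 4) hsharp.η_small
    nlinarith [hsharp.M_le, hsharp.η_pos, hA.η_le hθ]
  have hδ₂ := hA.δ₂_le hK hS hθ
  refine (hsharp.corr_last_le hθ.pos.le
    ((hA.data.modes_sum_sq_le hA.spectral (by linarith) hγ T₁).trans hθ.tail_le)).trans ?_
  calc 1000 * (K ^ 7) ^ 4 * (R.δ₂ T₁ + θ + (R.modes T₁).M) * R.δ₂ T₁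
      ≤ 1000 * (K ^ 7) ^ 4 * (θ + θ + θ) * R.δ₂ T₁ := by
        gcongr
        exact R.δ₂_nonneg T₁
    _ = _ := by ring

theorem α_lt (hA : R.Assumptions a γ K ρ t₀ T₁) (hγ : 1 < γ) (hK : 1 ≤ K)
    (hS : R.StartsPhaseIII t₀ T₁ (T₁ + T)) (hθ : IsAccuracy n a γ K ρ θ)
    (hIV : R.InPhaseIV (T₁ + T) (T₁ + N)) {c₂ : ℝ} (hc₂ : 24000 * (K ^ 7) ^ 4 * θ ≤ c₂)
    (hE : l2norm (R.E (T₁ + N)) ^ 2 ≤ l2norm (R.E (T₁ + T)) ^ 2)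
    (hexcess : c₂ * (R.δ₂ T₁ / R.η) ≤ R.excess (T₁ + T)) : R.α (T₁ + T) < R.α (T₁ + N) := by
  have hK₀ : 0 < K := by linarith
  have hn : (0 : ℝ) < n := Nat.cast_pos.2 (NeZero.pos n)
  have hη := hA.rate.η_pos hK₀
  have hY := hA.data.Y_pos hK₀
  have hlam := hA.data.lam_pos hA.spectral hK₀ 0
  have hδ₂ := R.δ₂_nonneg T₁
  have hsharp := hA.isSharpening_modes hK hS hθ
  have hN : T ≤ N := Nat.le_of_add_le_add_left hIV.le
  have hα {s : ℕ} (h₁ : T ≤ s) (h₂ : s ≤ N) :=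
    have hr : R.IsRankOne (T₁ + s) := hA.isRankOne (hS.1.trans (Nat.le_add_right _ _))
    modes_α hA.spectral hr hη.ne' hlam.ne' hY.ne'
      (hr.c_ne_zero_of_corr_ne_zero (hIV.corr_pos (by omega) (by omega)).ne')
  rw [hα le_rfl hN, hα hN le_rfl]
  refine mul_lt_mul_of_pos_left (hsharp.outputSq_div_sq_lt (x := c₂ * R.δ₂ T₁) ?_ ?_ ?_
    (modes_σ_lt_two hη hIV.phaseIV.1) ?_ (modes_corr_pos hA.spectral hY hIV.phaseIV.2) ?_ ?_)
    (by positivity)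
  · exact mul_nonneg (le_trans (mul_nonneg (by positivity) hθ.pos.le) hc₂) hδ₂
  · have h := mul_le_mul_of_nonneg_left hexcess hη.le
    rw [← modes_σ_sub_two hη.ne', mul_left_comm, mul_div_cancel₀ _ hη.ne'] at h
    linarith
  · linarith [hA.one_le_modes_σ hK hS hθ hIV hN le_rfl]
  · refine (hA.modes_corr_last_le hγ hK hS hθ).trans ?_
    linarith [mul_le_mul_of_nonneg_right hc₂ hδ₂]
  · exact hsharp.loss_last_le.trans (hA.mul_δ₂_le_quarter hK hS hθ)
  · rw [modes_loss hA.spectral, modes_loss hA.spectral]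
    gcongr

end Assumptions

end Run

theorem mainTheorem1 (a γ K : ℝ) (ha₀ : 0 < a) (ha₁ : a < 1) (hγ : 1 < γ) (hK : 1 ≤ K) :
    (∀ c₁ : ℝ, 0 < c₁ → ∃ C : ℝ, 0 < C ∧
      ∀ ρ : ℕ → ℝ, Tendsto ρ atTop (𝓝 0) → ∃ N : ℕ, ∀ n : ℕ, N ≤ n → ∀ [NeZero n],
      ∀ (d h : ℕ) (R : Run n d h) (t₀ T₁ t₁ t : ℕ),
        R.Assumptions a γ K (ρ n) t₀ T₁ →
        R.StartsPhaseIII t₀ T₁ t₁ →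
        R.InPhaseIII t₁ t →
        c₁ * (R.δ₂ T₁ * l2norm R.Y) ≤ |R.E t ⬝ᵥ R.q 0| →
        C * max 1 (1 / (R.η * (n : ℝ) ^ (a / 4))) < R.excess t →
        R.c (t + 1) ^ 2 < R.c t ^ 2 ∧ l2norm (R.v t) ^ 2 < l2norm (R.v (t + 1)) ^ 2) ∧
    (∃ C : ℝ, 0 < C ∧ ∀ c₂ : ℝ, 0 < c₂ →
      ∀ ρ : ℕ → ℝ, Tendsto ρ atTop (𝓝 0) → ∃ N : ℕ, ∀ n : ℕ, N ≤ n → ∀ [NeZero n],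
      ∀ (d h : ℕ) (R : Run n d h) (t₀ T₁ t₁ t₂ : ℕ),
        R.Assumptions a γ K (ρ n) t₀ T₁ →
        -- the sign of the unit vector `u` is chosen so that `c` is positive at the end of Phase I
        0 < R.c T₁ →
        R.StartsPhaseIII t₀ T₁ t₁ →
        R.InPhaseIV t₁ t₂ →
        l2norm (R.E t₂) ^ 2 ≤ l2norm (R.E t₁) ^ 2 →
        c₂ * (R.δ₂ T₁ / R.η) ≤ R.excess t₁ →
        R.α t₁ < R.α t₂ ∧
          1 - C * R.δ₂ T₁ ≤ cosAngle (R.v t₁) R.Y ∧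
          1 - C * R.δ₂ T₁ ≤ cosAngle (R.v t₂) R.Y) := by
  have hL : 0 < (K ^ 7) ^ 4 := by positivity
  refine ⟨fun c₁ hc₁ => ⟨1 + (2 * K ^ 7 / c₁ + 1680 * (K ^ 7) ^ 4 / c₁ ^ 2), by positivity,
    fun ρ hρ => ?_⟩, 50 * (K ^ 7) ^ 2, by positivity, fun c₂ hc₂ ρ hρ => ?_⟩
  · obtain ⟨N, hN⟩ := eventually_atTop.1 (eventually_isAccuracy (K := K) γ ha₀ ha₁
      (θ := 1 / (200 * (K ^ 7) ^ 4)) (by positivity) (mul_one_div_cancel (by positivity)).le hρ)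
    refine ⟨N, fun n hn _ d h R t₀ T₁ t₁ t hA hS hIII hE hexcess => ?_⟩
    obtain ⟨T, rfl⟩ := Nat.exists_eq_add_of_le hS.2.1.le
    obtain ⟨s, rfl⟩ := Nat.exists_eq_add_of_le (hS.2.1.le.trans hIII.1)
    exact ⟨hA.second_layer_falls hK hS.1 (hN n hn) (hIII.2 _ hIII.1 le_rfl),
      hA.first_layer_grows ha₀.le hK hS (hN n hn) hIII hc₁
        (le_add_of_nonneg_right (by positivity)) (le_add_of_nonneg_left zero_le_one) hE hexcess⟩
  · obtain ⟨θ, hθ₀, hθ⟩ : ∃ θ > 0, 24000 * (K ^ 7) ^ 4 * θ = min 1 c₂ :=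
      ⟨min 1 c₂ / (24000 * (K ^ 7) ^ 4), by positivity, mul_div_cancel₀ _ (by positivity)⟩
    obtain ⟨N, hN⟩ := eventually_atTop.1 (eventually_isAccuracy (K := K) γ ha₀ ha₁ hθ₀
      (by linarith [mul_pos hL hθ₀, min_le_left 1 c₂]) hρ)
    refine ⟨N, fun n hn _ d h R t₀ T₁ t₁ t₂ hA hc hS hIV hE hexcess => ?_⟩
    obtain ⟨T, rfl⟩ := Nat.exists_eq_add_of_le hS.2.1.le
    obtain ⟨s, rfl⟩ := Nat.exists_eq_add_of_le (hS.2.1.le.trans hIV.le)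
    have hTs : T ≤ s := Nat.le_of_add_le_add_left hIV.le
    have hcos (r : ℕ) (hr : r ≤ s) :=
      hA.one_sub_le_cosAngle_v hK hS (hN n hn) (hS.1.trans (Nat.le_add_right T₁ r))
        (hA.c_pos hK hS (hN n hn) hIV hc hr)
    have hE_T := hA.E_sq_le hK hS (hN n hn)
    exact ⟨hA.α_lt hγ hK hS (hN n hn) hIV (hθ.trans_le (min_le_right 1 c₂)) hE hexcess,
      hcos T hTs hE_T, hcos s le_rfl (hE.trans hE_T)⟩
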